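/- Let $k$ be a field of characteristic $0$, $G$ a finite abelian group, and let $\mathcal D$ be a datum of a quantum linear space: elements $g_1,\dots,g_\theta\in G$ and characters $\chi_1,\dots,\chi_\theta\colon G\to k^\times$ with $\chi_i(g_j)\chi_j(g_i)=1$ for $i\ne j$ and $\chi_i(g_i)\neq 1$; let $N_i$ be the order of $\chi_i(g_i)$. Let $\mu=(\mu_i)_{1\le i\le\theta}$ and $\lambda=(\lambda_{ij})_{1\le i<j\le\theta}$ be scalars in $k$ with $\mu_i=0$ unless $\chi_i^{N_i}=\varepsilon$, and $\lambda_{ij}=0$ unless $\chi_i\chi_j=\varepsilon$. Let $u(\mathcal D,\lambda,\mu)$ be the Hopf algebra generated by the group $G$ and $x_1,\dots,x_\theta$ with relations $$hx_i=\chi_i(h)x_ih,\qquad x_ix_j-\chi_j(g_i)x_jx_i=\lambda_{ij}(1-g_ig_j)\ (i<j),\qquad x_i^{N_i}=\mu_i(1-g_i^{N_i}),$$ where $h\in G$, and with $\Delta(h)=h\otimes h$, $\Delta(x_i)=x_i\otimes 1+g_i\otimes x_i$. Put $A=u(\mathcal D,0,0)$, with PBW basis $x^ah=x_1^{a_1}\cdots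 x_\theta^{a_\theta}h$ ($0\le a_i<N_i$, $h\in G$). All products and powers of functionals below are taken with respect to the convolution product $*$. *Root vector part.* Let $\zeta_i\colon A\otimes A\to k$ be given by $\zeta_i(x^ah\otimes x^bh')=\chi_i(h)^{b_i}$ if $x^a=x_i^{a_i}$, $x^b=x_i^{b_i}$ and $a_i+b_i=N_i$, and $0$ on all other pairs of PBW monomials. Put $e^{f}=\sum_{n\ge0}f^{*n}/n!$. *Linking part.* Let $G_0\subseteq G$ be the subgroup generated by the $g_i^{N_i}\neq1$ with $\chi_i^{N_i}=\varepsilon$, let $\mathcal D'$ be the datum over $G/G_0$ induced by $\mathcal D$, and let $\pi_\mu\colon u(\mathcal D,0,\mu)\to u(\mathcal D',0,0)$ be the canonical projection ($h\mapsto hG_0$, $x_i\mapsto x_i$). On $A'=u(\mathcal D',0,0)$ let $\chi_i(x^ah)=\varepsilon(x^a)\chi_i(h)$, let $d_i$ be the skew derivation with $d_i(x_ih)=1$ and $d_i=0$ on all other PBW monomials, and put $\eta_{i,j}=(d_i*\chi_j)\otimes d_j\colon A'\otimes A'\to k$. For a root of unity $q$ of order $\ell$ put $\exp_q(f)=\sum_{m=0}^{\ell-1}f^{*m}/(m)_q!$.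 Let $$\sigma_\lambda=\prod_{i<j}\exp_{\chi_j(g_i)}(\lambda_{ij}\,\eta_{i,j})\colon A'\otimes A'\to k,\qquad \sigma_{\lambda,\mu}=\sigma_\lambda\circ(\pi_\mu\otimes\pi_\mu)\colon u(\mathcal D,0,\mu)\otimes u(\mathcal D,0,\mu)\to k$$ (the pairs $(i,j)$ in the product being taken in lexicographic order). Identify $u(\mathcal D,0,\mu)$ with $A$ as a coalgebra through the PBW monomials $x^ah$, and put $$\sigma=\sigma_{\lambda,\mu}*e^{\sum_i\mu_i\zeta_i}\colon A\otimes A\to k.$$ **Theorem.** $\sigma$ is a multiplicative $2$-cocycle: it is convolution invertible, $\sigma(1\otimes a)=\varepsilon(a)=\sigma(a\otimes1)$, and $(\varepsilon\otimes\sigma)*\sigma(1\otimes m)=(\sigma\otimes\varepsilon)*\sigma(m\otimes1)$. The cocycle deformation $A_\sigma$ — the coalgebra $A$ with its unit, the multiplication $m_\sigma=\sigma*m*\sigma^{-1}$ and the antipode $s_\sigma(a)=\sigma(a_1\otimes s(a_2))\,s(a_3)\,\sigma^{-1}(s(a_4)\otimes a_5)$ — is $u(\mathcal D,\lambda,\mu)$: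 there is an isomorphism of Hopf algebras $A_\sigma\cong u(\mathcal D,\lambda,\mu)$ with $h\mapsto h$ for $h\in G$ and $x_i\mapsto x_i$ for all $i$. Thus each of the liftings $u(\mathcal D,\lambda,\mu)$ of $A$ is obtained from $A$ by an explicit cocycle. -/

import Mathlib

open scoped TensorProduct

noncomputable section

/-! ### Multiplicative cocycles and cocycle deformations of a Hopf algebra

`WithConv (C →ₗ[k] B)` is Mathlib's convolution algebra `Hom(C, B)`; its product `*` is the
convolution product and its unit is `ε` followed by the unit of `B`. -/

namespace HopfDeformation

open Coalgebra WithConv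

variable {k H : Type*} [Field k] [Ring H] [HopfAlgebra k H]

/-- `ε ⊗ σ` on `H ⊗ (H ⊗ H)`. -/
def epsTensor (σ : WithConv (H ⊗[k] H →ₗ[k] k)) : WithConv (H ⊗[k] (H ⊗[k] H) →ₗ[k] k) :=
  toConv (LinearMap.mul' k k ∘ₗ TensorProduct.map (counit (R := k) (A := H)) σ.ofConv)

/-- `σ ⊗ ε` on `H ⊗ (H ⊗ H)`. -/
def tensorEps (σ : WithConv (H ⊗[k] H →ₗ[k] k)) : WithConv (H ⊗[k] (H ⊗[k] H) →ₗ[k] k) :=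
  toConv (LinearMap.mul' k k ∘ₗ TensorProduct.map σ.ofConv (counit (R := k) (A := H)) ∘ₗ
    (TensorProduct.assoc k H H H).symm.toLinearMap)

/-- `σ (1 ⊗ m)` on `H ⊗ (H ⊗ H)`. -/
def compIdMul (σ : WithConv (H ⊗[k] H →ₗ[k] k)) : WithConv (H ⊗[k] (H ⊗[k] H) →ₗ[k] k) :=
  toConv (σ.ofConv ∘ₗ (LinearMap.mul' k H).lTensor H)

/-- `σ (m ⊗ 1)` on `H ⊗ (H ⊗ H)`. -/
def compMulId (σ : WithConv (H ⊗[k] H →ₗ[k] k)) : WithConv (H ⊗[k] (H ⊗[k] H) →ₗ[k] k) :=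
  toConv (σ.ofConv ∘ₗ (LinearMap.mul' k H).rTensor H ∘ₗ
    (TensorProduct.assoc k H H H).symm.toLinearMap)

/-- A (normalized, convolution invertible) multiplicative 2-cocycle on `H`. -/
structure IsMulCocycle (σ : WithConv (H ⊗[k] H →ₗ[k] k)) : Prop where
  isUnit : IsUnit σ
  cocycle : epsTensor σ * compIdMul σ = tensorEps σ * compMulId σ
  one_left : ∀ a : H, σ ((1 : H) ⊗ₜ[k] a) = counit (R := k) a
  one_right : ∀ a : H, σ (a ⊗ₜ[k] (1 : H)) = counit (R := k) a

/-- A scalar valued map, regarded as a map with values in `k · 1 ⊆ H`. -/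
def toAlg {C : Type*} [AddCommGroup C] [Module k C] (H : Type*) [Ring H] [Algebra k H]
    (f : WithConv (C →ₗ[k] k)) : WithConv (C →ₗ[k] H) :=
  toConv (Algebra.linearMap k H ∘ₗ f.ofConv)

/-- The deformed multiplication `m_σ = σ * m * σ⁻¹`. -/
def deformedMul (σ : WithConv (H ⊗[k] H →ₗ[k] k)) : H ⊗[k] H →ₗ[k] H :=
  (toAlg H σ * toConv (LinearMap.mul' k H) * toAlg H (Ring.inverse σ)).ofConv

/-- The deformed antipode `s_σ = σ * s * σ⁻¹`, that is
`s_σ(h) = σ(h₁ ⊗ s(h₂)) s(h₃) σ⁻¹(s(h₄) ⊗ h₅)`. -/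
def deformedAntipode (σ : WithConv (H ⊗[k] H →ₗ[k] k)) : H →ₗ[k] H :=
  (toAlg H (toConv (σ.ofConv ∘ₗ (HopfAlgebra.antipode k (A := H)).lTensor H ∘ₗ comul)) *
    toConv (HopfAlgebra.antipode k (A := H)) *
    toAlg H (toConv ((Ring.inverse σ).ofConv ∘ₗ
      (HopfAlgebra.antipode k (A := H)).rTensor H ∘ₗ comul))).ofConv

end HopfDeformation

/-! ### `q`-numbers, the exponential and the `q`-exponential -/

section QExp

variable {k : Type*} [Field k]

/-- `(n)_q = 1 + q + ⋯ + q ^ (n - 1)`. -/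
def qNumber (q : k) (n : ℕ) : k := ∑ i ∈ Finset.range n, q ^ i

/-- `(n)!_q = (1)_q (2)_q ⋯ (n)_q`. -/
def qFactorial (q : k) (n : ℕ) : k := ∏ i ∈ Finset.range n, qNumber q (i + 1)

/-- `exp_q(x) = ∑_{m < ℓ} x ^ m / (m)!_q`, where `ℓ` is the order of the root of unity `q`. -/
def qExp {B : Type*} [Ring B] [Algebra k B] (q : k) (x : B) : B :=
  ∑ m ∈ Finset.range (orderOf q), (qFactorial q m)⁻¹ • x ^ m

/-- `e ^ f = ∑_{i ≥ 0} f ^ i / i!` for a nilpotent element `f` of a `k`-algebra (the sum then has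
only finitely many nonzero terms). -/
def nilExp (k : Type*) [Field k] {B : Type*} [Ring B] [Algebra k B] (f : B) : B :=
  ∑ᶠ i : ℕ, ((i.factorial : k))⁻¹ • f ^ i

/-- Gaussian binomial coefficients, by the `q`-Pascal rule. -/
def gaussBinom (q : k) : ℕ → ℕ → k
  | _, 0 => 1
  | 0, _ + 1 => 0
  | n + 1, i + 1 => gaussBinom q n i + q ^ (i + 1) * gaussBinom q n (i + 1)

theorem gaussBinom_zero_right (q : k) (n : ℕ) : gaussBinom q n 0 = 1 := by
  cases n <;> rfl

theorem gaussBinom_eq_zero (q : k) : ∀ n i : ℕ, n < i → gaussBinom q n i = 0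
  | _, 0, h => absurd h (Nat.not_lt_zero _)
  | 0, _ + 1, _ => rfl
  | n + 1, i + 1, h => by
    rw [gaussBinom, gaussBinom_eq_zero q n i (by omega), gaussBinom_eq_zero q n (i + 1) (by omega)]
    simp

theorem gaussBinom_self (q : k) (n : ℕ) : gaussBinom q n n = 1 := by
  induction n with
  | zero => rfl
  | succ n ih => rw [gaussBinom, ih, gaussBinom_eq_zero q n (n + 1) (by omega)]; simp

theorem qFactorial_succ (q : k) (n : ℕ) :
    qFactorial q (n + 1) = qFactorial q n * qNumber q (n + 1) := by
  rw [qFactorial, Finset.prod_range_succ]; rfl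

theorem qNumber_add (q : k) (m n : ℕ) : qNumber q (m + n) = qNumber q m + q ^ m * qNumber q n := by
  simp only [qNumber, Finset.sum_range_add, Finset.mul_sum, pow_add]

theorem gaussBinom_mul (q : k) : ∀ n i j : ℕ, i + j = n →
    gaussBinom q n i * (qFactorial q i * qFactorial q j) = qFactorial q n
  | n, 0, j, h => by
    have : j = n := by omega
    subst this
    simp [gaussBinom_zero_right, qFactorial]
  | n, i + 1, 0, h => by
    have : i + 1 = n := by omega
    subst this
    simp [gaussBinom_self, qFactorial]
  | 0, i + 1, j + 1, h => by omega
  | n + 1, i + 1, j + 1, h => by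
    have h1 := gaussBinom_mul q n i (j + 1) (by omega)
    have h2 := gaussBinom_mul q n (i + 1) j (by omega)
    have h3 : qNumber q (n + 1) = qNumber q (i + 1) + q ^ (i + 1) * qNumber q (j + 1) := by
      rw [← qNumber_add]; congr 1; omega
    rw [gaussBinom, qFactorial_succ q n, h3]
    rw [qFactorial_succ q i] at h2 ⊢
    rw [qFactorial_succ q j] at h1 ⊢
    linear_combination (qNumber q (i + 1)) * h1 + q ^ (i + 1) * qNumber q (j + 1) * h2

theorem qNumber_mul (q : k) (n : ℕ) : (q - 1) * qNumber q n = q ^ n - 1 := by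
  rw [qNumber, mul_comm, geom_sum_mul]

theorem qFactorial_ne_zero {q : k} {n m : ℕ} (hq : IsPrimitiveRoot q n) (hm : m < n) :
    qFactorial q m ≠ 0 := by
  rw [qFactorial, Finset.prod_ne_zero_iff]
  intro i hi h0
  have hi' := Finset.mem_range.1 hi
  have h := qNumber_mul q (i + 1)
  rw [h0, mul_zero] at h
  have := hq.dvd_of_pow_eq_one (i + 1) (by linear_combination -h)
  have := Nat.le_of_dvd (by omega) this
  omega

theorem gaussBinom_root {q : k} {n i : ℕ} (hq : IsPrimitiveRoot q n) (h0 : 0 < i) (hi : i < n) :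
    gaussBinom q n i = 0 := by
  have h := gaussBinom_mul q n i (n - i) (by omega)
  have hn : qFactorial q n = 0 := by
    obtain ⟨m, rfl⟩ : ∃ m, n = m + 1 := ⟨n - 1, by omega⟩
    rw [qFactorial_succ]
    have h1 : q - 1 ≠ 0 := fun h => hq.ne_one (by omega) (by linear_combination h)
    have h2 := qNumber_mul q (m + 1)
    rw [hq.pow_eq_one, sub_self] at h2
    rw [(mul_eq_zero.1 h2).resolve_left h1, mul_zero]
  rw [hn] at h
  exact (mul_eq_zero.1 h).resolve_right
    (mul_ne_zero (qFactorial_ne_zero hq hi) (qFactorial_ne_zero hq (by omega)))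

variable {B : Type*} [Ring B] [Algebra k B]

theorem mul_pow_of_qcomm {q : k} {a b : B} (h : b * a = q • (a * b)) (i : ℕ) :
    b * a ^ i = q ^ i • (a ^ i * b) := by
  induction i with
  | zero => simp
  | succ i ih =>
    rw [pow_succ, ← mul_assoc, ih, smul_mul_assoc, mul_assoc, h, mul_smul_comm, smul_smul,
      ← pow_succ, ← mul_assoc]

theorem add_pow_qcomm {q : k} {a b : B} (h : b * a = q • (a * b)) (n : ℕ) :
    (a + b) ^ n = ∑ i ∈ Finset.range (n + 1), gaussBinom q n i • (a ^ i * b ^ (n - i)) := by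
  induction n with
  | zero => simp [gaussBinom_zero_right]
  | succ n ih =>
    rw [pow_succ', ih, add_mul, Finset.mul_sum, Finset.mul_sum]
    have h1 : ∀ i, a * gaussBinom q n i • (a ^ i * b ^ (n - i)) =
        gaussBinom q n i • (a ^ (i + 1) * b ^ (n - i)) := fun i => by
      rw [mul_smul_comm, ← mul_assoc, ← pow_succ']
    have h2 : ∀ i ∈ Finset.range (n + 1), b * gaussBinom q n i • (a ^ i * b ^ (n - i)) =
        (q ^ i * gaussBinom q n i) • (a ^ i * b ^ (n + 1 - i)) := fun i hi => by
      have : n + 1 - i = (n - i) + 1 := by have := Finset.mem_range.1 hi; omega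
      rw [mul_smul_comm, ← mul_assoc, mul_pow_of_qcomm h, smul_mul_assoc, mul_assoc, ← pow_succ',
        smul_smul, mul_comm, this]
    rw [Finset.sum_congr rfl fun i _ => h1 i, Finset.sum_congr rfl h2,
      Finset.sum_range_succ' (fun i => gaussBinom q (n + 1) i • (a ^ i * b ^ (n + 1 - i))) (n + 1),
      Finset.sum_range_succ' (fun i => (q ^ i * gaussBinom q n i) • (a ^ i * b ^ (n + 1 - i))) n]
    have h3 : ∑ i ∈ Finset.range (n + 1), gaussBinom q (n + 1) (i + 1) •
        (a ^ (i + 1) * b ^ (n + 1 - (i + 1))) =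
        ∑ i ∈ Finset.range (n + 1), gaussBinom q n i • (a ^ (i + 1) * b ^ (n - i)) +
        ∑ i ∈ Finset.range n, (q ^ (i + 1) * gaussBinom q n (i + 1)) •
          (a ^ (i + 1) * b ^ (n + 1 - (i + 1))) := by
      have h4 := Finset.sum_range_succ (fun i => (q ^ (i + 1) * gaussBinom q n (i + 1)) •
          (a ^ (i + 1) * b ^ (n + 1 - (i + 1)))) n
      rw [gaussBinom_eq_zero q n (n + 1) (by omega), mul_zero, zero_smul, add_zero] at h4
      rw [← h4, ← Finset.sum_add_distrib]
      refine Finset.sum_congr rfl fun i _ => ?_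
      rw [gaussBinom, add_smul, Nat.add_sub_add_right]
    rw [h3]
    simp [gaussBinom_zero_right, add_assoc]

theorem add_pow_root {q : k} {a b : B} (h : b * a = q • (a * b)) {n : ℕ} (hn : 0 < n)
    (hq : IsPrimitiveRoot q n) : (a + b) ^ n = a ^ n + b ^ n := by
  rw [add_pow_qcomm h, Finset.sum_range_succ, gaussBinom_self]
  obtain ⟨m, rfl⟩ : ∃ m, n = m + 1 := ⟨n - 1, by omega⟩
  rw [Finset.sum_range_succ', Finset.sum_eq_zero]
  · simp [gaussBinom_zero_right, add_comm]
  · intro i hi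
    have := Finset.mem_range.1 hi
    rw [gaussBinom_root hq (by omega) (by omega), zero_smul]

theorem neg_mul_pow_root {q : k} {u x : B} (h : x * u = q • (u * x)) {n : ℕ} (hn : 0 < n)
    (hq : IsPrimitiveRoot q n) : (-(u * x)) ^ n = -(u ^ n * x ^ n) := by
  have key : ∀ m : ℕ, (u * x) ^ m = q ^ (∑ i ∈ Finset.range m, i) • (u ^ m * x ^ m) := by
    intro m
    induction m with
    | zero => simp
    | succ m ih =>
      have h1 : x ^ m * u = q ^ m • (u * x ^ m) := by
        clear ih
        induction m with
        | zero => simp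
        | succ m ih =>
          rw [pow_succ', mul_assoc, ih, mul_smul_comm, ← mul_assoc, h, smul_mul_assoc, smul_smul,
            ← pow_succ, mul_assoc]
      rw [pow_succ, ih, Finset.sum_range_succ, smul_mul_assoc, mul_assoc, ← mul_assoc (x ^ m), h1,
        smul_mul_assoc, mul_smul_comm, smul_smul, pow_add, mul_assoc, ← mul_assoc (u ^ m),
        ← pow_succ, ← pow_succ]
  have hs := Finset.sum_range_id_mul_two n
  rw [neg_pow, key]
  rcases Nat.even_or_odd' n with ⟨m, rfl | rfl⟩
  · have hq1 : q ^ m = -1 := by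
      have h1 : q ^ m * q ^ m = 1 := by rw [← pow_add, ← two_mul]; exact hq.pow_eq_one
      rcases mul_self_eq_one_iff.1 h1 with h2 | h2
      · have := Nat.le_of_dvd (by omega) (hq.dvd_of_pow_eq_one m h2)
        omega
      · exact h2
    have e : ∑ i ∈ Finset.range (2 * m), i = m * (2 * m - 1) := by
      have h3 : 2 * m * (2 * m - 1) = m * (2 * m - 1) * 2 := by ring
      omega
    have ho : Odd (2 * m - 1) := ⟨m - 1, by omega⟩
    rw [(even_two_mul m).neg_one_pow, e, pow_mul q, hq1, ho.neg_one_pow]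
    simp
  · have e : ∑ i ∈ Finset.range (2 * m + 1), i = (2 * m + 1) * m := by
      rw [Nat.add_sub_cancel] at hs
      nlinarith
    rw [e, pow_mul q, hq.pow_eq_one, one_pow, (odd_two_mul_add_one m).neg_one_pow]
    simp

end QExp

/-! ### Quantum linear spaces and the Hopf algebras `u(D, λ, μ)` -/

/-- A datum `D` of a quantum linear space over the abelian group `G`: elements `g i` of `G` and
characters `χ i` with `χ i (g j) * χ j (g i) = 1` for `i ≠ j` and `χ i (g i) ≠ 1`. -/
structure QLSDatum (k G : Type*) [Field k] [CommGroup G] (θ : ℕ) where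
  g : Fin θ → G
  χ : Fin θ → G →* kˣ
  braiding : ∀ i j, i ≠ j → χ i (g j) * χ j (g i) = 1
  nontrivial : ∀ i, χ i (g i) ≠ 1

namespace QLSDatum

open Coalgebra WithConv

variable {k G : Type*} [Field k] [CommGroup G] {θ : ℕ} (D : QLSDatum k G θ)

/-- `N i` is the order of `χ i (g i)`. -/
def N (i : Fin θ) : ℕ := orderOf (D.χ i (D.g i))

/-- The defining relations of `u(D, λ, μ)`, on generators `h ∈ G` and `x 1, …, x θ`. -/
inductive Rel (lam : Fin θ → Fin θ → k) (mu : Fin θ → k) :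
    FreeAlgebra k (G ⊕ Fin θ) → FreeAlgebra k (G ⊕ Fin θ) → Prop
  | one : Rel lam mu (FreeAlgebra.ι k (Sum.inl 1)) 1
  | mul (h h' : G) : Rel lam mu (FreeAlgebra.ι k (Sum.inl (h * h')))
      (FreeAlgebra.ι k (Sum.inl h) * FreeAlgebra.ι k (Sum.inl h'))
  | conj (h : G) (i : Fin θ) :
      Rel lam mu (FreeAlgebra.ι k (Sum.inl h) * FreeAlgebra.ι k (Sum.inr i))
        ((D.χ i h : k) • (FreeAlgebra.ι k (Sum.inr i) * FreeAlgebra.ι k (Sum.inl h)))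
  | link (i j : Fin θ) (hij : i < j) :
      Rel lam mu (FreeAlgebra.ι k (Sum.inr i) * FreeAlgebra.ι k (Sum.inr j))
        ((D.χ j (D.g i) : k) • (FreeAlgebra.ι k (Sum.inr j) * FreeAlgebra.ι k (Sum.inr i)) +
          lam i j • (1 - FreeAlgebra.ι k (Sum.inl (D.g i * D.g j))))
  | root (i : Fin θ) : Rel lam mu (FreeAlgebra.ι k (Sum.inr i) ^ D.N i)
      (mu i • (1 - FreeAlgebra.ι k (Sum.inl (D.g i ^ D.N i))))

/-- The algebra `u(D, λ, μ)` with generators `h ∈ G` and `x i`, the relations of `G`, and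
`h xᵢ = χᵢ(h) xᵢ h`, `xᵢ xⱼ - χⱼ(gᵢ) xⱼ xᵢ = λᵢⱼ (1 - gᵢ gⱼ)` for `i < j`,
`xᵢ ^ Nᵢ = μᵢ (1 - gᵢ ^ Nᵢ)`. -/
def U (lam : Fin θ → Fin θ → k) (mu : Fin θ → k) : Type _ := RingQuot (D.Rel lam mu)

variable (lam : Fin θ → Fin θ → k) (mu : Fin θ → k)

instance : Ring (D.U lam mu) := inferInstanceAs (Ring (RingQuot (D.Rel lam mu)))
instance : Algebra k (D.U lam mu) := inferInstanceAs (Algebra k (RingQuot (D.Rel lam mu)))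

/-- The canonical projection from the free algebra. -/
def fromFree : FreeAlgebra k (G ⊕ Fin θ) →ₐ[k] D.U lam mu := RingQuot.mkAlgHom k (D.Rel lam mu)

variable {D lam mu} in
theorem fromFree_rel {a b : FreeAlgebra k (G ⊕ Fin θ)} (h : D.Rel lam mu a b) :
    D.fromFree lam mu a = D.fromFree lam mu b := RingQuot.mkAlgHom_rel k h

/-- The group elements in `u(D, λ, μ)`. -/
def grp : G →* D.U lam mu where
  toFun h := D.fromFree lam mu (FreeAlgebra.ι k (Sum.inl h))
  map_one' := by rw [fromFree_rel .one, map_one]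
  map_mul' h h' := by rw [fromFree_rel (.mul h h'), map_mul]

/-- The generators `x i` of `u(D, λ, μ)`. -/
def x (i : Fin θ) : D.U lam mu := D.fromFree lam mu (FreeAlgebra.ι k (Sum.inr i))

theorem grp_mul_x (h : G) (i : Fin θ) :
    D.grp lam mu h * D.x lam mu i = (D.χ i h : k) • (D.x lam mu i * D.grp lam mu h) := by
  have := fromFree_rel (.conj (D := D) (lam := lam) (mu := mu) h i)
  rw [map_mul, map_smul, map_mul] at this
  exact this

theorem x_mul_grp (h : G) (i : Fin θ) :
    D.x lam mu i * D.grp lam mu h = (D.χ i h⁻¹ : k) • (D.grp lam mu h * D.x lam mu i) := by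
  rw [grp_mul_x, smul_smul, ← Units.val_mul, ← map_mul]
  simp

theorem x_mul_x {i j : Fin θ} (hij : i < j) :
    D.x lam mu i * D.x lam mu j = (D.χ j (D.g i) : k) • (D.x lam mu j * D.x lam mu i) +
      lam i j • (1 - D.grp lam mu (D.g i * D.g j)) := by
  have := fromFree_rel (.link (D := D) (lam := lam) (mu := mu) i j hij)
  rw [map_mul, map_add, map_smul, map_mul, map_smul, map_sub, map_one] at this
  exact this

theorem x_pow (i : Fin θ) :
    D.x lam mu i ^ D.N i = mu i • (1 - D.grp lam mu (D.g i ^ D.N i)) := by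
  have := fromFree_rel (.root (D := D) (lam := lam) (mu := mu) i)
  rw [map_pow, map_smul, map_sub, map_one] at this
  exact this

section lift

variable {D lam mu} {B : Type*} [Ring B] [Algebra k B]

/-- The universal property of `u(D, λ, μ)`. -/
def lift (φ : G →* B) (y : Fin θ → B)
    (h1 : ∀ h i, φ h * y i = (D.χ i h : k) • (y i * φ h))
    (h2 : ∀ i j, i < j → y i * y j = (D.χ j (D.g i) : k) • (y j * y i) +
      lam i j • (1 - φ (D.g i * D.g j)))
    (h3 : ∀ i, y i ^ D.N i = mu i • (1 - φ (D.g i ^ D.N i))) : D.U lam mu →ₐ[k] B :=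
  RingQuot.liftAlgHom k ⟨FreeAlgebra.lift k (Sum.elim φ y), by
    intro a b hab
    cases hab with
    | one => simp
    | mul h h' => simp
    | conj h i => simpa using h1 h i
    | link i j hij => simpa using h2 i j hij
    | root i => simpa using h3 i⟩

variable {φ : G →* B} {y : Fin θ → B}
    {h1 : ∀ h i, φ h * y i = (D.χ i h : k) • (y i * φ h)}
    {h2 : ∀ i j, i < j → y i * y j = (D.χ j (D.g i) : k) • (y j * y i) +
      lam i j • (1 - φ (D.g i * D.g j))}
    {h3 : ∀ i, y i ^ D.N i = mu i • (1 - φ (D.g i ^ D.N i))}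

@[simp] theorem lift_grp (h : G) : lift φ y h1 h2 h3 (D.grp lam mu h) = φ h := by
  refine (RingQuot.liftAlgHom_mkAlgHom_apply k _ _ _).trans ?_
  simp

@[simp] theorem lift_x (i : Fin θ) : lift φ y h1 h2 h3 (D.x lam mu i) = y i := by
  refine (RingQuot.liftAlgHom_mkAlgHom_apply k _ _ _).trans ?_
  simp

theorem algHom_ext {f f' : D.U lam mu →ₐ[k] B}
    (hg : ∀ h, f (D.grp lam mu h) = f' (D.grp lam mu h))
    (hx : ∀ i, f (D.x lam mu i) = f' (D.x lam mu i)) : f = f' := by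
  refine RingQuot.ringQuot_ext' k _ _ (FreeAlgebra.hom_ext (funext fun s => ?_))
  rcases s with h | i
  · exact hg h
  · exact hx i

@[elab_as_elim]
theorem induction {P : D.U lam mu → Prop} (a : D.U lam mu) (hg : ∀ h, P (D.grp lam mu h))
    (hx : ∀ i, P (D.x lam mu i)) (hs : ∀ r : k, P (algebraMap k _ r))
    (ha : ∀ a b, P a → P b → P (a + b)) (hm : ∀ a b, P a → P b → P (a * b)) : P a := by
  obtain ⟨a, rfl⟩ := RingQuot.mkAlgHom_surjective k (D.Rel lam mu) a
  change P (D.fromFree lam mu a)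
  induction a using FreeAlgebra.induction with
  | grade0 r => rw [AlgHom.commutes]; exact hs r
  | grade1 s =>
    rcases s with h | i
    · exact hg h
    · exact hx i
  | mul a b iha ihb => rw [map_mul]; exact hm _ _ iha ihb
  | add a b iha ihb => rw [map_add]; exact ha _ _ iha ihb

end lift

theorem isPrimitiveRoot (i : Fin θ) : IsPrimitiveRoot (D.χ i (D.g i) : k) (D.N i) := by
  rw [N, ← orderOf_units]
  exact IsPrimitiveRoot.orderOf _

theorem N_pos [Finite G] (i : Fin θ) : 0 < D.N i := by
  have h : IsOfFinOrder (D.χ i (D.g i)) := (D.χ i).isOfFinOrder (isOfFinOrder_of_finite _)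
  exact h.orderOf_pos

theorem braiding' {i j : Fin θ} (h : i ≠ j) : (D.χ i (D.g j) : k) * D.χ j (D.g i) = 1 := by
  rw [← Units.val_mul, D.braiding i j h, Units.val_one]

/-! ### The Hopf algebra structure: `Δ h = h ⊗ h`, `Δ xᵢ = xᵢ ⊗ 1 + gᵢ ⊗ xᵢ` -/

section Hopf

variable [Finite G]

local notation "𝓤" => U D lam mu
local notation "𝐠" => grp D lam mu
local notation "𝐱" => x D lam mu

/-- The comultiplication as an algebra homomorphism. -/
def comulHom : 𝓤 →ₐ[k] 𝓤 ⊗[k] 𝓤 :=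
  lift
    { toFun := fun h => 𝐠 h ⊗ₜ[k] 𝐠 h
      map_one' := by rw [map_one]; rfl
      map_mul' := fun h h' => by rw [map_mul, Algebra.TensorProduct.tmul_mul_tmul] }
    (fun i => 𝐱 i ⊗ₜ[k] 1 + 𝐠 (D.g i) ⊗ₜ[k] 𝐱 i)
    (fun h i => by
      simp only [MonoidHom.coe_mk, OneHom.coe_mk, mul_add, add_mul,
        Algebra.TensorProduct.tmul_mul_tmul, mul_one, one_mul, grp_mul_x, smul_add,
        TensorProduct.smul_tmul', TensorProduct.tmul_smul, ← map_mul, mul_comm h])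
    (fun i j hij => by
      have hb := D.braiding' hij.ne
      have e1 := D.grp_mul_x lam mu (D.g i) j
      have e2 := D.grp_mul_x lam mu (D.g j) i
      have e3 := D.x_mul_x lam mu hij
      simp only [MonoidHom.coe_mk, OneHom.coe_mk, mul_add, add_mul,
        Algebra.TensorProduct.tmul_mul_tmul, mul_one, one_mul, ← map_mul, e1, e2, e3,
        mul_comm (D.g j) (D.g i), Algebra.TensorProduct.one_def, smul_add,
        TensorProduct.tmul_add, TensorProduct.add_tmul, TensorProduct.tmul_smul,
        ← TensorProduct.smul_tmul', smul_sub, TensorProduct.tmul_sub, TensorProduct.sub_tmul,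
        smul_smul]
      rw [mul_comm (D.χ j (D.g i) : k), hb, one_smul]
      abel)
    (fun i => by
      have hc : 𝐠 (D.g i) ⊗ₜ[k] 𝐱 i * 𝐱 i ⊗ₜ[k] (1 : 𝓤) =
          (D.χ i (D.g i) : k) • (𝐱 i ⊗ₜ[k] (1 : 𝓤) * 𝐠 (D.g i) ⊗ₜ[k] 𝐱 i) := by
        simp only [Algebra.TensorProduct.tmul_mul_tmul, mul_one, one_mul, grp_mul_x,
          TensorProduct.smul_tmul']
      rw [add_pow_root hc (D.N_pos i) (D.isPrimitiveRoot i), Algebra.TensorProduct.tmul_pow,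
        Algebra.TensorProduct.tmul_pow, one_pow, x_pow, ← map_pow]
      simp only [MonoidHom.coe_mk, OneHom.coe_mk, Algebra.TensorProduct.one_def,
        TensorProduct.tmul_smul, ← TensorProduct.smul_tmul', smul_sub, TensorProduct.tmul_sub,
        TensorProduct.sub_tmul]
      abel)

/-- The counit as an algebra homomorphism. -/
def counitHom : 𝓤 →ₐ[k] k :=
  lift (1 : G →* k) (fun _ => 0) (by simp) (by simp) (fun i => by
    rw [zero_pow (D.N_pos i).ne']; simp)

@[simp] theorem comulHom_grp (h : G) : D.comulHom lam mu (𝐠 h) = 𝐠 h ⊗ₜ 𝐠 h := lift_grp h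

@[simp] theorem comulHom_x (i : Fin θ) :
    D.comulHom lam mu (𝐱 i) = 𝐱 i ⊗ₜ 1 + 𝐠 (D.g i) ⊗ₜ 𝐱 i := lift_x i

@[simp] theorem counitHom_grp (h : G) : D.counitHom lam mu (𝐠 h) = 1 := lift_grp h

@[simp] theorem counitHom_x (i : Fin θ) : D.counitHom lam mu (𝐱 i) = 0 := lift_x i

instance : Bialgebra k 𝓤 :=
  Bialgebra.ofAlgHom (D.comulHom lam mu) (D.counitHom lam mu)
    (algHom_ext (fun h => by simp) (fun i => by
      simp [TensorProduct.add_tmul, TensorProduct.tmul_add, Algebra.TensorProduct.one_def,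
        add_assoc]))
    (algHom_ext (fun h => by simp) (fun i => by simp))
    (algHom_ext (fun h => by simp) (fun i => by simp))

theorem comul_eq (a : 𝓤) : comul (R := k) a = D.comulHom lam mu a := rfl

theorem counit_eq (a : 𝓤) : counit (R := k) a = D.counitHom lam mu a := rfl

/-- The antipode as an algebra homomorphism to the opposite algebra:
`h ↦ h⁻¹`, `xᵢ ↦ - gᵢ⁻¹ xᵢ`. -/
def antipodeHom : 𝓤 →ₐ[k] 𝓤ᵐᵒᵖ :=
  lift
    { toFun := fun h => MulOpposite.op (𝐠 h⁻¹)
      map_one' := by simp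
      map_mul' := fun h h' => by rw [mul_inv_rev, map_mul, MulOpposite.op_mul] }
    (fun i => MulOpposite.op (-(𝐠 (D.g i)⁻¹ * 𝐱 i)))
    (fun h i => by
      simp only [MonoidHom.coe_mk, OneHom.coe_mk, ← MulOpposite.op_mul, ← MulOpposite.op_smul]
      congr 1
      rw [neg_mul, mul_neg, smul_neg, mul_assoc, x_mul_grp, inv_inv, mul_smul_comm, ← mul_assoc,
        ← mul_assoc, ← map_mul, ← map_mul, mul_comm (D.g i)⁻¹])
    (fun i j hij => by
      have hb := D.braiding' hij.ne
      simp only [MonoidHom.coe_mk, OneHom.coe_mk, ← MulOpposite.op_mul, ← MulOpposite.op_smul,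
        ← MulOpposite.op_one, ← MulOpposite.op_sub, ← MulOpposite.op_add]
      congr 1
      have e : ∀ a b : Fin θ, 𝐠 (D.g a)⁻¹ * 𝐱 a * (𝐠 (D.g b)⁻¹ * 𝐱 b) =
          (D.χ a (D.g b) : k) • (𝐠 (D.g a * D.g b)⁻¹ * (𝐱 a * 𝐱 b)) := fun a b => by
        rw [mul_assoc, ← mul_assoc (𝐱 a), x_mul_grp, inv_inv, smul_mul_assoc, mul_smul_comm,
          mul_inv, map_mul, mul_assoc, mul_assoc]
      rw [neg_mul_neg, neg_mul_neg, e, e, x_mul_x D lam mu hij, smul_smul,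
        mul_comm (D.χ j (D.g i) : k), hb, one_smul, mul_comm (D.g j), mul_add, mul_smul_comm,
        mul_smul_comm, mul_sub, mul_one, ← map_mul, inv_mul_cancel, map_one, smul_sub, smul_sub]
      abel)
    (fun i => by
      simp only [MonoidHom.coe_mk, OneHom.coe_mk, ← MulOpposite.op_pow, ← MulOpposite.op_smul,
        ← MulOpposite.op_one, ← MulOpposite.op_sub]
      congr 1
      have hc : 𝐱 i * 𝐠 (D.g i)⁻¹ = (D.χ i (D.g i) : k) • (𝐠 (D.g i)⁻¹ * 𝐱 i) := by
        rw [x_mul_grp, inv_inv]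
      rw [neg_mul_pow_root hc (D.N_pos i) (D.isPrimitiveRoot i), x_pow, ← map_pow, mul_smul_comm,
        mul_sub, mul_one, ← map_mul, inv_pow, inv_mul_cancel, map_one, ← smul_neg, neg_sub])

@[simp] theorem antipodeHom_grp (h : G) :
    D.antipodeHom lam mu (𝐠 h) = MulOpposite.op (𝐠 h⁻¹) := lift_grp h

@[simp] theorem antipodeHom_x (i : Fin θ) :
    D.antipodeHom lam mu (𝐱 i) = MulOpposite.op (-(𝐠 (D.g i)⁻¹ * 𝐱 i)) := lift_x i

/-- The antipode as a linear map. -/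
def antipodeLin : 𝓤 →ₗ[k] 𝓤 :=
  (MulOpposite.opLinearEquiv k).symm.toLinearMap ∘ₗ (D.antipodeHom lam mu).toLinearMap

theorem antipodeLin_apply (a : 𝓤) :
    D.antipodeLin lam mu a = (D.antipodeHom lam mu a).unop := rfl

theorem antipodeLin_mul (a b : 𝓤) :
    D.antipodeLin lam mu (a * b) = D.antipodeLin lam mu b * D.antipodeLin lam mu a := by
  simp [antipodeLin_apply]

instance : HopfAlgebra k 𝓤 where
  antipode := D.antipodeLin lam mu
  mul_antipode_rTensor_comul := by
    ext a
    simp only [LinearMap.comp_apply, comul_eq, counit_eq, Algebra.linearMap_apply]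
    induction a using induction with
    | hg h => simp [antipodeLin_apply, ← map_mul]
    | hx i => simp [antipodeLin_apply]
    | hs r => simp [Algebra.TensorProduct.algebraMap_apply, antipodeLin_apply]
    | ha a b ha hb => simp only [map_add, ha, hb]
    | hm a b ha hb =>
      have key : ∀ w : 𝓤 ⊗[k] 𝓤, LinearMap.mul' k 𝓤
          ((D.antipodeLin lam mu).rTensor 𝓤 (D.comulHom lam mu a * w)) =
          D.counitHom lam mu a • LinearMap.mul' k 𝓤 ((D.antipodeLin lam mu).rTensor 𝓤 w) := by
        intro w
        induction w using TensorProduct.induction_on with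
        | zero => simp
        | add w w' hw hw' => simp only [mul_add, map_add, hw, hw', smul_add]
        | tmul c d =>
          have h2 : ∀ z : 𝓤 ⊗[k] 𝓤, LinearMap.mul' k 𝓤
              ((D.antipodeLin lam mu).rTensor 𝓤 (z * c ⊗ₜ d)) =
              D.antipodeLin lam mu c *
                LinearMap.mul' k 𝓤 ((D.antipodeLin lam mu).rTensor 𝓤 z) * d := by
            intro z
            induction z using TensorProduct.induction_on with
            | zero => simp
            | add z z' hz hz' => simp only [add_mul, mul_add, map_add, hz, hz']
            | tmul p q => simp [antipodeLin_mul, mul_assoc]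
          rw [h2, ha, ← Algebra.commutes, mul_assoc, ← Algebra.smul_def]
          simp
      rw [map_mul, key, hb, map_mul, map_mul, Algebra.smul_def]
  mul_antipode_lTensor_comul := by
    ext a
    simp only [LinearMap.comp_apply, comul_eq, counit_eq, Algebra.linearMap_apply]
    induction a using induction with
    | hg h => simp [antipodeLin_apply, ← map_mul]
    | hx i => simp [antipodeLin_apply, ← mul_assoc, ← map_mul]
    | hs r => simp [Algebra.TensorProduct.algebraMap_apply, antipodeLin_apply]
    | ha a b ha hb => simp only [map_add, ha, hb]
    | hm a b ha hb =>
      have key : ∀ w : 𝓤 ⊗[k] 𝓤, LinearMap.mul' k 𝓤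
          ((D.antipodeLin lam mu).lTensor 𝓤 (w * D.comulHom lam mu b)) =
          D.counitHom lam mu b • LinearMap.mul' k 𝓤 ((D.antipodeLin lam mu).lTensor 𝓤 w) := by
        intro w
        induction w using TensorProduct.induction_on with
        | zero => simp
        | add w w' hw hw' => simp only [add_mul, map_add, hw, hw', smul_add]
        | tmul c d =>
          have h2 : ∀ z : 𝓤 ⊗[k] 𝓤, LinearMap.mul' k 𝓤
              ((D.antipodeLin lam mu).lTensor 𝓤 (c ⊗ₜ d * z)) =
              c * LinearMap.mul' k 𝓤 ((D.antipodeLin lam mu).lTensor 𝓤 z) *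
                D.antipodeLin lam mu d := by
            intro z
            induction z using TensorProduct.induction_on with
            | zero => simp
            | add z z' hz hz' => simp only [add_mul, mul_add, map_add, hz, hz']
            | tmul p q => simp [antipodeLin_mul, mul_assoc]
          rw [h2, hb, ← Algebra.commutes, mul_assoc, ← Algebra.smul_def]
          simp
      rw [map_mul, key, ha, map_mul, map_mul, Algebra.smul_def, Algebra.commutes]

end Hopf

/-! ### The PBW basis of `A = u(D, 0, 0)` -/

/-- The bosonization `A = u(D, 0, 0) = B(V) # kG` of the quantum linear space. -/
abbrev A : Type _ := D.U 0 0

/-- The ordered monomial `x^a h = x₁^a₁ ⋯ x_θ^a_θ h` in `u(D, λ, μ)`. -/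
def monomial (a : Fin θ → ℕ) (h : G) : D.U lam mu :=
  ((List.finRange θ).map fun i => D.x lam mu i ^ a i).prod * D.grp lam mu h

/-- The index set of the PBW basis: exponents `a` with `a i < N i`, and elements of `G`. -/
abbrev PBWIndex : Type _ := ((i : Fin θ) → Fin (D.N i)) × G

/-- The PBW monomials of `A`. -/
def pbwMonomial (p : D.PBWIndex) : D.A := D.monomial 0 0 (fun i => p.1 i) p.2

section Representation

/-- The scalar `c` in `xᵢ x^a = c x^(a + eᵢ)`. -/
def repCoeff (i : Fin θ) (a : Fin θ → ℕ) : k :=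
  ∏ j, if j < i then (D.χ j (D.g i) : k) ^ a j else 1

/-- The scalar `χ^a(h)`. -/
def repChar (a : Fin θ → ℕ) (h : G) : k := ∏ j, (D.χ j h : k) ^ a j

theorem repCoeff_ne_zero (i : Fin θ) (a : Fin θ → ℕ) : D.repCoeff i a ≠ 0 := by
  rw [repCoeff, Finset.prod_ne_zero_iff]
  intro j _
  split_ifs
  · exact pow_ne_zero _ (Units.ne_zero _)
  · exact one_ne_zero

theorem repCoeff_add (i j : Fin θ) (a : Fin θ → ℕ) (n : ℕ) :
    D.repCoeff i (a + Pi.single j n) =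
      D.repCoeff i a * if j < i then (D.χ j (D.g i) : k) ^ n else 1 := by
  rw [repCoeff, repCoeff]
  have : (if j < i then (D.χ j (D.g i) : k) ^ n else 1) =
      ∏ l, if l = j then (if l < i then (D.χ l (D.g i) : k) ^ n else 1) else 1 := by simp
  rw [this, ← Finset.prod_mul_distrib]
  refine Finset.prod_congr rfl fun l _ => ?_
  by_cases hl : l = j
  · subst hl
    by_cases h : l < i <;> simp [h, pow_add]
  · simp [hl]

theorem repChar_add (j : Fin θ) (a : Fin θ → ℕ) (n : ℕ) (h : G) :
    D.repChar (a + Pi.single j n) h = D.repChar a h * (D.χ j h : k) ^ n := by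
  rw [repChar, repChar]
  have : (D.χ j h : k) ^ n = ∏ l, if l = j then (D.χ l h : k) ^ n else 1 := by simp
  rw [this, ← Finset.prod_mul_distrib]
  refine Finset.prod_congr rfl fun l _ => ?_
  by_cases hl : l = j
  · subst hl; simp [pow_add]
  · simp [hl]

/-- The action of `h ∈ G` on formal monomials. -/
def repGrp : G →* Module.End k ((Fin θ → ℕ) × G →₀ k) where
  toFun h := Finsupp.linearCombination k fun p => Finsupp.single (p.1, h * p.2) (D.repChar p.1 h)
  map_one' := by
    ext p : 2
    simp [repChar]
  map_mul' h h' := by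
    refine Finsupp.lhom_ext' fun p => LinearMap.ext_ring ?_
    simp only [LinearMap.comp_apply, Finsupp.lsingle_apply, Module.End.mul_apply,
      Finsupp.linearCombination_single, one_smul, Finsupp.smul_single, smul_eq_mul]
    rw [mul_assoc]
    congr 1
    simp only [repChar, map_mul, Units.val_mul, mul_pow, Finset.prod_mul_distrib]
    rw [mul_comm]

/-- The action of `x i` on formal monomials. -/
def repX (i : Fin θ) : Module.End k ((Fin θ → ℕ) × G →₀ k) :=
  Finsupp.linearCombination k fun p =>
    if p.1 i + 1 < D.N i then Finsupp.single (p.1 + Pi.single i 1, p.2) (D.repCoeff i p.1) else 0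

theorem repGrp_single (h : G) (p : (Fin θ → ℕ) × G) :
    D.repGrp h (Finsupp.single p 1) = Finsupp.single (p.1, h * p.2) (D.repChar p.1 h) := by
  simp [repGrp]

theorem repX_single (i : Fin θ) (p : (Fin θ → ℕ) × G) :
    D.repX i (Finsupp.single p 1) = if p.1 i + 1 < D.N i then
      D.repCoeff i p.1 • Finsupp.single (p.1 + Pi.single i 1, p.2) 1 else 0 := by
  simp [repX]

theorem repX_pow_single (i : Fin θ) (p : (Fin θ → ℕ) × G) (n : ℕ) :
    (D.repX i ^ n) (Finsupp.single p 1) = if n = 0 ∨ p.1 i + n < D.N i then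
      D.repCoeff i p.1 ^ n • Finsupp.single (p.1 + Pi.single i n, p.2) 1 else 0 := by
  induction n with
  | zero => simp
  | succ n ih =>
    rw [pow_succ', Module.End.mul_apply, ih]
    by_cases h : n = 0 ∨ p.1 i + n < D.N i
    · rw [if_pos h, map_smul, repX_single]
      have e : (p.1 + Pi.single i n : Fin θ → ℕ) + Pi.single i 1 = p.1 + Pi.single i (n + 1) := by
        rw [add_assoc, ← Pi.single_add]
      by_cases h' : p.1 i + (n + 1) < D.N i
      · rw [if_pos (by simpa [add_assoc] using h'), if_pos (Or.inr h'), e, repCoeff_add,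
          if_neg (lt_irrefl i), mul_one, smul_smul, pow_succ]
      · rw [if_neg (by simpa [add_assoc] using h'), if_neg (by simpa using h'), smul_zero]
    · rw [if_neg h, map_zero, if_neg]
      omega

variable [Finite G]

/-- The representation of `A` on formal monomials. -/
def rep : D.A →ₐ[k] Module.End k ((Fin θ → ℕ) × G →₀ k) :=
  lift D.repGrp D.repX
    (fun h i => by
      refine Finsupp.lhom_ext' fun p => LinearMap.ext_ring ?_
      simp only [LinearMap.comp_apply, Finsupp.lsingle_apply, Module.End.mul_apply,
        LinearMap.smul_apply, repGrp_single, repX_single]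
      have e : Finsupp.single (p.1, h * p.2) (D.repChar p.1 h) =
          D.repChar p.1 h • (Finsupp.single (p.1, h * p.2) 1 : (Fin θ → ℕ) × G →₀ k) := by simp
      rw [e, map_smul, repX_single]
      split_ifs
      · rw [map_smul, repGrp_single, repChar_add, pow_one]
        simp only [Finsupp.smul_single, smul_eq_mul, mul_one]
        congr 1
        ring
      · simp)
    (fun i j hij => by
      refine Finsupp.lhom_ext' fun p => LinearMap.ext_ring ?_
      simp only [LinearMap.comp_apply, Finsupp.lsingle_apply, Module.End.mul_apply,
        LinearMap.smul_apply, repX_single, Pi.zero_apply, zero_smul, add_zero]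
      by_cases h1 : p.1 i + 1 < D.N i <;> by_cases h2 : p.1 j + 1 < D.N j <;>
        simp only [h1, h2, if_true, if_false, map_smul, map_zero, smul_zero, repX_single,
          Pi.add_apply, Pi.single_eq_of_ne hij.ne, Pi.single_eq_of_ne hij.ne', add_zero]
      rw [repCoeff_add, repCoeff_add, if_neg hij.asymm, if_pos hij, smul_smul, smul_smul,
        smul_smul, add_right_comm]
      congr 1
      have := D.braiding' hij.ne
      rw [pow_one, mul_one]
      linear_combination (-(D.repCoeff j p.1 * D.repCoeff i p.1)) * this)
    (fun i => by
      refine Finsupp.lhom_ext' fun p => LinearMap.ext_ring ?_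
      simp only [LinearMap.comp_apply, Finsupp.lsingle_apply,
        repX_pow_single, Pi.zero_apply, zero_smul, LinearMap.zero_apply]
      rw [if_neg]
      have := D.N_pos i
      omega)

theorem rep_prod_single {a : Fin θ → ℕ} (ha : ∀ i, a i < D.N i) (l : List (Fin θ)) (hl : l.Nodup)
    (h : G) : ∃ c : kˣ, D.rep (l.map fun i => D.x 0 0 i ^ a i).prod (Finsupp.single (0, h) 1) =
      c • Finsupp.single ((l.map fun i => (Pi.single i (a i) : Fin θ → ℕ)).sum, h) 1 := by
  induction l with
  | nil => exact ⟨1, by simp⟩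
  | cons i l ih =>
    have hi := (List.nodup_cons.1 hl).1
    obtain ⟨c, hc⟩ := ih (List.nodup_cons.1 hl).2
    have h0 : (l.map fun j => (Pi.single j (a j) : Fin θ → ℕ)).sum i = 0 := by
      clear ih hc hl c
      induction l with
      | nil => simp
      | cons j l ih =>
        rw [List.mem_cons, not_or] at hi
        simp only [List.map_cons, List.sum_cons, Pi.add_apply, ih hi.2,
          Pi.single_eq_of_ne hi.1]
    rw [List.map_cons, List.prod_cons, map_mul, Module.End.mul_apply, hc, map_pow, rep, lift_x,
      Units.smul_def, map_smul, repX_pow_single, if_pos (Or.inr (by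
        change (l.map fun j => (Pi.single j (a j) : Fin θ → ℕ)).sum i + a i < D.N i
        rw [h0, zero_add]
        exact ha i)), smul_smul]
    refine ⟨c * (Units.mk0 _ (D.repCoeff_ne_zero i
      (l.map fun j => (Pi.single j (a j) : Fin θ → ℕ)).sum)) ^ a i, ?_⟩
    have e : ((i :: l).map fun j => (Pi.single j (a j) : Fin θ → ℕ)).sum =
        (l.map fun j => (Pi.single j (a j) : Fin θ → ℕ)).sum + Pi.single i (a i) := by
      rw [List.map_cons, List.sum_cons, add_comm]
    rw [e, Units.smul_def]
    simp

theorem rep_pbwMonomial (p : D.PBWIndex) : ∃ c : kˣ,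
    D.rep (D.pbwMonomial p) (Finsupp.single (0, 1) 1) =
      c • Finsupp.single ((fun i => (p.1 i : ℕ)), p.2) 1 := by
  obtain ⟨c, hc⟩ := D.rep_prod_single (a := fun i => p.1 i) (fun i => (p.1 i).2)
    (List.finRange θ) (List.nodup_finRange θ) p.2
  refine ⟨c, ?_⟩
  rw [pbwMonomial, monomial, map_mul, Module.End.mul_apply]
  have e1 : D.rep (D.grp 0 0 p.2) (Finsupp.single (0, 1) 1) = Finsupp.single (0, p.2) 1 := by
    rw [rep, lift_grp, repGrp_single]
    simp [repChar]
  have e2 : ((List.finRange θ).map fun i => (Pi.single i (p.1 i : ℕ) : Fin θ → ℕ)).sum =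
      fun i => (p.1 i : ℕ) := by
    rw [← Fin.sum_univ_def]
    exact Finset.univ_sum_single _
  rw [e1, hc, e2]

theorem linearIndependent_pbwMonomial : LinearIndependent k D.pbwMonomial := by
  choose c hc using D.rep_pbwMonomial
  let L : D.A →ₗ[k] ((Fin θ → ℕ) × G →₀ k) :=
    LinearMap.applyₗ (Finsupp.single ((0 : Fin θ → ℕ), (1 : G)) (1 : k)) ∘ₗ D.rep.toLinearMap
  refine LinearIndependent.of_comp L ?_
  have h1 : LinearIndependent k fun p : D.PBWIndex =>
      (Finsupp.single ((fun i => (p.1 i : ℕ)), p.2) 1 : (Fin θ → ℕ) × G →₀ k) := by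
    refine (Finsupp.linearIndependent_single_one k ((Fin θ → ℕ) × G)).comp
      (fun p : D.PBWIndex => ((fun i => (p.1 i : ℕ)), p.2)) ?_
    rintro ⟨a, h⟩ ⟨b, h'⟩ hab
    obtain ⟨h1, h2⟩ := Prod.mk.inj hab
    exact Prod.ext (funext fun i => Fin.ext (congrFun h1 i)) h2
  have h2 := h1.units_smul c
  convert h2 using 1
  funext p
  exact hc p

end Representation

theorem grp_mul_prod (h : G) (a : Fin θ → ℕ) (l : List (Fin θ)) : ∃ c : k,
    D.grp lam mu h * (l.map fun i => D.x lam mu i ^ a i).prod =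
      c • ((l.map fun i => D.x lam mu i ^ a i).prod * D.grp lam mu h) := by
  induction l with
  | nil => exact ⟨1, by simp⟩
  | cons i l ih =>
    obtain ⟨c, hc⟩ := ih
    have := mul_pow_of_qcomm (D.grp_mul_x lam mu h i) (a i)
    exact ⟨(D.χ i h : k) ^ a i * c, by
      rw [List.map_cons, List.prod_cons, ← mul_assoc, this, smul_mul_assoc, mul_assoc, hc,
        mul_smul_comm, smul_smul, mul_assoc]⟩

theorem x_mul_x_zero {i j : Fin θ} (hij : i ≠ j) :
    D.x 0 mu i * D.x 0 mu j = (D.χ j (D.g i) : k) • (D.x 0 mu j * D.x 0 mu i) := by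
  rcases lt_or_gt_of_ne hij with h | h
  · rw [D.x_mul_x 0 mu h]; simp
  · rw [D.x_mul_x 0 mu h]; simp [smul_smul, D.braiding' h.ne]

theorem x_mul_prod (i : Fin θ) (a : Fin θ → ℕ) (l : List (Fin θ)) (hl : l.Nodup) (hi : i ∈ l) :
    ∃ c : k, D.x 0 mu i * (l.map fun j => D.x 0 mu j ^ a j).prod =
      c • (l.map fun j => D.x 0 mu j ^ (a + Pi.single i 1 : Fin θ → ℕ) j).prod := by
  induction l with
  | nil => simp at hi
  | cons j l ih =>
    obtain ⟨hj, hl⟩ := List.nodup_cons.1 hl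
    by_cases hij : i = j
    · subst hij
      refine ⟨1, ?_⟩
      have e : (l.map fun j => D.x 0 mu j ^ (a + Pi.single i 1 : Fin θ → ℕ) j) =
          l.map fun j => D.x 0 mu j ^ a j := by
        refine List.map_congr_left fun j hjl => ?_
        have : j ≠ i := fun h => hj (h ▸ hjl)
        simp [this]
      rw [List.map_cons, List.map_cons, e, List.prod_cons, List.prod_cons, ← mul_assoc,
        ← pow_succ', one_smul]
      simp
    · obtain ⟨c, hc⟩ := ih hl ((List.mem_cons.1 hi).resolve_left hij)
      have := mul_pow_of_qcomm (D.x_mul_x_zero mu hij) (a j)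
      refine ⟨(D.χ j (D.g i) : k) ^ a j * c, ?_⟩
      rw [List.map_cons, List.map_cons, List.prod_cons, List.prod_cons, ← mul_assoc, this,
        smul_mul_assoc, mul_assoc, hc, mul_smul_comm, smul_smul]
      have hji : j ≠ i := fun h => hij h.symm
      simp [hji]

/-! ### The quotient datum `D'` over `G / G₀` -/

/-- The subgroup `G₀` generated by the elements `gᵢ ^ Nᵢ ≠ 1` with `χᵢ ^ Nᵢ = ε`. -/
def G₀ : Subgroup G :=
  Subgroup.closure {h | ∃ i, D.χ i ^ D.N i = 1 ∧ D.g i ^ D.N i ≠ 1 ∧ D.g i ^ D.N i = h}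

theorem G₀_le_ker (j : Fin θ) : D.G₀ ≤ (D.χ j).ker := by
  rw [G₀, Subgroup.closure_le]
  rintro _ ⟨i, hi, -, rfl⟩
  rw [SetLike.mem_coe, MonoidHom.mem_ker, map_pow]
  by_cases hij : j = i
  · subst hij; exact pow_orderOf_eq_one _
  · have h1 : (D.χ j (D.g i)) ^ D.N i * (D.χ i (D.g j)) ^ D.N i = 1 := by
      rw [← mul_pow, D.braiding j i hij, one_pow]
    have h2 : (D.χ i (D.g j)) ^ D.N i = 1 := by
      rw [← MonoidHom.pow_apply, hi, MonoidHom.one_apply]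
    rwa [h2, mul_one] at h1

/-- The datum `D'` over `G' = G / G₀`. -/
def quot : QLSDatum k (G ⧸ D.G₀) θ where
  g i := (D.g i : G ⧸ D.G₀)
  χ i := QuotientGroup.lift D.G₀ (D.χ i) (D.G₀_le_ker i)
  braiding i j h := D.braiding i j h
  nontrivial i := D.nontrivial i

theorem quot_N (i : Fin θ) : D.quot.N i = D.N i := rfl

variable [Finite G]

theorem span_pbwMonomial : ⊤ ≤ Submodule.span k (Set.range D.pbwMonomial) := by
  set S := Submodule.span k (Set.range D.pbwMonomial)
  have hS : ∀ (a : Fin θ → ℕ) (h : G), (∀ i, a i < D.N i) → D.monomial 0 0 a h ∈ S :=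
    fun a h ha => Submodule.subset_span ⟨(fun i => ⟨a i, ha i⟩, h), rfl⟩
  have key : ∀ u : D.A, ∀ s ∈ S, u * s ∈ S := by
    intro u
    induction u using induction with
    | hg h =>
      intro s hs
      induction hs using Submodule.span_induction with
      | mem s hs =>
        obtain ⟨p, rfl⟩ := hs
        obtain ⟨c, hc⟩ := D.grp_mul_prod 0 0 h (fun i => p.1 i) (List.finRange θ)
        rw [pbwMonomial, monomial, ← mul_assoc, hc, smul_mul_assoc, mul_assoc, ← map_mul]
        exact S.smul_mem _ (hS _ _ fun i => (p.1 i).2)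
      | zero => rw [mul_zero]; exact S.zero_mem
      | add s t _ _ hs ht => rw [mul_add]; exact S.add_mem hs ht
      | smul r s _ hs => rw [mul_smul_comm]; exact S.smul_mem _ hs
    | hx i =>
      intro s hs
      induction hs using Submodule.span_induction with
      | mem s hs =>
        obtain ⟨p, rfl⟩ := hs
        obtain ⟨c, hc⟩ := D.x_mul_prod 0 i (fun i => p.1 i) (List.finRange θ)
          (List.nodup_finRange θ) (List.mem_finRange i)
        rw [pbwMonomial, monomial, ← mul_assoc, hc, smul_mul_assoc]
        refine S.smul_mem _ ?_
        by_cases h : (p.1 i : ℕ) + 1 < D.N i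
        · refine hS _ _ fun j => ?_
          by_cases hj : j = i
          · subst hj; simpa using h
          · simp [hj]
        · have h1 : (p.1 i : ℕ) + 1 = D.N i := by have := (p.1 i).2; omega
          rw [List.prod_eq_zero, zero_mul]
          · exact S.zero_mem
          · refine List.mem_map.2 ⟨i, List.mem_finRange i, ?_⟩
            simp [h1, x_pow]
      | zero => rw [mul_zero]; exact S.zero_mem
      | add s t _ _ hs ht => rw [mul_add]; exact S.add_mem hs ht
      | smul r s _ hs => rw [mul_smul_comm]; exact S.smul_mem _ hs
    | hs r => intro s hs; rw [← Algebra.smul_def]; exact S.smul_mem _ hs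
    | ha a b ha hb => intro s hs; rw [add_mul]; exact S.add_mem (ha s hs) (hb s hs)
    | hm a b ha hb => intro s hs; rw [mul_assoc]; exact ha _ (hb s hs)
  intro u _
  have h1 : (1 : D.A) ∈ S := by
    have := hS 0 1 D.N_pos
    simpa [monomial] using this
  simpa using key u 1 h1

/-- The PBW basis `x^a h` (`0 ≤ aᵢ < Nᵢ`, `h ∈ G`) of `A`. -/
def pbwBasis : Module.Basis D.PBWIndex k D.A :=
  Module.Basis.mk D.linearIndependent_pbwMonomial D.span_pbwMonomial

theorem pbwBasis_apply (p : D.PBWIndex) : D.pbwBasis p = D.pbwMonomial p := by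
  rw [pbwBasis, Module.Basis.mk_apply]

/-! ### The root vector cocycle `e^ζ` with `ζ = ∑ μᵢ ζᵢ` -/

/-- The linear map `ζᵢ : A ⊗ A → k` with `ζᵢ(x^a h ⊗ x^b h') = χᵢ(h)^bᵢ` if `a = aᵢ eᵢ`,
`b = bᵢ eᵢ` and `aᵢ + bᵢ = Nᵢ`, and `0` on all other pairs of PBW monomials. -/
def zeta (i : Fin θ) : WithConv (D.A ⊗[k] D.A →ₗ[k] k) :=
  toConv ((D.pbwBasis.tensorProduct D.pbwBasis).constr k fun p =>
    if (∀ j, j ≠ i → (p.1.1 j : ℕ) = 0 ∧ (p.2.1 j : ℕ) = 0) ∧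
        (p.1.1 i : ℕ) + (p.2.1 i : ℕ) = D.N i
    then (D.χ i p.1.2 : k) ^ (p.2.1 i : ℕ) else 0)

/-- The cocycle `e^ζ` on `A`, where `ζ = ∑ μᵢ ζᵢ`. -/
def rootCocycle (mu : Fin θ → k) : WithConv (D.A ⊗[k] D.A →ₗ[k] k) :=
  nilExp k (∑ i, mu i • D.zeta i)

/-! ### The linking cocycle `σ_λ` -/

/-- The character `χᵢ`, extended to `A` by `χᵢ(x^a h) = ε(x^a) χᵢ(h)`. -/
def chiExt (i : Fin θ) : WithConv (D.A →ₗ[k] k) :=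
  toConv (D.pbwBasis.constr k fun p => if ∀ j, (p.1 j : ℕ) = 0 then (D.χ i p.2 : k) else 0)

/-- The skew derivation `dᵢ` of `A`: `dᵢ(xᵢ h) = 1`, and `0` on all other PBW monomials. -/
def skewDer (i : Fin θ) : WithConv (D.A →ₗ[k] k) :=
  toConv (D.pbwBasis.constr k fun p =>
    if ∀ j, (p.1 j : ℕ) = if j = i then 1 else 0 then 1 else 0)

/-- The linking Hochschild cocycle `η_{i,j} = (dᵢ * χⱼ) ⊗ dⱼ : A ⊗ A → k`. -/
def eta (i j : Fin θ) : WithConv (D.A ⊗[k] D.A →ₗ[k] k) :=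
  toConv (LinearMap.mul' k k ∘ₗ
    TensorProduct.map (D.skewDer i * D.chiExt j).ofConv (D.skewDer j).ofConv)

/-- The pairs `(i, j)` with `i < j`. -/
def pairs (θ : ℕ) : List (Fin θ × Fin θ) :=
  ((List.finRange θ) ×ˢ (List.finRange θ)).filter fun p => p.1 < p.2

/-- `σ_λ`, the convolution product over `i < j` of `exp_q(λᵢⱼ η_{i,j})` with `q = χⱼ(gᵢ)`. A pair
with `λᵢⱼ = 0` contributes the unit `ε`. -/
def linkCocycle (lam : Fin θ → Fin θ → k) : WithConv (D.A ⊗[k] D.A →ₗ[k] k) :=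
  ((pairs θ).map fun p => qExp (D.χ p.2 (D.g p.1) : k) (lam p.1 p.2 • D.eta p.1 p.2)).prod

/-! ### The projection `π_μ`, the cocycle `σ_{λ,μ}` and `σ` -/

/-- The canonical projection `π_μ : u(D, 0, μ) → u(D', 0, 0)`, `h ↦ h G₀`, `xᵢ ↦ xᵢ`. -/
def projMu (hmu : ∀ i, D.χ i ^ D.N i ≠ 1 → mu i = 0) : D.U 0 mu →ₐ[k] D.quot.A :=
  lift ((D.quot.grp 0 0).comp (QuotientGroup.mk' D.G₀)) (D.quot.x 0 0)
    (fun h i => D.quot.grp_mul_x 0 0 h i)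
    (fun i j hij => by
      rw [D.quot.x_mul_x 0 0 hij, Pi.zero_apply, Pi.zero_apply, zero_smul, zero_smul]
      rfl)
    (fun i => by
      have h0 : D.quot.x 0 0 i ^ D.N i = 0 := by
        rw [← D.quot_N i, x_pow, Pi.zero_apply, zero_smul]
      rw [h0]
      by_cases hm : mu i = 0
      · rw [hm, zero_smul]
      · have hχ : D.χ i ^ D.N i = 1 := by
          by_contra h
          exact hm (hmu i h)
        have hg : D.g i ^ D.N i ∈ D.G₀ := by
          by_cases hg : D.g i ^ D.N i = 1
          · rw [hg]; exact one_mem _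
          · exact Subgroup.subset_closure ⟨i, hχ, hg, rfl⟩
        have h1 : (QuotientGroup.mk' D.G₀) (D.g i ^ D.N i) = 1 :=
          (QuotientGroup.eq_one_iff _).2 hg
        rw [MonoidHom.comp_apply, h1, map_one, sub_self, smul_zero])

/-- `σ_{λ,μ} = σ_λ ∘ (π_μ ⊗ π_μ)` on `u(D, 0, μ)`, where `σ_λ` is the linking cocycle on
`u(D', 0, 0)`. -/
def linkCocycleMu (hmu : ∀ i, D.χ i ^ D.N i ≠ 1 → mu i = 0) :
    WithConv (D.U 0 mu ⊗[k] D.U 0 mu →ₗ[k] k) :=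
  toConv ((D.quot.linkCocycle lam).ofConv ∘ₗ
    TensorProduct.map (D.projMu mu hmu).toLinearMap (D.projMu mu hmu).toLinearMap)

/-- The identification of the underlying coalgebra of `A` with that of `u(D, 0, μ)`, sending the
PBW monomial `x^a h` of `A` to the monomial `x^a h` of `u(D, 0, μ)`. (The ordered monomials
`x^a h` formed with the multiplication of `A` and with its `e^ζ`-deformation are the same.) -/
def pbwIdent : D.A →ₗ[k] D.U 0 mu :=
  D.pbwBasis.constr k fun p => D.monomial 0 mu (fun i => p.1 i) p.2

/-- `σ = σ_{λ,μ} * e^(∑ μᵢ ζᵢ)` on `A`. -/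
def sigma (hmu : ∀ i, D.χ i ^ D.N i ≠ 1 → mu i = 0) : WithConv (D.A ⊗[k] D.A →ₗ[k] k) :=
  toConv ((D.linkCocycleMu lam mu hmu).ofConv ∘ₗ
    TensorProduct.map (D.pbwIdent mu) (D.pbwIdent mu)) * D.rootCocycle mu

end QLSDatum

end

/-!
The cocycle `σ` is built in two steps, and the theorem follows the same two steps. The general
principle is `IsMulCocycle.comp` together with `map_deformedMul_comp`: if `τ` is a cocycle on `H`,
`Φ : H_τ → L` is a homomorphism of bialgebras and `ρ` is a cocycle on `L`, then
`(ρ ∘ (Φ ⊗ Φ)) * τ` is a cocycle on `H`, and deforming `H` by it amounts to deforming `H` by `τ` and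
then transporting the deformation of `L` by `ρ`. Here `τ = e^ζ` with `ζ = ∑ μᵢ ζᵢ` on `A`, `Φ` is the
identification of `A` with `u(D, 0, μ)` through PBW monomials, and `ρ = σ_{λ,μ}`.

*Cocycles as exponentials.* Each `ζᵢ` is a sum of external products of divided powers of the skew
derivation `dᵢ`, `ζᵢ = ∑_{a + b = Nᵢ, a, b > 0} dᵢ^(a) χᵢ^b ⊠ dᵢ^(b)`, all in the convolution algebra
dual to `A`. The comultiplication of the divided powers is a form of the `q`-binomial formula, and
gives the Hochschild cocycle condition (`zeta_hochschild`). When the two terms on either side of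
that condition commute, the exponential of a Hochschild cocycle is a multiplicative cocycle
(`isMulCocycle_nilExp`). The commutation needs `χᵢ^Nᵢ = ε`, which is exactly the case `μᵢ ≠ 0`. In the
same way, `exp_q (λᵢⱼ η_{i,j})` is a cocycle by the functional equation of the `q`-exponential for
`q`-commuting elements (`isMulCocycle_qExp`), and for the product over all pairs one checks that
the pieces belonging to different linked pairs commute (`isMulCocycle_linkCocycle`). The cocycle
`σ_{λ,μ}` is then obtained by pulling back along `π_μ`.

*Identifying the deformations.* For a cocycle `σ` that is trivial on `G`, the product of a
skew-primitive element `x` (`Δ(x) = x ⊗ 1 + g ⊗ x`) with an arbitrary `b` in the deformation is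
`x b + φ(b₁) b₂ - g b₁ φ(b₂)`, where `φ = σ(x ⊗ -)` (`deformedMul_of_skew`). For `x = xᵢ` and the root
vector cocycle this functional `φ` is `μᵢ dᵢ^(Nᵢ - 1)`; for the linking cocycle it is `∑_{l > i} λᵢₗ dₗ`.
Hence the defining relations of `u(D, 0, μ)` hold in `A_{e^ζ}`, and those of `u(D, λ, μ)` hold in
`u(D, 0, μ)_{σ_{λ,μ}}`, which gives the homomorphisms `rootHom` and `linkHom`. Ordered monomials are
mapped to ordered monomials, in increasing order for `rootHom` and in decreasing order for
`linkHom`, because then all correction terms vanish. So both homomorphisms are surjective, and they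
are bijective since `dim u(D, λ, μ) ≤ dim A` for all `λ`, `μ` (`finrank_U_le`, from the spanning
monomials). Compatibility with the antipodes is automatic: on the coefficients of a finite
dimensional coalgebra the deformed antipode is a matrix inverse, as is the antipode of the target
(`map_deformedAntipode`).
-/

set_option linter.unusedSectionVars false

noncomputable section

/-! ### Functoriality of convolution algebras -/

namespace HopfDeformation

open Coalgebra WithConv

section Convolution

variable {k : Type*} [Field k] {C C' : Type*} [AddCommGroup C] [Module k C] [Coalgebra k C]
  [AddCommGroup C'] [Module k C'] [Coalgebra k C'] {B B' : Type*} [Ring B] [Algebra k B] [Ring B'] [Algebra k B']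

/-- Precomposition with a coalgebra homomorphism, as a homomorphism of convolution algebras. -/
def pullback (B : Type*) [Ring B] [Algebra k B] (f : C →ₗc[k] C') :
    WithConv (C' →ₗ[k] B) →ₐ[k] WithConv (C →ₗ[k] B) :=
  AlgHom.ofLinearMap
    { toFun := fun φ => toConv (φ.ofConv ∘ₗ f.toLinearMap)
      map_add' := fun _ _ => rfl
      map_smul' := fun _ _ => rfl }
    (by ext c; simp)
    (fun φ ψ => WithConv.ext (LinearMap.convMul_comp_coalgHom_distrib φ ψ f))

@[simp] theorem pullback_apply (f : C →ₗc[k] C') (φ : WithConv (C' →ₗ[k] B)) (c : C) :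
    pullback B f φ c = φ (f c) := rfl

/-- Postcomposition with an algebra homomorphism, as a homomorphism of convolution algebras. -/
def pushforward (C : Type*) [AddCommGroup C] [Module k C] [Coalgebra k C] (g : B →ₐ[k] B') :
    WithConv (C →ₗ[k] B) →ₐ[k] WithConv (C →ₗ[k] B') :=
  AlgHom.ofLinearMap
    { toFun := fun φ => toConv (g.toLinearMap ∘ₗ φ.ofConv)
      map_add' := fun _ _ => by ext; simp
      map_smul' := fun _ _ => by ext; simp }
    (by ext c; simp)
    (fun φ ψ => WithConv.ext (LinearMap.algHom_comp_convMul_distrib g φ ψ))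

@[simp] theorem pushforward_apply (g : B →ₐ[k] B') (φ : WithConv (C →ₗ[k] B)) (c : C) :
    pushforward C g φ c = g (φ c) := rfl

theorem toAlg_eq (f : WithConv (C →ₗ[k] k)) : toAlg B f = pushforward C (Algebra.ofId k B) f := rfl

@[simp] theorem toAlg_apply (f : WithConv (C →ₗ[k] k)) (c : C) :
    toAlg B f c = algebraMap k B (f c) := rfl

@[simp] theorem toAlg_mul (f g : WithConv (C →ₗ[k] k)) :
    toAlg B (f * g) = toAlg B f * toAlg B g := by simp only [toAlg_eq, map_mul]

@[simp] theorem toAlg_one : toAlg B (1 : WithConv (C →ₗ[k] k)) = 1 := by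
  simp only [toAlg_eq, map_one]

theorem toAlg_mul_apply (φ : WithConv (C →ₗ[k] k)) (f : WithConv (C →ₗ[k] B)) {ι : Type*} {c : C}
    (r : Coalgebra.Repr k c ι) :
    (toAlg B φ * f) c = ∑ i ∈ r.index, φ (r.left i) • f (r.right i) := by
  rw [r.convMul_apply]
  simp [Algebra.smul_def]

theorem mul_toAlg_apply (φ : WithConv (C →ₗ[k] k)) (f : WithConv (C →ₗ[k] B)) {ι : Type*} {c : C}
    (r : Coalgebra.Repr k c ι) :
    (f * toAlg B φ) c = ∑ i ∈ r.index, φ (r.right i) • f (r.left i) := by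
  rw [r.convMul_apply]
  simp [Algebra.smul_def, Algebra.commutes]

theorem comp_toAlg_mul (L : B →ₗ[k] B') (φ : WithConv (C →ₗ[k] k)) (f : WithConv (C →ₗ[k] B)) :
    toConv (L ∘ₗ (toAlg B φ * f).ofConv) = toAlg B' φ * toConv (L ∘ₗ f.ofConv) := by
  ext c
  rw [toAlg_mul_apply φ _ (ℛ k c), LinearMap.comp_apply, toAlg_mul_apply φ _ (ℛ k c)]
  simp

theorem comp_mul_toAlg (L : B →ₗ[k] B') (φ : WithConv (C →ₗ[k] k)) (f : WithConv (C →ₗ[k] B)) :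
    toConv (L ∘ₗ (f * toAlg B φ).ofConv) = toConv (L ∘ₗ f.ofConv) * toAlg B' φ := by
  ext c
  rw [mul_toAlg_apply φ _ (ℛ k c), LinearMap.comp_apply, mul_toAlg_apply φ _ (ℛ k c)]
  simp

/-- Conjugation of `B`-valued maps by an invertible functional: `f ↦ u * f * u⁻¹`. -/
def conj (u : (WithConv (C →ₗ[k] k))ˣ) (f : WithConv (C →ₗ[k] B)) : WithConv (C →ₗ[k] B) :=
  toAlg B u * f * toAlg B (u⁻¹ : (WithConv (C →ₗ[k] k))ˣ)

theorem toAlg_inv_mul (u : (WithConv (C →ₗ[k] k))ˣ) :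
    toAlg B (u⁻¹ : (WithConv (C →ₗ[k] k))ˣ) * toAlg B (u : WithConv (C →ₗ[k] k)) = 1 := by
  rw [← toAlg_mul, Units.inv_mul, toAlg_one]

theorem conj_mul (u : (WithConv (C →ₗ[k] k))ˣ) (f g : WithConv (C →ₗ[k] B)) :
    conj u (f * g) = conj u f * conj u g := by
  have h : ∀ p : WithConv (C →ₗ[k] B), toAlg B (u⁻¹ : (WithConv (C →ₗ[k] k))ˣ) *
      (toAlg B (u : WithConv (C →ₗ[k] k)) * p) = p := fun p => by
    rw [← mul_assoc, toAlg_inv_mul, one_mul]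
  simp only [conj, mul_assoc, h]

theorem conj_conj (u v : (WithConv (C →ₗ[k] k))ˣ) (f : WithConv (C →ₗ[k] B)) :
    conj u (conj v f) = conj (u * v) f := by
  simp only [conj, mul_inv_rev, Units.val_mul, toAlg_mul, mul_assoc]

@[simp] theorem one_conj (f : WithConv (C →ₗ[k] B)) : conj 1 f = f := by
  simp [conj]

@[simp] theorem conj_one (u : (WithConv (C →ₗ[k] k))ˣ) :
    conj u (1 : WithConv (C →ₗ[k] B)) = 1 := by
  rw [conj, mul_one, ← toAlg_mul, Units.mul_inv, toAlg_one]

theorem comp_conj (L : B →ₗ[k] B') (u : (WithConv (C →ₗ[k] k))ˣ) (f : WithConv (C →ₗ[k] B)) :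
    toConv (L ∘ₗ (conj u f).ofConv) = conj u (toConv (L ∘ₗ f.ofConv)) := by
  rw [conj, comp_mul_toAlg, comp_toAlg_mul]; rfl

theorem pullback_conj (h : C' →ₗc[k] C) (u : (WithConv (C →ₗ[k] k))ˣ)
    (f : WithConv (C →ₗ[k] B)) :
    pullback B h (conj u f) = conj (Units.map (pullback k h).toMonoidHom u) (pullback B h f) := by
  rw [conj, map_mul, map_mul, conj, ← map_inv]; rfl

/-- The external product `φ ⊠ ψ` of two functionals. -/
def box (φ : WithConv (C →ₗ[k] k)) (ψ : WithConv (C' →ₗ[k] k)) : WithConv (C ⊗[k] C' →ₗ[k] k) :=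
  toConv (LinearMap.mul' k k ∘ₗ TensorProduct.map φ.ofConv ψ.ofConv)

@[simp] theorem box_tmul (φ : WithConv (C →ₗ[k] k)) (ψ : WithConv (C' →ₗ[k] k)) (c : C) (c' : C') :
    box φ ψ (c ⊗ₜ[k] c') = φ c * ψ c' := rfl

theorem conv_ext_tmul {f g : WithConv (C ⊗[k] C' →ₗ[k] B)}
    (h : ∀ c c', f (c ⊗ₜ[k] c') = g (c ⊗ₜ[k] c')) : f = g :=
  WithConv.ext (TensorProduct.ext' h)

theorem box_mul_box (φ φ' : WithConv (C →ₗ[k] k)) (ψ ψ' : WithConv (C' →ₗ[k] k)) :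
    box φ ψ * box φ' ψ' = box (φ * φ') (ψ * ψ') := by
  have h : ∀ (α : WithConv (C →ₗ[k] k)) (β : WithConv (C' →ₗ[k] k)), box α β =
      pushforward (C ⊗[k] C') (Algebra.TensorProduct.lmul' k : k ⊗[k] k →ₐ[k] k)
        (toConv (TensorProduct.map α.ofConv β.ofConv)) := fun _ _ => rfl
  rw [h, h, h, ← map_mul, TensorProduct.map_convMul_map]

@[simp] theorem box_one_one :
    box (1 : WithConv (C →ₗ[k] k)) (1 : WithConv (C' →ₗ[k] k)) = 1 := by
  refine conv_ext_tmul fun c c' => ?_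
  simp [mul_comm]

theorem smul_box (r : k) (φ : WithConv (C →ₗ[k] k)) (ψ : WithConv (C' →ₗ[k] k)) :
    box (r • φ) ψ = r • box φ ψ :=
  conv_ext_tmul fun c c' => by simp [mul_assoc]

theorem box_smul (r : k) (φ : WithConv (C →ₗ[k] k)) (ψ : WithConv (C' →ₗ[k] k)) :
    box φ (r • ψ) = r • box φ ψ :=
  conv_ext_tmul fun c c' => by simp [mul_left_comm]

theorem add_box (φ φ' : WithConv (C →ₗ[k] k)) (ψ : WithConv (C' →ₗ[k] k)) :
    box (φ + φ') ψ = box φ ψ + box φ' ψ :=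
  conv_ext_tmul fun c c' => by simp [add_mul]

theorem box_add (φ : WithConv (C →ₗ[k] k)) (ψ ψ' : WithConv (C' →ₗ[k] k)) :
    box φ (ψ + ψ') = box φ ψ + box φ ψ' :=
  conv_ext_tmul fun c c' => by simp [mul_add]

/-- `φ ↦ φ ⊠ 1`. -/
def boxOne (k : Type*) [Field k] (C C' : Type*) [AddCommGroup C] [Module k C] [Coalgebra k C]
    [AddCommGroup C'] [Module k C'] [Coalgebra k C'] :
    WithConv (C →ₗ[k] k) →ₐ[k] WithConv (C ⊗[k] C' →ₗ[k] k) :=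
  AlgHom.ofLinearMap
    { toFun := fun φ => box φ 1
      map_add' := fun _ _ => add_box _ _ _
      map_smul' := fun _ _ => smul_box _ _ _ }
    box_one_one (fun φ ψ => by simp [box_mul_box])

/-- `φ ↦ 1 ⊠ φ`. -/
def oneBox (k : Type*) [Field k] (C C' : Type*) [AddCommGroup C] [Module k C] [Coalgebra k C]
    [AddCommGroup C'] [Module k C'] [Coalgebra k C'] :
    WithConv (C' →ₗ[k] k) →ₐ[k] WithConv (C ⊗[k] C' →ₗ[k] k) :=
  AlgHom.ofLinearMap
    { toFun := fun φ => box 1 φ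
      map_add' := fun _ _ => box_add _ _ _
      map_smul' := fun _ _ => box_smul _ _ _ }
    box_one_one (fun φ ψ => by simp [box_mul_box])

theorem boxOne_apply (φ : WithConv (C →ₗ[k] k)) : boxOne k C C' φ = box φ 1 := rfl

theorem oneBox_apply (φ : WithConv (C' →ₗ[k] k)) : oneBox k C C' φ = box 1 φ := rfl

/-- The map `(f ⊗ g) ∘ Δ` is a convolution product of maps into the two tensor factors; this is
what allows statements about `Δ` to be checked in a convolution algebra. -/
theorem pushforward_includeLeft_mul (f g : WithConv (C →ₗ[k] B)) :
    pushforward C (Algebra.TensorProduct.includeLeft : B →ₐ[k] B ⊗[k] B) f *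
      pushforward C (Algebra.TensorProduct.includeRight : B →ₐ[k] B ⊗[k] B) g =
      toConv (TensorProduct.map f.ofConv g.ofConv ∘ₗ comul) := by
  ext c
  rw [(ℛ k c).convMul_apply, LinearMap.comp_apply, ← (ℛ k c).eq]
  simp

end Convolution

end HopfDeformation

/-! ### The deformed multiplication -/

namespace HopfDeformation

open Coalgebra WithConv

variable {k H : Type*} [Field k] [Ring H] [HopfAlgebra k H]

/-- The multiplication of `H`, as an element of the convolution algebra `Hom(H ⊗ H, H)`. -/
def mulConv (k H : Type*) [Field k] [Ring H] [HopfAlgebra k H] : WithConv (H ⊗[k] H →ₗ[k] H) :=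
  toConv (LinearMap.mul' k H)

/-- `H ⊗ (H ⊗ H) → (H ⊗ H) ⊗ H` as a homomorphism of coalgebras. -/
def assocSymm (k H : Type*) [Field k] [Ring H] [HopfAlgebra k H] :
    H ⊗[k] (H ⊗[k] H) →ₗc[k] (H ⊗[k] H) ⊗[k] H :=
  (Coalgebra.TensorProduct.assoc k k H H H).symm.toCoalgHom

@[simp] theorem assocSymm_tmul (a b c : H) :
    assocSymm k H (a ⊗ₜ[k] (b ⊗ₜ[k] c)) = (a ⊗ₜ[k] b) ⊗ₜ[k] c := rfl

theorem epsTensor_eq (σ : WithConv (H ⊗[k] H →ₗ[k] k)) :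
    epsTensor σ = oneBox k H (H ⊗[k] H) σ := rfl

theorem tensorEps_eq (σ : WithConv (H ⊗[k] H →ₗ[k] k)) :
    tensorEps σ = pullback k (assocSymm k H) (boxOne k (H ⊗[k] H) H σ) := rfl

/-- `epsTensor` as a homomorphism of convolution algebras. -/
def epsTensorHom (k H : Type*) [Field k] [Ring H] [HopfAlgebra k H] :
    WithConv (H ⊗[k] H →ₗ[k] k) →ₐ[k] WithConv (H ⊗[k] (H ⊗[k] H) →ₗ[k] k) :=
  oneBox k H (H ⊗[k] H)

/-- `tensorEps` as a homomorphism of convolution algebras. -/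
def tensorEpsHom (k H : Type*) [Field k] [Ring H] [HopfAlgebra k H] :
    WithConv (H ⊗[k] H →ₗ[k] k) →ₐ[k] WithConv (H ⊗[k] (H ⊗[k] H) →ₗ[k] k) :=
  (pullback k (assocSymm k H)).comp (boxOne k (H ⊗[k] H) H)

/-- `compIdMul` as a homomorphism of convolution algebras. -/
def compIdMulHom (k H : Type*) [Field k] [Ring H] [HopfAlgebra k H] :
    WithConv (H ⊗[k] H →ₗ[k] k) →ₐ[k] WithConv (H ⊗[k] (H ⊗[k] H) →ₗ[k] k) :=
  pullback k (CoalgHom.lTensor H (Bialgebra.mulCoalgHom k H))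

/-- `compMulId` as a homomorphism of convolution algebras. -/
def compMulIdHom (k H : Type*) [Field k] [Ring H] [HopfAlgebra k H] :
    WithConv (H ⊗[k] H →ₗ[k] k) →ₐ[k] WithConv (H ⊗[k] (H ⊗[k] H) →ₗ[k] k) :=
  (pullback k (assocSymm k H)).comp
    (pullback k (CoalgHom.rTensor H (Bialgebra.mulCoalgHom k H)))

theorem deformedMul_unit (u : (WithConv (H ⊗[k] H →ₗ[k] k))ˣ) :
    deformedMul (u : WithConv (H ⊗[k] H →ₗ[k] k)) = (conj u (mulConv k H)).ofConv := by
  rw [deformedMul, Ring.inverse_unit]; rfl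

/-- A linear map `f` into a bialgebra is a homomorphism of coalgebras if it is compatible with `ε`
and `Δ ∘ f` is the convolution product of `f ⊗ 1` and `1 ⊗ f`. -/
def coalgHomOfConv {C L : Type*} [AddCommGroup C] [Module k C] [Coalgebra k C] [Ring L]
    [HopfAlgebra k L] (f : WithConv (C →ₗ[k] L))
    (h1 : toConv (counit (R := k) (A := L) ∘ₗ f.ofConv) = 1)
    (h2 : toConv (comul (R := k) (A := L) ∘ₗ f.ofConv) =
      pushforward C (Algebra.TensorProduct.includeLeft : L →ₐ[k] L ⊗[k] L) f *
        pushforward C (Algebra.TensorProduct.includeRight : L →ₐ[k] L ⊗[k] L) f) : C →ₗc[k] L where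
  toLinearMap := f.ofConv
  counit_comp := congrArg ofConv h1
  map_comp_comul := by
    rw [pushforward_includeLeft_mul] at h2
    exact (congrArg ofConv h2).symm

theorem comp_mulConv_counit :
    toConv (counit (R := k) (A := H) ∘ₗ (mulConv k H).ofConv) = 1 :=
  conv_ext_tmul fun a b => by simp [mulConv, mul_comm]

theorem comp_mulConv_comul :
    toConv (comul (R := k) (A := H) ∘ₗ (mulConv k H).ofConv) =
      pushforward _ (Algebra.TensorProduct.includeLeft : H →ₐ[k] H ⊗[k] H) (mulConv k H) *
        pushforward _ (Algebra.TensorProduct.includeRight : H →ₐ[k] H ⊗[k] H) (mulConv k H) := by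
  rw [pushforward_includeLeft_mul]
  exact congrArg toConv (Bialgebra.mulCoalgHom k H).map_comp_comul.symm

/-- The deformed multiplication is a homomorphism of coalgebras. -/
def conjMulCoalgHom (u : (WithConv (H ⊗[k] H →ₗ[k] k))ˣ) : H ⊗[k] H →ₗc[k] H :=
  coalgHomOfConv (conj u (mulConv k H))
    (by rw [comp_conj, comp_mulConv_counit, conj_one])
    (by
      rw [comp_conj, comp_mulConv_comul, conj_mul]
      exact congrArg₂ _ (comp_conj _ _ _).symm (comp_conj _ _ _).symm)

theorem conjMulCoalgHom_apply (u : (WithConv (H ⊗[k] H →ₗ[k] k))ˣ) (w : H ⊗[k] H) :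
    conjMulCoalgHom u w = deformedMul (u : WithConv (H ⊗[k] H →ₗ[k] k)) w := by
  rw [deformedMul_unit]; rfl

theorem toAlg_boxOne {C C' B B' : Type*} [AddCommGroup C] [Module k C] [Coalgebra k C]
    [AddCommGroup C'] [Module k C'] [Coalgebra k C'] [Ring B] [Algebra k B] [Ring B'] [Algebra k B']
    (φ : WithConv (C →ₗ[k] k)) :
    toAlg (B ⊗[k] B') (boxOne k C C' φ) =
      toConv (TensorProduct.map (toAlg B φ).ofConv (1 : WithConv (C' →ₗ[k] B')).ofConv) := by
  refine conv_ext_tmul fun c c' => ?_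
  rw [toAlg_apply, boxOne_apply, box_tmul, map_mul]
  simp [← TensorProduct.smul_tmul', Algebra.algebraMap_eq_smul_one, mul_comm, smul_smul,
    Algebra.TensorProduct.one_def]

theorem toAlg_oneBox {C C' B B' : Type*} [AddCommGroup C] [Module k C] [Coalgebra k C]
    [AddCommGroup C'] [Module k C'] [Coalgebra k C'] [Ring B] [Algebra k B] [Ring B'] [Algebra k B']
    (φ : WithConv (C' →ₗ[k] k)) :
    toAlg (B ⊗[k] B') (oneBox k C C' φ) =
      toConv (TensorProduct.map (1 : WithConv (C →ₗ[k] B)).ofConv (toAlg B' φ).ofConv) := by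
  refine conv_ext_tmul fun c c' => ?_
  rw [toAlg_apply, oneBox_apply, box_tmul, map_mul]
  simp [← TensorProduct.smul_tmul', Algebra.algebraMap_eq_smul_one, mul_comm, smul_smul,
    Algebra.TensorProduct.one_def]

theorem map_conj_one {C C' B B' : Type*} [AddCommGroup C] [Module k C] [Coalgebra k C]
    [AddCommGroup C'] [Module k C'] [Coalgebra k C'] [Ring B] [Algebra k B] [Ring B'] [Algebra k B']
    (u : (WithConv (C →ₗ[k] k))ˣ) (f : WithConv (C →ₗ[k] B)) (g : WithConv (C' →ₗ[k] B')) :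
    toConv (TensorProduct.map (conj u f).ofConv g.ofConv) =
      conj (Units.map (boxOne k C C').toMonoidHom u)
        (toConv (TensorProduct.map f.ofConv g.ofConv)) := by
  have h1 := toAlg_boxOne (k := k) (B := B) (B' := B') (C' := C') (u : WithConv (C →ₗ[k] k))
  have h2 := toAlg_boxOne (k := k) (B := B) (B' := B') (C' := C')
    ((u⁻¹ : (WithConv (C →ₗ[k] k))ˣ) : WithConv (C →ₗ[k] k))
  rw [conj, conj, ← map_inv]
  refine Eq.symm ((congrArg₂ (fun a b => a * _ * b) h1 h2).trans ?_)
  rw [TensorProduct.map_convMul_map, TensorProduct.map_convMul_map, one_mul, mul_one]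

theorem map_one_conj {C C' B B' : Type*} [AddCommGroup C] [Module k C] [Coalgebra k C]
    [AddCommGroup C'] [Module k C'] [Coalgebra k C'] [Ring B] [Algebra k B] [Ring B'] [Algebra k B']
    (u : (WithConv (C' →ₗ[k] k))ˣ) (f : WithConv (C →ₗ[k] B)) (g : WithConv (C' →ₗ[k] B')) :
    toConv (TensorProduct.map f.ofConv (conj u g).ofConv) =
      conj (Units.map (oneBox k C C').toMonoidHom u)
        (toConv (TensorProduct.map f.ofConv g.ofConv)) := by
  have h1 := toAlg_oneBox (k := k) (B := B) (B' := B') (C := C) (u : WithConv (C' →ₗ[k] k))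
  have h2 := toAlg_oneBox (k := k) (B := B) (B' := B') (C := C)
    ((u⁻¹ : (WithConv (C' →ₗ[k] k))ˣ) : WithConv (C' →ₗ[k] k))
  rw [conj, conj, ← map_inv]
  refine Eq.symm ((congrArg₂ (fun a b => a * _ * b) h1 h2).trans ?_)
  rw [TensorProduct.map_convMul_map, TensorProduct.map_convMul_map, one_mul, mul_one]

/-- Composing a linear map on `H ⊗ H` with `m_σ ⊗ 1` amounts to composing with `m ⊗ 1` and
conjugating by `σ ⊗ ε`. -/
theorem comp_conjMul_rTensor {B : Type*} [Ring B] [Algebra k B]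
    (u : (WithConv (H ⊗[k] H →ₗ[k] k))ˣ) (F : WithConv (H ⊗[k] H →ₗ[k] B)) :
    pullback B (assocSymm k H) (pullback B (CoalgHom.rTensor H (conjMulCoalgHom u)) F) =
      conj (Units.map (tensorEpsHom k H).toMonoidHom u)
        (pullback B (assocSymm k H)
          (pullback B (CoalgHom.rTensor H (Bialgebra.mulCoalgHom k H)) F)) := by
  have h : pullback B (CoalgHom.rTensor H (conjMulCoalgHom u)) F =
      conj (Units.map (boxOne k (H ⊗[k] H) H).toMonoidHom u)
        (pullback B (CoalgHom.rTensor H (Bialgebra.mulCoalgHom k H)) F) :=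
    (congrArg (fun g => toConv (F.ofConv ∘ₗ ofConv g))
      (map_conj_one u (mulConv k H) (toConv (LinearMap.id (R := k) (M := H))))).trans
      (comp_conj _ _ _)
  rw [h, pullback_conj]
  rfl

/-- Composing a linear map on `H ⊗ H` with `1 ⊗ m_σ` amounts to composing with `1 ⊗ m` and
conjugating by `ε ⊗ σ`. -/
theorem comp_conjMul_lTensor {B : Type*} [Ring B] [Algebra k B]
    (u : (WithConv (H ⊗[k] H →ₗ[k] k))ˣ) (F : WithConv (H ⊗[k] H →ₗ[k] B)) :
    pullback B (CoalgHom.lTensor H (conjMulCoalgHom u)) F =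
      conj (Units.map (epsTensorHom k H).toMonoidHom u)
        (pullback B (CoalgHom.lTensor H (Bialgebra.mulCoalgHom k H)) F) :=
  (congrArg (fun g => toConv (F.ofConv ∘ₗ ofConv g))
    (map_one_conj u (toConv (LinearMap.id (R := k) (M := H))) (mulConv k H))).trans
    (comp_conj _ _ _)

theorem mulConv_assoc :
    pullback H (CoalgHom.lTensor H (Bialgebra.mulCoalgHom k H)) (mulConv k H) =
      pullback H (assocSymm k H)
        (pullback H (CoalgHom.rTensor H (Bialgebra.mulCoalgHom k H)) (mulConv k H)) := by
  refine conv_ext_tmul fun a w => ?_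
  induction w with
  | zero => simp
  | add v w hv hw => simp only [TensorProduct.tmul_add, map_add, hv, hw]
  | tmul b c => exact (mul_assoc a b c).symm

/-- The deformed multiplication by a cocycle is associative: the two triple products are the
conjugates of the triple product of `H` by the two sides of the cocycle condition. -/
theorem conjMul_assoc {u : (WithConv (H ⊗[k] H →ₗ[k] k))ˣ}
    (hu : IsMulCocycle (u : WithConv (H ⊗[k] H →ₗ[k] k))) :
    pullback H (CoalgHom.lTensor H (conjMulCoalgHom u)) (conj u (mulConv k H)) =
      pullback H (assocSymm k H)
        (pullback H (CoalgHom.rTensor H (conjMulCoalgHom u)) (conj u (mulConv k H))) := by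
  have hc : Units.map (epsTensorHom k H).toMonoidHom u *
      Units.map (compIdMulHom k H).toMonoidHom u =
      Units.map (tensorEpsHom k H).toMonoidHom u * Units.map (compMulIdHom k H).toMonoidHom u :=
    Units.ext hu.cocycle
  rw [comp_conjMul_lTensor, comp_conjMul_rTensor, pullback_conj, pullback_conj, pullback_conj,
    conj_conj, conj_conj, mulConv_assoc]
  exact congrArg (fun v => conj v _) hc

end HopfDeformation

namespace HopfDeformation

open Coalgebra WithConv

variable {k H : Type*} [Field k] [Ring H] [HopfAlgebra k H]

/-! ### The cocycle deformation as a bialgebra -/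

/-- `b ↦ g ⊗ b` for a group-like element `g`, as a homomorphism of coalgebras. -/
def groupLikeTmul {g : H} (hg : IsGroupLikeElem k g) : H →ₗc[k] H ⊗[k] H where
  toLinearMap := TensorProduct.mk k H H g
  counit_comp := by ext b; simp [hg.counit_eq_one]
  map_comp_comul := by
    ext b
    simp only [LinearMap.comp_apply, TensorProduct.mk_apply, TensorProduct.comul_tmul,
      hg.comul_eq_tmul_self, ← (ℛ k b).eq, map_sum, TensorProduct.tmul_sum]
    rfl

/-- `b ↦ b ⊗ g` for a group-like element `g`, as a homomorphism of coalgebras. -/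
def tmulGroupLike {g : H} (hg : IsGroupLikeElem k g) : H →ₗc[k] H ⊗[k] H where
  toLinearMap := (TensorProduct.mk k H H).flip g
  counit_comp := by ext b; simp [hg.counit_eq_one]
  map_comp_comul := by
    ext b
    simp only [LinearMap.comp_apply, LinearMap.flip_apply, TensorProduct.mk_apply,
      TensorProduct.comul_tmul, hg.comul_eq_tmul_self, ← (ℛ k b).eq, map_sum,
      TensorProduct.sum_tmul]
    rfl

@[simp] theorem groupLikeTmul_apply {g : H} (hg : IsGroupLikeElem k g) (b : H) :
    groupLikeTmul hg b = g ⊗ₜ[k] b := rfl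

@[simp] theorem tmulGroupLike_apply {g : H} (hg : IsGroupLikeElem k g) (b : H) :
    tmulGroupLike hg b = b ⊗ₜ[k] g := rfl

theorem isGroupLikeElem_one : IsGroupLikeElem k (1 : H) := ⟨by simp, by
  simp [Algebra.TensorProduct.one_def]⟩

theorem deformedMul_tmul_of_left {u : (WithConv (H ⊗[k] H →ₗ[k] k))ˣ} {g : H}
    (hg : IsGroupLikeElem k g) (hu : ∀ b : H, u.1 (g ⊗ₜ[k] b) = counit (R := k) b) (b : H) :
    deformedMul u.1 (g ⊗ₜ[k] b) = g * b := by
  have h := pullback_conj (groupLikeTmul hg) u (mulConv k H)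
  have h1 : Units.map (pullback k (groupLikeTmul hg)).toMonoidHom u = 1 :=
    Units.ext (WithConv.ext (LinearMap.ext fun b => by simpa using hu b))
  rw [h1, one_conj] at h
  rw [deformedMul_unit]
  exact congrArg (fun f => f b) h

theorem deformedMul_tmul_of_right {u : (WithConv (H ⊗[k] H →ₗ[k] k))ˣ} {g : H}
    (hg : IsGroupLikeElem k g) (hu : ∀ b : H, u.1 (b ⊗ₜ[k] g) = counit (R := k) b) (b : H) :
    deformedMul u.1 (b ⊗ₜ[k] g) = b * g := by
  have h := pullback_conj (tmulGroupLike hg) u (mulConv k H)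
  have h1 : Units.map (pullback k (tmulGroupLike hg)).toMonoidHom u = 1 :=
    Units.ext (WithConv.ext (LinearMap.ext fun b => by simpa using hu b))
  rw [h1, one_conj] at h
  rw [deformedMul_unit]
  exact congrArg (fun f => f b) h

/-- The underlying vector space of `H`, with the multiplication deformed by a cocycle. -/
def Deformed {σ : WithConv (H ⊗[k] H →ₗ[k] k)} (_ : IsMulCocycle σ) : Type _ := H

section Deformed

variable {σ : WithConv (H ⊗[k] H →ₗ[k] k)} (hσ : IsMulCocycle σ)

instance : AddCommGroup (Deformed hσ) := inferInstanceAs (AddCommGroup H)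
instance : Module k (Deformed hσ) := inferInstanceAs (Module k H)
instance : Coalgebra k (Deformed hσ) := inferInstanceAs (Coalgebra k H)

/-- The identity map `H → H_σ`. -/
def toDeformed : H ≃ₗc[k] Deformed hσ := CoalgEquiv.refl k H

instance : One (Deformed hσ) := ⟨toDeformed hσ 1⟩

instance : Mul (Deformed hσ) := ⟨fun a b =>
  toDeformed hσ (deformedMul σ ((toDeformed hσ).symm a ⊗ₜ[k] (toDeformed hσ).symm b))⟩

theorem toDeformed_one : toDeformed hσ 1 = 1 := rfl

theorem toDeformed_mul (a b : H) :
    toDeformed hσ a * toDeformed hσ b = toDeformed hσ (deformedMul σ (a ⊗ₜ[k] b)) := rfl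

theorem deformedMul_assoc (hσ : IsMulCocycle σ) (a b c : H) :
    deformedMul σ (deformedMul σ (a ⊗ₜ[k] b) ⊗ₜ[k] c) =
      deformedMul σ (a ⊗ₜ[k] deformedMul σ (b ⊗ₜ[k] c)) := by
  obtain ⟨u, rfl⟩ := hσ.isUnit
  have := congrArg (fun f => f (a ⊗ₜ[k] (b ⊗ₜ[k] c))) (conjMul_assoc hσ)
  simp only [pullback_apply, assocSymm_tmul, Coalgebra.TensorProduct.map_tmul,
    conjMulCoalgHom_apply, CoalgHom.id_apply, ← deformedMul_unit] at this
  exact this.symm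

theorem one_deformedMul (hσ : IsMulCocycle σ) (b : H) : deformedMul σ (1 ⊗ₜ[k] b) = b := by
  obtain ⟨u, rfl⟩ := hσ.isUnit
  rw [deformedMul_tmul_of_left isGroupLikeElem_one hσ.one_left, one_mul]

theorem deformedMul_one (hσ : IsMulCocycle σ) (b : H) : deformedMul σ (b ⊗ₜ[k] 1) = b := by
  obtain ⟨u, rfl⟩ := hσ.isUnit
  rw [deformedMul_tmul_of_right isGroupLikeElem_one hσ.one_right, mul_one]

instance : Ring (Deformed hσ) where
  __ := (inferInstance : AddCommGroup (Deformed hσ))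
  left_distrib a b c := by
    change deformedMul σ _ = deformedMul σ _ + deformedMul σ _
    rw [map_add, TensorProduct.tmul_add, map_add]
  right_distrib a b c := by
    change deformedMul σ _ = deformedMul σ _ + deformedMul σ _
    rw [map_add, TensorProduct.add_tmul, map_add]
  zero_mul a := by
    change deformedMul σ _ = 0
    rw [map_zero, TensorProduct.zero_tmul, map_zero]
  mul_zero a := by
    change deformedMul σ _ = 0
    rw [map_zero, TensorProduct.tmul_zero, map_zero]
  mul_assoc a b c := deformedMul_assoc hσ a b c
  one_mul a := one_deformedMul hσ a
  mul_one a := deformedMul_one hσ a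

instance : Algebra k (Deformed hσ) := Algebra.ofModule
  (fun r a b => (deformedMul σ).map_smul r
    ((toDeformed hσ).symm a ⊗ₜ[k] (toDeformed hσ).symm b))
  (fun r a b => (congrArg (deformedMul σ) (TensorProduct.tmul_smul r _ _)).trans
    ((deformedMul σ).map_smul r ((toDeformed hσ).symm a ⊗ₜ[k] (toDeformed hσ).symm b)))

theorem mul'_deformed : LinearMap.mul' k (Deformed hσ) = (toDeformed hσ).toLinearMap ∘ₗ
    deformedMul σ ∘ₗ TensorProduct.map (toDeformed hσ).symm.toLinearMap
      (toDeformed hσ).symm.toLinearMap :=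
  TensorProduct.ext' fun _ _ => rfl

theorem counit_deformedMul (hσ : IsMulCocycle σ) (w : H ⊗[k] H) :
    counit (R := k) (deformedMul σ w) = counit (R := k) w := by
  obtain ⟨u, rfl⟩ := hσ.isUnit
  rw [← conjMulCoalgHom_apply, CoalgHomClass.counit_comp_apply]

theorem comul_deformedMul (hσ : IsMulCocycle σ) (w : H ⊗[k] H) :
    comul (R := k) (deformedMul σ w) =
      TensorProduct.map (deformedMul σ) (deformedMul σ) (comul (R := k) w) := by
  obtain ⟨u, rfl⟩ := hσ.isUnit
  have : (conjMulCoalgHom u).toLinearMap = deformedMul u.1 :=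
    LinearMap.ext (conjMulCoalgHom_apply u)
  rw [← this]
  exact (CoalgHomClass.map_comp_comul_apply (conjMulCoalgHom u) w).symm

instance : Bialgebra k (Deformed hσ) := Bialgebra.mk' k (Deformed hσ)
  (Bialgebra.counit_one (R := k) (A := H))
  (fun {a b} => (counit_deformedMul hσ
      ((toDeformed hσ).symm a ⊗ₜ[k] (toDeformed hσ).symm b)).trans
    (mul_comm _ _))
  (Bialgebra.comul_one (R := k) (A := H))
  (fun {a b} => by
    have h1 : comul (R := k) (a * b) = TensorProduct.map (LinearMap.mul' k (Deformed hσ))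
        (LinearMap.mul' k (Deformed hσ)) (comul (R := k) (a ⊗ₜ[k] b)) := by
      have e : TensorProduct.map (toDeformed hσ).symm.toLinearMap
          (toDeformed hσ).symm.toLinearMap = LinearMap.id := TensorProduct.ext' fun _ _ => rfl
      rw [mul'_deformed, e]
      exact comul_deformedMul hσ ((toDeformed hσ).symm a ⊗ₜ[k] (toDeformed hσ).symm b)
    rw [h1, TensorProduct.comul_tmul]
    generalize comul (R := k) a = v
    generalize comul (R := k) b = w
    induction v using TensorProduct.induction_on with
    | zero =>
      simp only [TensorProduct.zero_tmul, LinearEquiv.map_zero, LinearMap.map_zero, zero_mul]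
    | add v v' hv hv' => simp only [TensorProduct.add_tmul, map_add, hv, hv', add_mul]
    | tmul a b =>
      induction w using TensorProduct.induction_on with
      | zero =>
        simp only [TensorProduct.tmul_zero, LinearEquiv.map_zero, LinearMap.map_zero, mul_zero]
      | add v v' hv hv' => simp only [TensorProduct.tmul_add, map_add, hv, hv', mul_add]
      | tmul c d => simp)

end Deformed
end HopfDeformation

namespace HopfDeformation

open Coalgebra WithConv

variable {k H L : Type*} [Field k] [Ring H] [HopfAlgebra k H] [Ring L] [HopfAlgebra k L]
  {B : Type*} [Ring B] [Algebra k B]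

/-! ### Composition of cocycles -/

/-- `σ ↦ σ ∘ (Φ ⊗ Φ)`. -/
def pullback₂ (Φ : H →ₗc[k] L) : WithConv (L ⊗[k] L →ₗ[k] k) →ₐ[k] WithConv (H ⊗[k] H →ₗ[k] k) :=
  pullback k (Coalgebra.TensorProduct.map Φ Φ)

@[simp] theorem pullback₂_tmul (Φ : H →ₗc[k] L) (σ : WithConv (L ⊗[k] L →ₗ[k] k)) (a b : H) :
    pullback₂ Φ σ (a ⊗ₜ[k] b) = σ (Φ a ⊗ₜ[k] Φ b) := rfl

/-- `σ ↦ σ ∘ (Φ ⊗ (Φ ⊗ Φ))`. -/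
def pullback₃ (Φ : H →ₗc[k] L) :
    WithConv (L ⊗[k] (L ⊗[k] L) →ₗ[k] k) →ₐ[k] WithConv (H ⊗[k] (H ⊗[k] H) →ₗ[k] k) :=
  pullback k (Coalgebra.TensorProduct.map Φ (Coalgebra.TensorProduct.map Φ Φ))

theorem conv_ext_tmul₃ {C C' C'' : Type*} [AddCommGroup C] [Module k C] [AddCommGroup C']
    [Module k C'] [AddCommGroup C''] [Module k C''] {f g : WithConv (C ⊗[k] (C' ⊗[k] C'') →ₗ[k] B)}
    (h : ∀ a b c, f (a ⊗ₜ[k] (b ⊗ₜ[k] c)) = g (a ⊗ₜ[k] (b ⊗ₜ[k] c))) : f = g :=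
  WithConv.ext (TensorProduct.ext (LinearMap.ext fun a => TensorProduct.ext' (h a)))

theorem pullback₂_conj_mulConv {u : (WithConv (H ⊗[k] H →ₗ[k] k))ˣ} {Φ : H →ₗc[k] L}
    (hΦ : ∀ a b : H, Φ (deformedMul u.1 (a ⊗ₜ[k] b)) = Φ a * Φ b) :
    toConv (Φ.toLinearMap ∘ₗ (conj u (mulConv k H)).ofConv) =
      pullback L (Coalgebra.TensorProduct.map Φ Φ) (mulConv k L) := by
  refine conv_ext_tmul fun a b => ?_
  have := hΦ a b
  rw [deformedMul_unit] at this
  exact this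

/-- If the deformation of `H` by `τ` maps to `L` by a homomorphism `Φ` of bialgebras and `ρ` is a
cocycle on `L`, then `(ρ ∘ (Φ ⊗ Φ)) * τ` is a cocycle on `H`. -/
theorem IsMulCocycle.comp {τ : WithConv (H ⊗[k] H →ₗ[k] k)} (hτ : IsMulCocycle τ)
    {ρ : WithConv (L ⊗[k] L →ₗ[k] k)} (hρ : IsMulCocycle ρ) (Φ : H →ₗc[k] L) (h1 : Φ 1 = 1)
    (hΦ : ∀ a b : H, Φ (deformedMul τ (a ⊗ₜ[k] b)) = Φ a * Φ b) :
    IsMulCocycle (pullback₂ Φ ρ * τ) := by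
  obtain ⟨u, rfl⟩ := hτ.isUnit
  refine ⟨(hρ.isUnit.map (pullback₂ Φ)).mul u.isUnit, ?_, fun a => ?_, fun a => ?_⟩
  · have e1 : epsTensor (pullback₂ Φ ρ) = pullback₃ Φ (epsTensor ρ) :=
      conv_ext_tmul₃ fun a b c => congrArg (· * ρ (Φ b ⊗ₜ[k] Φ c))
        (CoalgHomClass.counit_comp_apply Φ a).symm
    have e2 : tensorEps (pullback₂ Φ ρ) = pullback₃ Φ (tensorEps ρ) :=
      conv_ext_tmul₃ fun a b c => congrArg (ρ (Φ a ⊗ₜ[k] Φ b) * ·)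
        (CoalgHomClass.counit_comp_apply Φ c).symm
    -- moving `ε ⊗ τ` past `ρ(1 ⊗ m)` turns `m` into `m_τ`, which `Φ` maps to the product of `L`
    have e3 : epsTensor u.1 * compIdMul (pullback₂ Φ ρ) =
        pullback₃ Φ (compIdMul ρ) * epsTensor u.1 := by
      have h : pullback₃ Φ (compIdMul ρ) = epsTensor u.1 * compIdMul (pullback₂ Φ ρ) *
          ((Units.map (epsTensorHom k H).toMonoidHom u)⁻¹ : _ˣ) := by
        refine Eq.trans ?_ (comp_conjMul_lTensor u (pullback₂ Φ ρ))
        refine conv_ext_tmul₃ fun a b c => ?_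
        refine congrArg (fun z => ρ (Φ a ⊗ₜ[k] z)) ?_
        exact (hΦ b c).symm.trans (congrArg Φ (conjMulCoalgHom_apply u _).symm)
      rw [h]
      exact (Units.inv_mul_cancel_right _ _).symm
    have e4 : tensorEps u.1 * compMulId (pullback₂ Φ ρ) =
        pullback₃ Φ (compMulId ρ) * tensorEps u.1 := by
      have h : pullback₃ Φ (compMulId ρ) = tensorEps u.1 * compMulId (pullback₂ Φ ρ) *
          ((Units.map (tensorEpsHom k H).toMonoidHom u)⁻¹ : _ˣ) := by
        refine Eq.trans ?_ (comp_conjMul_rTensor u (pullback₂ Φ ρ))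
        refine conv_ext_tmul₃ fun a b c => ?_
        refine congrArg (fun z => ρ (z ⊗ₜ[k] Φ c)) ?_
        exact (hΦ a b).symm.trans (congrArg Φ (conjMulCoalgHom_apply u _).symm)
      rw [h]
      exact (Units.inv_mul_cancel_right _ _).symm
    have m1 : ∀ α β : WithConv (H ⊗[k] H →ₗ[k] k), epsTensor (α * β) = epsTensor α * epsTensor β :=
      map_mul (epsTensorHom k H)
    have m2 : ∀ α β : WithConv (H ⊗[k] H →ₗ[k] k), tensorEps (α * β) = tensorEps α * tensorEps β :=
      map_mul (tensorEpsHom k H)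
    have m3 : ∀ α β : WithConv (H ⊗[k] H →ₗ[k] k), compIdMul (α * β) = compIdMul α * compIdMul β :=
      map_mul (compIdMulHom k H)
    have m4 : ∀ α β : WithConv (H ⊗[k] H →ₗ[k] k), compMulId (α * β) = compMulId α * compMulId β :=
      map_mul (compMulIdHom k H)
    calc epsTensor (pullback₂ Φ ρ * u.1) * compIdMul (pullback₂ Φ ρ * u.1)
        = epsTensor (pullback₂ Φ ρ) * (epsTensor u.1 * compIdMul (pullback₂ Φ ρ)) *
            compIdMul u.1 := by rw [m1, m3]; simp only [mul_assoc]
      _ = pullback₃ Φ (epsTensor ρ * compIdMul ρ) * (epsTensor u.1 * compIdMul u.1) := by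
          rw [e3, e1, map_mul]; simp only [mul_assoc]
      _ = pullback₃ Φ (tensorEps ρ * compMulId ρ) * (tensorEps u.1 * compMulId u.1) := by
          rw [hτ.cocycle, hρ.cocycle]
      _ = tensorEps (pullback₂ Φ ρ) * (tensorEps u.1 * compMulId (pullback₂ Φ ρ)) *
            compMulId u.1 := by rw [e4, e2, map_mul]; simp only [mul_assoc]
      _ = tensorEps (pullback₂ Φ ρ * u.1) * compMulId (pullback₂ Φ ρ * u.1) := by
          rw [m2, m4]; simp only [mul_assoc]
  · have h := map_mul (pullback k (groupLikeTmul (k := k) (H := H) isGroupLikeElem_one))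
      (pullback₂ Φ ρ) u.1
    have h2 : pullback k (groupLikeTmul (k := k) (H := H) isGroupLikeElem_one)
        (pullback₂ Φ ρ) = 1 :=
      WithConv.ext (LinearMap.ext fun b => by
        refine (congrArg (fun z => ρ (z ⊗ₜ[k] Φ b)) h1).trans ?_
        rw [hρ.one_left]; exact CoalgHomClass.counit_comp_apply Φ b)
    have h3 : pullback k (groupLikeTmul (k := k) (H := H) isGroupLikeElem_one) u.1 = 1 :=
      WithConv.ext (LinearMap.ext hτ.one_left)
    rw [h2, h3, mul_one] at h
    exact congrArg (fun f => f a) h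
  · have h := map_mul (pullback k (tmulGroupLike (k := k) (H := H) isGroupLikeElem_one))
      (pullback₂ Φ ρ) u.1
    have h2 : pullback k (tmulGroupLike (k := k) (H := H) isGroupLikeElem_one)
        (pullback₂ Φ ρ) = 1 :=
      WithConv.ext (LinearMap.ext fun b => by
        refine (congrArg (fun z => ρ (Φ b ⊗ₜ[k] z)) h1).trans ?_
        rw [hρ.one_right]; exact CoalgHomClass.counit_comp_apply Φ b)
    have h3 : pullback k (tmulGroupLike (k := k) (H := H) isGroupLikeElem_one) u.1 = 1 :=
      WithConv.ext (LinearMap.ext hτ.one_right)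
    rw [h2, h3, mul_one] at h
    exact congrArg (fun f => f a) h

/-- Deforming by `(ρ ∘ (Φ ⊗ Φ)) * τ` is deforming first by `τ` and then by `ρ`. -/
theorem map_deformedMul_comp {τ : WithConv (H ⊗[k] H →ₗ[k] k)} (hτ : IsUnit τ)
    {ρ : WithConv (L ⊗[k] L →ₗ[k] k)} (hρ : IsUnit ρ) (Φ : H →ₗc[k] L)
    (hΦ : ∀ a b : H, Φ (deformedMul τ (a ⊗ₜ[k] b)) = Φ a * Φ b) (a b : H) :
    Φ (deformedMul (pullback₂ Φ ρ * τ) (a ⊗ₜ[k] b)) = deformedMul ρ (Φ a ⊗ₜ[k] Φ b) := by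
  obtain ⟨u, rfl⟩ := hτ
  obtain ⟨v, rfl⟩ := hρ
  have h1 : deformedMul (pullback₂ Φ v.1 * u.1) =
      (conj (Units.map (pullback₂ Φ).toMonoidHom v * u) (mulConv k H)).ofConv :=
    deformedMul_unit (Units.map (pullback₂ Φ).toMonoidHom v * u)
  have h2 : toConv (Φ.toLinearMap ∘ₗ
      (conj (Units.map (pullback₂ Φ).toMonoidHom v * u) (mulConv k H)).ofConv) =
      pullback L (Coalgebra.TensorProduct.map Φ Φ) (conj v (mulConv k L)) := by
    rw [← conj_conj, comp_conj, pullback₂_conj_mulConv hΦ, pullback_conj]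
    rfl
  rw [h1, deformedMul_unit]
  exact congrArg (fun f => f (a ⊗ₜ[k] b)) h2

theorem deformedMul_of_one :
    deformedMul (1 : WithConv (H ⊗[k] H →ₗ[k] k)) = LinearMap.mul' k H := by
  have := deformedMul_unit (1 : (WithConv (H ⊗[k] H →ₗ[k] k))ˣ)
  rw [one_conj] at this
  exact this

theorem isMulCocycle_one : IsMulCocycle (1 : WithConv (H ⊗[k] H →ₗ[k] k)) where
  isUnit := isUnit_one
  cocycle := by
    have h1 : epsTensor (1 : WithConv (H ⊗[k] H →ₗ[k] k)) = 1 := map_one (epsTensorHom k H)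
    have h2 : tensorEps (1 : WithConv (H ⊗[k] H →ₗ[k] k)) = 1 := map_one (tensorEpsHom k H)
    have h3 : compIdMul (1 : WithConv (H ⊗[k] H →ₗ[k] k)) = 1 := map_one (compIdMulHom k H)
    have h4 : compMulId (1 : WithConv (H ⊗[k] H →ₗ[k] k)) = 1 := map_one (compMulIdHom k H)
    rw [h1, h2, h3, h4]
  one_left a := by simp
  one_right a := by simp

/-- Cocycles can be pulled back along homomorphisms of bialgebras. -/
theorem IsMulCocycle.pullback {ρ : WithConv (L ⊗[k] L →ₗ[k] k)} (hρ : IsMulCocycle ρ)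
    (π : H →ₗc[k] L) (h1 : π 1 = 1) (hπ : ∀ a b : H, π (a * b) = π a * π b) :
    IsMulCocycle (pullback₂ π ρ) := by
  have := isMulCocycle_one.comp hρ π h1 (fun a b => by
    rw [deformedMul_of_one]; exact hπ a b)
  rwa [mul_one] at this

/-! ### Multiplication by skew-primitive elements -/

/-- `F ↦ F(w ⊗ -)`. -/
def evalLeft (w : H) (F : WithConv (H ⊗[k] H →ₗ[k] B)) : WithConv (H →ₗ[k] B) :=
  toConv (F.ofConv ∘ₗ TensorProduct.mk k H H w)

@[simp] theorem evalLeft_apply (w : H) (F : WithConv (H ⊗[k] H →ₗ[k] B)) (b : H) :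
    evalLeft w F b = F (w ⊗ₜ[k] b) := rfl

theorem evalLeft_mul_of_skew {x g : H}
    (hx : comul (R := k) x = x ⊗ₜ[k] 1 + g ⊗ₜ[k] x) (F F' : WithConv (H ⊗[k] H →ₗ[k] B)) :
    evalLeft x (F * F') =
      evalLeft x F * evalLeft 1 F' + evalLeft g F * evalLeft x F' := by
  ext b
  rw [evalLeft_apply, LinearMap.convMul_apply, TensorProduct.comul_tmul, hx, WithConv.ofConv_add,
    LinearMap.add_apply, (ℛ k b).convMul_apply, (ℛ k b).convMul_apply, ← (ℛ k b).eq]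
  simp [TensorProduct.tmul_sum, TensorProduct.add_tmul, Finset.sum_add_distrib]

theorem evalLeft_mul_of_groupLike {g : H} (hg : IsGroupLikeElem k g)
    (F F' : WithConv (H ⊗[k] H →ₗ[k] B)) :
    evalLeft g (F * F') = evalLeft g F * evalLeft g F' :=
  map_mul (HopfDeformation.pullback B (groupLikeTmul hg)) F F'

/-- `b ↦ φ(b₁) b₂`. -/
def actLeft (φ : WithConv (H →ₗ[k] k)) : H →ₗ[k] H := (toAlg H φ * toConv LinearMap.id).ofConv

/-- `b ↦ b₁ φ(b₂)`. -/
def actRight (φ : WithConv (H →ₗ[k] k)) : H →ₗ[k] H := (toConv LinearMap.id * toAlg H φ).ofConv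

/-- The product of a skew-primitive element with any other in a cocycle deformation. -/
theorem deformedMul_of_skew {σ : WithConv (H ⊗[k] H →ₗ[k] k)} (hσ : IsUnit σ) {x g : H}
    (hg : IsGroupLikeElem k g) (hx : comul (R := k) x = x ⊗ₜ[k] 1 + g ⊗ₜ[k] x)
    (h1 : evalLeft 1 σ = 1) (h2 : evalLeft g σ = 1) (b : H) :
    deformedMul σ (x ⊗ₜ[k] b) =
      x * b + (actLeft (evalLeft x σ) b - g * actRight (evalLeft x σ) b) := by
  obtain ⟨u, rfl⟩ := hσ
  set v : WithConv (H ⊗[k] H →ₗ[k] k) := Units.val u⁻¹ with hv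
  have huv : u.1 * v = 1 := u.mul_inv
  have hx0 : counit (R := k) x = 0 := by
    have h3 : x = counit (R := k) x • (1 : H) + x := by
      have h4 := congrArg (TensorProduct.lid k H ∘ (counit (R := k) (A := H)).rTensor H) hx
      rw [Function.comp_apply, Function.comp_apply, rTensor_counit_comul] at h4
      simpa [hg.counit_eq_one] using h4
    simpa using congrArg (counit (R := k)) (left_eq_add.1 (h3.trans (add_comm _ _)))
  have v1 : evalLeft 1 v = 1 := by
    have := evalLeft_mul_of_groupLike isGroupLikeElem_one u.1 v
    rw [h1, one_mul, huv] at this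
    rw [← this]; ext b; simp
  have vx : evalLeft x v = - evalLeft x u.1 := by
    have := evalLeft_mul_of_skew hx u.1 v
    rw [v1, h2, huv, mul_one, one_mul] at this
    have h0 : evalLeft x (1 : WithConv (H ⊗[k] H →ₗ[k] k)) = 0 := by ext b; simp [hx0]
    rw [h0] at this
    exact (neg_eq_of_add_eq_zero_right this.symm).symm
  have tA : ∀ (w : H) (φ : WithConv (H ⊗[k] H →ₗ[k] k)),
      evalLeft w (toAlg H φ) = toAlg H (evalLeft w φ) := fun _ _ => rfl
  have key : evalLeft x (conj u (mulConv k H)) = toConv (LinearMap.mulLeft k x) +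
      (toAlg H (evalLeft x u.1) * toConv LinearMap.id -
        toConv (LinearMap.mulLeft k g ∘ₗ actRight (evalLeft x u.1))) := by
    have e1 : evalLeft 1 (mulConv k H) = toConv LinearMap.id := by
      ext b; simp [mulConv]
    have e2 : evalLeft g (mulConv k H) = toConv (LinearMap.mulLeft k g) := rfl
    have e3 : evalLeft x (mulConv k H) = toConv (LinearMap.mulLeft k x) := rfl
    have e4 : toConv (LinearMap.mulLeft k g ∘ₗ actRight (evalLeft x u.1)) =
        toConv (LinearMap.mulLeft k g) * toAlg H (evalLeft x u.1) :=
      comp_mul_toAlg (LinearMap.mulLeft k g) (evalLeft x u.1) (toConv LinearMap.id)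
    rw [conj, evalLeft_mul_of_skew hx, evalLeft_mul_of_skew hx, evalLeft_mul_of_groupLike hg,
      tA, tA, tA, tA, h2, v1, vx, e1, e2, e3, e4]
    have e5 : toAlg H (-evalLeft x u.1) = - toAlg H (evalLeft x u.1) := by
      simp only [toAlg_eq, map_neg]
    rw [e5]
    simp only [toAlg_one, one_mul, mul_one, mul_neg]
    abel
  rw [deformedMul_unit]
  exact congrArg (fun f => f b) key

/-! ### Translations of a bialgebra by functionals -/

theorem actLeft_eq (φ : WithConv (H →ₗ[k] k)) {ι : Type*} {b : H} (r : Coalgebra.Repr k b ι) :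
    actLeft φ b = ∑ i ∈ r.index, φ (r.left i) • r.right i := toAlg_mul_apply φ _ r

theorem actRight_eq (φ : WithConv (H →ₗ[k] k)) {ι : Type*} {b : H} (r : Coalgebra.Repr k b ι) :
    actRight φ b = ∑ i ∈ r.index, φ (r.right i) • r.left i := mul_toAlg_apply φ _ r

theorem actLeft_mul (φ ψ : WithConv (H →ₗ[k] k)) (b : H) :
    actLeft (φ * ψ) b = actLeft ψ (actLeft φ b) := by
  have h := comp_toAlg_mul (actLeft ψ) φ (toConv LinearMap.id)
  have h2 : actLeft (φ * ψ) = (toAlg H φ * (toAlg H ψ * toConv LinearMap.id)).ofConv := by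
    rw [actLeft, toAlg_mul, mul_assoc]
  rw [h2]
  exact (congrArg (fun f => f b) h).symm

theorem actRight_mul (φ ψ : WithConv (H →ₗ[k] k)) (b : H) :
    actRight (φ * ψ) b = actRight φ (actRight ψ b) := by
  have h := comp_mul_toAlg (actRight φ) ψ (toConv LinearMap.id)
  have h2 : actRight (φ * ψ) = (toConv LinearMap.id * toAlg H φ * toAlg H ψ).ofConv := by
    rw [actRight, toAlg_mul, ← mul_assoc]
  rw [h2]
  exact (congrArg (fun f => f b) h).symm

@[simp] theorem actLeft_one (b : H) : actLeft (1 : WithConv (H →ₗ[k] k)) b = b := by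
  rw [actLeft, toAlg_one, one_mul]; rfl

@[simp] theorem actRight_one (b : H) : actRight (1 : WithConv (H →ₗ[k] k)) b = b := by
  rw [actRight, toAlg_one, mul_one]; rfl

theorem actLeft_apply (φ : WithConv (H →ₗ[k] k)) (b : H) :
    actLeft φ b = TensorProduct.lid k H (φ.ofConv.rTensor H (comul (R := k) b)) := by
  rw [actLeft_eq φ (ℛ k b), ← (ℛ k b).eq]
  simp

theorem actRight_apply (φ : WithConv (H →ₗ[k] k)) (b : H) :
    actRight φ b = TensorProduct.rid k H (φ.ofConv.lTensor H (comul (R := k) b)) := by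
  rw [actRight_eq φ (ℛ k b), ← (ℛ k b).eq]
  simp

/-- `(χ, ε)`-skew derivations act on products from the left by a twisted Leibniz rule. -/
theorem actLeft_skewDer {d χ : WithConv (H →ₗ[k] k)}
    (hd : ∀ a b, d (a * b) = d a * counit (R := k) b + χ a * d b) (a b : H) :
    actLeft d (a * b) = actLeft d a * b + actLeft χ a * actLeft d b := by
  suffices h : actLeft d (a * b) = actLeft d a * actLeft (1 : WithConv (H →ₗ[k] k)) b +
      actLeft χ a * actLeft d b by
    rwa [actLeft_one] at h
  simp only [actLeft_apply, Bialgebra.comul_mul]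
  generalize comul (R := k) a = v
  generalize comul (R := k) b = w
  induction v using TensorProduct.induction_on with
  | zero => simp
  | add v v' hv hv' => simp only [add_mul, map_add, hv, hv']; abel
  | tmul a b =>
    induction w using TensorProduct.induction_on with
    | zero => simp
    | add v v' hv hv' => simp only [mul_add, map_add, hv, hv']; abel
    | tmul c e => simp [hd, add_smul, smul_smul, mul_comm]

/-- `(χ, ε)`-skew derivations act on products from the right by a twisted Leibniz rule. -/
theorem actRight_skewDer {d χ : WithConv (H →ₗ[k] k)}
    (hd : ∀ a b, d (a * b) = d a * counit (R := k) b + χ a * d b) (a b : H) :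
    actRight d (a * b) = actRight d a * b + actRight χ a * actRight d b := by
  suffices h : actRight d (a * b) = actRight d a * actRight (1 : WithConv (H →ₗ[k] k)) b +
      actRight χ a * actRight d b by
    rwa [actRight_one] at h
  simp only [actRight_apply, Bialgebra.comul_mul]
  generalize comul (R := k) a = v
  generalize comul (R := k) b = w
  induction v using TensorProduct.induction_on with
  | zero => simp
  | add v v' hv hv' => simp only [add_mul, map_add, hv, hv']; abel
  | tmul a b =>
    induction w using TensorProduct.induction_on with
    | zero => simp
    | add v v' hv hv' => simp only [mul_add, map_add, hv, hv']; abel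
    | tmul c e => simp [hd, add_smul, smul_smul, mul_comm]

end HopfDeformation

namespace HopfDeformation

open Coalgebra WithConv

/-! ### The deformed antipode -/

section Comatrix

variable {k C ι : Type*} [Field k] [AddCommGroup C] [Module k C] [Coalgebra k C] [Fintype ι]
  [DecidableEq ι]

/-- A square matrix `t` of elements of a coalgebra with `Δ(t) = t ⊗ t` and `ε(t) = 1`. -/
structure IsComatrix (k : Type*) {C ι : Type*} [Field k] [AddCommGroup C] [Module k C]
    [Coalgebra k C] [Fintype ι] [DecidableEq ι] (t : ι → ι → C) : Prop where
  comul_eq : ∀ i j, comul (R := k) (t i j) = ∑ l, t i l ⊗ₜ[k] t l j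
  counit_eq : ∀ i j, counit (R := k) (t i j) = if i = j then 1 else 0

/-- The coefficients of `Δ` with respect to a basis form a comatrix which spans the coalgebra. -/
theorem exists_isComatrix (b : Module.Basis ι k C) :
    ∃ t : ι → ι → C, IsComatrix k t ∧ ∀ p, b p = ∑ q, counit (R := k) (b q) • t q p := by
  let t : ι → ι → C := fun q p =>
    TensorProduct.lid k C ((b.coord q).rTensor C (comul (R := k) (b p)))
  have h1 : ∀ w : C ⊗[k] C, w = ∑ q, b q ⊗ₜ[k] TensorProduct.lid k C ((b.coord q).rTensor C w) := by
    intro w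
    induction w using TensorProduct.induction_on with
    | zero => simp
    | add v w hv hw =>
      conv_lhs => rw [hv, hw]
      simp only [map_add, TensorProduct.tmul_add, Finset.sum_add_distrib]
    | tmul x y =>
      conv_lhs => rw [← b.sum_repr x, TensorProduct.sum_tmul]
      exact Finset.sum_congr rfl fun q _ => by simp [TensorProduct.smul_tmul]
  have h2 : ∀ p, comul (R := k) (b p) = ∑ q, b q ⊗ₜ[k] t q p := fun p => h1 _
  have h3 : ∀ p, b p = ∑ q, counit (R := k) (b q) • t q p := fun p => by
    have := rTensor_counit_comul (R := k) (b p)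
    rw [h2] at this
    have := congrArg (TensorProduct.lid k C) this
    simpa using this.symm
  have inj : ∀ u v : ι → C ⊗[k] C, ∑ q, b q ⊗ₜ[k] u q = ∑ q, b q ⊗ₜ[k] v q → u = v := by
    intro u v h
    funext r
    have := congrArg (fun w => TensorProduct.lid k (C ⊗[k] C) ((b.coord r).rTensor (C ⊗[k] C) w)) h
    simpa [Finsupp.single_apply] using this
  refine ⟨t, ⟨fun i j => ?_, fun i j => ?_⟩, h3⟩
  · have h4 := coassoc_apply (R := k) (b j)
    rw [h2] at h4
    simp only [map_sum, LinearMap.rTensor_tmul, LinearMap.lTensor_tmul, h2,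
      TensorProduct.sum_tmul, TensorProduct.assoc_tmul] at h4
    rw [Finset.sum_comm] at h4
    simp only [← TensorProduct.tmul_sum] at h4
    exact (congrFun (inj _ _ h4) i).symm
  · have h4 := lTensor_counit_comul (R := k) (b j)
    rw [h2] at h4
    have h5 := congrArg (TensorProduct.rid k C) h4
    simp only [map_sum, LinearMap.lTensor_tmul, TensorProduct.rid_tmul, one_smul] at h5
    have h6 := congrArg (fun w => b.repr w i) h5
    simpa [Finsupp.single_apply, eq_comm] using h6

theorem IsComatrix.conv_apply {t : ι → ι → C} (ht : IsComatrix k t) {B : Type*} [Ring B]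
    [Algebra k B] (f g : WithConv (C →ₗ[k] B)) (i j : ι) :
    (f * g) (t i j) = ∑ l, f (t i l) * g (t l j) := by
  rw [LinearMap.convMul_apply, ht.comul_eq]
  simp

end Comatrix

namespace IsComatrix

variable {k H ι : Type*} [Field k] [Ring H] [HopfAlgebra k H] [Fintype ι] [DecidableEq ι]
  {t : ι → ι → H}

local notation "S" => HopfAlgebra.antipode k (A := H)

theorem sum_antipode_mul (ht : IsComatrix k t) (i j : ι) :
    ∑ l, S (t i l) * t l j = if i = j then 1 else 0 := by
  have := HopfAlgebra.mul_antipode_rTensor_comul_apply (R := k) (t i j)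
  rw [ht.comul_eq, ht.counit_eq] at this
  simpa [apply_ite] using this

theorem sum_mul_antipode (ht : IsComatrix k t) (i j : ι) :
    ∑ l, t i l * S (t l j) = if i = j then 1 else 0 := by
  have := HopfAlgebra.mul_antipode_lTensor_comul_apply (R := k) (t i j)
  rw [ht.comul_eq, ht.counit_eq] at this
  simpa [apply_ite] using this

/-- The antipode reverses the comultiplication: `Δ(S(t)) = S(t)^{cop} ⊗ S(t)`. Both sides are
inverse to the matrix `Δ(t)`. -/
theorem comul_antipode (ht : IsComatrix k t) (i j : ι) :
    comul (R := k) (S (t i j)) = ∑ l, S (t l j) ⊗ₜ[k] S (t i l) := by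
  let X : Matrix ι ι (H ⊗[k] H) := .of fun i j => ∑ l, S (t l j) ⊗ₜ[k] S (t i l)
  let Y : Matrix ι ι (H ⊗[k] H) := .of fun i j => comul (R := k) (t i j)
  let Z : Matrix ι ι (H ⊗[k] H) := .of fun i j => comul (R := k) (S (t i j))
  have hYZ : Y * Z = 1 := by
    ext i j
    rw [Matrix.mul_apply, Matrix.one_apply]
    simp only [Y, Z, Matrix.of_apply, ← Bialgebra.comul_mul, ← map_sum, ht.sum_mul_antipode]
    split_ifs <;> simp
  have hXY : X * Y = 1 := by
    ext i j
    rw [Matrix.mul_apply, Matrix.one_apply]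
    simp only [X, Y, Matrix.of_apply, ht.comul_eq, Finset.sum_mul_sum,
      Algebra.TensorProduct.tmul_mul_tmul]
    rw [Finset.sum_comm]
    have h : ∀ m : ι, ∑ l, ∑ n, (S (t m l) * t l n) ⊗ₜ[k] (S (t i m) * t n j) =
        1 ⊗ₜ[k] (S (t i m) * t m j) := fun m => by
      rw [Finset.sum_comm]
      simp only [← TensorProduct.sum_tmul, ht.sum_antipode_mul, TensorProduct.ite_tmul]
      simp
    rw [Finset.sum_congr rfl fun m _ => h m, ← TensorProduct.tmul_sum, ht.sum_antipode_mul]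
    split_ifs <;> simp [Algebra.TensorProduct.one_def]
  have h : X = Z := left_inv_eq_right_inv hXY hYZ
  exact (congrFun (congrFun h i) j).symm

/-- Convolution products evaluated at `t ⊗ S(t)`; the antipode reverses the order of the indices in
the second factor. -/
theorem conv_tmul_antipode (ht : IsComatrix k t) {B : Type*} [Ring B] [Algebra k B]
    (f g : WithConv (H ⊗[k] H →ₗ[k] B)) (a b c d : ι) :
    (f * g) (t a b ⊗ₜ[k] S (t c d)) =
      ∑ p : ι × ι, f (t a p.2 ⊗ₜ[k] S (t p.1 d)) * g (t p.2 b ⊗ₜ[k] S (t c p.1)) := by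
  rw [LinearMap.convMul_apply, TensorProduct.comul_tmul, ht.comul_eq, ht.comul_antipode,
    Fintype.sum_prod_type]
  simp [TensorProduct.sum_tmul, TensorProduct.tmul_sum]

theorem conv_tmul_antipode_tmul (ht : IsComatrix k t)
    (f g : WithConv (H ⊗[k] (H ⊗[k] H) →ₗ[k] k)) (a b c d i j : ι) :
    (f * g) (t a b ⊗ₜ[k] (S (t c d) ⊗ₜ[k] t i j)) =
      ∑ p : ι × ι × ι, f (t a p.2.2 ⊗ₜ[k] (S (t p.2.1 d) ⊗ₜ[k] t i p.1)) *
        g (t p.2.2 b ⊗ₜ[k] (S (t c p.2.1) ⊗ₜ[k] t p.1 j)) := by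
  rw [LinearMap.convMul_apply, TensorProduct.comul_tmul, TensorProduct.comul_tmul, ht.comul_eq,
    ht.comul_eq, ht.comul_antipode]
  simp only [Fintype.sum_prod_type]
  simp [TensorProduct.sum_tmul, TensorProduct.tmul_sum]

/-- `σ(a₁ ⊗ S(a₂)) σ⁻¹(S(a₃) ⊗ a₄) = ε(a)`, which is the cocycle condition evaluated at
`a₁ ⊗ S(a₂) ⊗ a₃`. -/
theorem sum_cocycle_mul_inv (ht : IsComatrix k t) {u : (WithConv (H ⊗[k] H →ₗ[k] k))ˣ}
    (hu : IsMulCocycle u.1) (a e : ι) :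
    ∑ c, (∑ b, u.1 (t a b ⊗ₜ[k] S (t b c))) * (∑ d, u⁻¹.1 (S (t c d) ⊗ₜ[k] t d e)) =
      if a = e then 1 else 0 := by
  have h1 : epsTensor u⁻¹.1 * tensorEps u.1 = compIdMul u.1 * compMulId u⁻¹.1 := by
    have hc : Units.map (epsTensorHom k H).toMonoidHom u *
        Units.map (compIdMulHom k H).toMonoidHom u =
        Units.map (tensorEpsHom k H).toMonoidHom u * Units.map (compMulIdHom k H).toMonoidHom u :=
      Units.ext hu.cocycle
    have h2 : Units.map (epsTensorHom k H).toMonoidHom u⁻¹ *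
        Units.map (tensorEpsHom k H).toMonoidHom u =
        Units.map (compIdMulHom k H).toMonoidHom u *
          Units.map (compMulIdHom k H).toMonoidHom u⁻¹ := by
      rw [map_inv, map_inv, inv_mul_eq_iff_eq_mul, ← mul_assoc, eq_mul_inv_iff_mul_eq, hc]
    exact congrArg Units.val h2
  have hinv : ∀ b : H, u⁻¹.1 ((1 : H) ⊗ₜ[k] b) = counit (R := k) b := by
    have h3 := map_mul (HopfDeformation.pullback k
      (groupLikeTmul (k := k) (H := H) isGroupLikeElem_one)) u.1 u⁻¹.1
    have h4 : HopfDeformation.pullback k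
        (groupLikeTmul (k := k) (H := H) isGroupLikeElem_one) u.1 = 1 :=
      WithConv.ext (LinearMap.ext hu.one_left)
    rw [Units.mul_inv, h4, one_mul, map_one] at h3
    exact fun b => (congrArg (fun f => f b) h3).symm
  have h5 : ∀ b d, (epsTensor u⁻¹.1 * tensorEps u.1) (t a b ⊗ₜ[k] (S (t b d) ⊗ₜ[k] t d e)) =
      (compIdMul u.1 * compMulId u⁻¹.1) (t a b ⊗ₜ[k] (S (t b d) ⊗ₜ[k] t d e)) :=
    fun b d => by rw [h1]
  have h6 : ∀ b d, (epsTensor u⁻¹.1 * tensorEps u.1) (t a b ⊗ₜ[k] (S (t b d) ⊗ₜ[k] t d e)) =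
      ∑ c, u.1 (t a b ⊗ₜ[k] S (t b c)) * u⁻¹.1 (S (t c d) ⊗ₜ[k] t d e) := by
    intro b d
    rw [ht.conv_tmul_antipode_tmul]
    have e1 : ∀ x y z : H, epsTensor u⁻¹.1 (x ⊗ₜ[k] (y ⊗ₜ[k] z)) =
      counit (R := k) x * u⁻¹.1 (y ⊗ₜ[k] z) := fun _ _ _ => rfl
    have e2 : ∀ x y z : H, tensorEps u.1 (x ⊗ₜ[k] (y ⊗ₜ[k] z)) =
      u.1 (x ⊗ₜ[k] y) * counit (R := k) z := fun _ _ _ => rfl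
    simp only [e1, e2, ht.counit_eq, Fintype.sum_prod_type]
    simp [mul_comm]
  have h7 : ∑ b, ∑ d, (compIdMul u.1 * compMulId u⁻¹.1)
      (t a b ⊗ₜ[k] (S (t b d) ⊗ₜ[k] t d e)) = if a = e then 1 else 0 := by
    have e1 : ∀ x y z : H, compIdMul u.1 (x ⊗ₜ[k] (y ⊗ₜ[k] z)) =
      u.1 (x ⊗ₜ[k] (y * z)) := fun _ _ _ => rfl
    have e2 : ∀ x y z : H, compMulId u⁻¹.1 (x ⊗ₜ[k] (y ⊗ₜ[k] z)) =
      u⁻¹.1 ((x * y) ⊗ₜ[k] z) := fun _ _ _ => rfl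
    have e3 : ∀ b, ∑ d, (compIdMul u.1 * compMulId u⁻¹.1)
        (t a b ⊗ₜ[k] (S (t b d) ⊗ₜ[k] t d e)) =
        ∑ q : ι × ι, u.1 (t a q.2 ⊗ₜ[k] (1 : H)) *
          u⁻¹.1 ((t q.2 b * S (t b q.1)) ⊗ₜ[k] t q.1 e) := by
      intro b
      rw [Finset.sum_congr rfl fun d _ => ht.conv_tmul_antipode_tmul _ _ a b b d d e,
        Finset.sum_comm]
      simp only [e1, e2, ← Finset.sum_mul, ← map_sum, ← TensorProduct.tmul_sum,
        ht.sum_antipode_mul]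
      rw [Fintype.sum_prod_type, Finset.sum_comm]
      simp [TensorProduct.tmul_ite, apply_ite u.1.ofConv]
    rw [Finset.sum_congr rfl fun b _ => e3 b, Finset.sum_comm]
    simp only [← Finset.mul_sum, ← map_sum, ← TensorProduct.sum_tmul, ht.sum_mul_antipode]
    rw [Fintype.sum_prod_type]
    simp [TensorProduct.ite_tmul, apply_ite u⁻¹.1.ofConv, hinv, hu.one_right, ht.counit_eq]
  rw [← h7, Finset.sum_congr rfl fun b _ => Finset.sum_congr rfl fun d _ => (h5 b d).symm]
  simp only [h6, Finset.sum_mul_sum]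
  rw [Finset.sum_comm]
  exact Finset.sum_congr rfl fun b _ => Finset.sum_comm

theorem deformedMul_tmul_antipode (ht : IsComatrix k t) (u : (WithConv (H ⊗[k] H →ₗ[k] k))ˣ)
    (a b c d : ι) :
    deformedMul u.1 (t a b ⊗ₜ[k] S (t c d)) =
      ∑ q : ι × ι, u⁻¹.1 (t q.2 b ⊗ₜ[k] S (t c q.1)) •
        ∑ p : ι × ι, u.1 (t a p.2 ⊗ₜ[k] S (t p.1 d)) • (t p.2 q.2 * S (t q.1 p.1)) := by
  rw [deformedMul_unit, conj, ht.conv_tmul_antipode]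
  refine Finset.sum_congr rfl fun q _ => ?_
  rw [ht.conv_tmul_antipode, toAlg_apply, ← Algebra.commutes, ← Algebra.smul_def]
  refine congrArg _ (Finset.sum_congr rfl fun p _ => ?_)
  rw [toAlg_apply, ← Algebra.smul_def]
  rfl

theorem deformedAntipode_apply (ht : IsComatrix k t) (u : (WithConv (H ⊗[k] H →ₗ[k] k))ˣ)
    (b e : ι) :
    deformedAntipode u.1 (t b e) =
      ∑ d, ∑ c, ((∑ f, u.1 (t b f ⊗ₜ[k] S (t f c))) * ∑ f, u⁻¹.1 (S (t d f) ⊗ₜ[k] t f e)) •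
        S (t c d) := by
  rw [deformedAntipode, Ring.inverse_unit, ht.conv_apply]
  refine Finset.sum_congr rfl fun d _ => ?_
  rw [ht.conv_apply, Finset.sum_mul]
  refine Finset.sum_congr rfl fun c _ => ?_
  rw [toAlg_apply, toAlg_apply, ← Algebra.commutes, ← Algebra.smul_def, ← Algebra.smul_def,
    smul_smul, mul_comm]
  simp [ht.comul_eq]

/-- `∑ m_σ(a₁ ⊗ s_σ(a₂)) = ε(a)`. -/
theorem sum_deformedMul_deformedAntipode (ht : IsComatrix k t)
    {u : (WithConv (H ⊗[k] H →ₗ[k] k))ˣ} (hu : IsMulCocycle u.1) (a e : ι) :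
    ∑ b, deformedMul u.1 (t a b ⊗ₜ[k] deformedAntipode u.1 (t b e)) = if a = e then 1 else 0 := by
  have cancel : ∀ i j : ι, ∑ b, ∑ c, u⁻¹.1 (t i b ⊗ₜ[k] S (t c j)) *
      ∑ f, u.1 (t b f ⊗ₜ[k] S (t f c)) = if i = j then 1 else 0 := by
    intro i j
    have h1 : ∀ f, (u⁻¹.1 * u.1) (t i f ⊗ₜ[k] S (t f j)) =
        (if i = f then 1 else 0) * if f = j then 1 else 0 := fun f => by
      rw [Units.inv_mul]
      simp [ht.counit_eq, mul_comm]
    have h2 : ∑ f, (u⁻¹.1 * u.1) (t i f ⊗ₜ[k] S (t f j)) = if i = j then 1 else 0 := by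
      rw [Finset.sum_congr rfl fun f _ => h1 f]
      simp
    rw [← h2, Finset.sum_congr rfl fun f _ => ht.conv_tmul_antipode _ _ i f f j]
    simp only [Fintype.sum_prod_type, Finset.mul_sum]
    rw [Finset.sum_comm, Finset.sum_comm (s := Finset.univ (α := ι)) (t := Finset.univ (α := ι))
      (f := fun f c => ∑ b, u⁻¹.1 (t i b ⊗ₜ[k] S (t c j)) * u.1 (t b f ⊗ₜ[k] S (t f c)))]
    exact Finset.sum_congr rfl fun c _ => Finset.sum_comm
  have e1 : ∀ b, deformedMul u.1 (t a b ⊗ₜ[k] deformedAntipode u.1 (t b e)) =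
      ∑ d, ∑ q : ι × ι, ∑ c, (u⁻¹.1 (t q.2 b ⊗ₜ[k] S (t c q.1)) *
        ∑ f, u.1 (t b f ⊗ₜ[k] S (t f c))) • (∑ f, u⁻¹.1 (S (t d f) ⊗ₜ[k] t f e)) •
        ∑ p : ι × ι, u.1 (t a p.2 ⊗ₜ[k] S (t p.1 d)) • (t p.2 q.2 * S (t q.1 p.1)) := by
    intro b
    rw [ht.deformedAntipode_apply]
    simp only [TensorProduct.tmul_sum, map_sum, TensorProduct.tmul_smul, map_smul,
      ht.deformedMul_tmul_antipode]
    refine Finset.sum_congr rfl fun d _ => ?_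
    rw [Finset.sum_comm]
    refine Finset.sum_congr rfl fun c _ => ?_
    rw [Finset.smul_sum]
    refine Finset.sum_congr rfl fun q _ => ?_
    rw [smul_smul, smul_smul]
    congr 1
    ring
  have e2 : ∀ d, ∑ b, ∑ q : ι × ι, ∑ c, (u⁻¹.1 (t q.2 b ⊗ₜ[k] S (t c q.1)) *
        ∑ f, u.1 (t b f ⊗ₜ[k] S (t f c))) • (∑ f, u⁻¹.1 (S (t d f) ⊗ₜ[k] t f e)) •
        ∑ p : ι × ι, u.1 (t a p.2 ⊗ₜ[k] S (t p.1 d)) • (t p.2 q.2 * S (t q.1 p.1)) =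
      ((∑ b, u.1 (t a b ⊗ₜ[k] S (t b d))) * ∑ f, u⁻¹.1 (S (t d f) ⊗ₜ[k] t f e)) • (1 : H) := by
    intro d
    rw [Finset.sum_comm]
    simp only [← Finset.sum_smul, cancel]
    rw [Fintype.sum_prod_type]
    simp only [ite_smul, one_smul, zero_smul, Finset.sum_ite_eq', Finset.mem_univ, if_true,
      ← Finset.smul_sum]
    rw [Finset.sum_comm]
    simp only [← Finset.smul_sum, ht.sum_mul_antipode, Fintype.sum_prod_type]
    simp only [smul_ite, smul_zero, Finset.sum_ite_eq', Finset.mem_univ, if_true]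
    rw [← Finset.sum_smul, smul_smul, mul_comm]
  rw [Finset.sum_congr rfl fun b _ => e1 b, Finset.sum_comm, Finset.sum_congr rfl fun d _ => e2 d,
    ← Finset.sum_smul, ht.sum_cocycle_mul_inv hu]
  split_ifs <;> simp

end IsComatrix

/-- An isomorphism from a cocycle deformation to a Hopf algebra carries the deformed antipode to
the antipode: both are convolution inverses of the isomorphism. -/
theorem map_deformedAntipode {k H L : Type*} [Field k] [Ring H] [HopfAlgebra k H]
    [FiniteDimensional k H] [Ring L] [HopfAlgebra k L] {σ : WithConv (H ⊗[k] H →ₗ[k] k)}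
    (hσ : IsMulCocycle σ) (Φ : H →ₗc[k] L) (h1 : Φ 1 = 1)
    (hΦ : ∀ a b : H, Φ (deformedMul σ (a ⊗ₜ[k] b)) = Φ a * Φ b) (a : H) :
    Φ (deformedAntipode σ a) = HopfAlgebra.antipode k (Φ a) := by
  classical
  obtain ⟨u, rfl⟩ := hσ.isUnit
  let b := Module.finBasis k H
  obtain ⟨t, ht, htb⟩ := exists_isComatrix b
  have hΦt : IsComatrix k fun i j => Φ (t i j) :=
    ⟨fun i j => by
      rw [← CoalgHomClass.map_comp_comul_apply, ht.comul_eq]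
      simp, fun i j => by rw [CoalgHomClass.counit_comp_apply, ht.counit_eq]⟩
  let P : Matrix _ _ L := .of fun i j => Φ (t i j)
  let Q : Matrix _ _ L := .of fun i j => Φ (deformedAntipode u.1 (t i j))
  let R : Matrix _ _ L := .of fun i j => HopfAlgebra.antipode k (Φ (t i j))
  have hRP : R * P = 1 := by
    ext i j
    rw [Matrix.mul_apply, Matrix.one_apply]
    exact hΦt.sum_antipode_mul i j
  have hPQ : P * Q = 1 := by
    ext i j
    rw [Matrix.mul_apply, Matrix.one_apply]
    simp only [P, Q, Matrix.of_apply, ← hΦ, ← map_sum, ht.sum_deformedMul_deformedAntipode hσ]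
    split_ifs <;> simp [h1]
  have hRQ : R = Q := left_inv_eq_right_inv hRP hPQ
  have key : Φ.toLinearMap ∘ₗ deformedAntipode u.1 =
      HopfAlgebra.antipode k ∘ₗ Φ.toLinearMap := by
    refine b.ext fun p => ?_
    rw [htb p]
    simp only [map_sum, map_smul]
    exact Finset.sum_congr rfl fun q _ => congrArg _ (congrFun (congrFun hRQ q) p).symm
  exact congrArg (fun f => f a) key

end HopfDeformation

namespace QLSDatum

open Coalgebra WithConv HopfDeformation

variable {k G : Type*} [Field k] [CommGroup G] {θ : ℕ} (D : QLSDatum k G θ) [Finite G]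

/-! ### The functionals `χᵢ` and `dᵢ` on `A` -/

theorem comul_grp (lam : Fin θ → Fin θ → k) (mu : Fin θ → k) (h : G) :
    comul (R := k) (D.grp lam mu h) = D.grp lam mu h ⊗ₜ[k] D.grp lam mu h :=
  D.comulHom_grp lam mu h

theorem comul_x (lam : Fin θ → Fin θ → k) (mu : Fin θ → k) (i : Fin θ) :
    comul (R := k) (D.x lam mu i) =
      D.x lam mu i ⊗ₜ[k] 1 + D.grp lam mu (D.g i) ⊗ₜ[k] D.x lam mu i :=
  D.comulHom_x lam mu i

@[simp] theorem counit_grp (lam : Fin θ → Fin θ → k) (mu : Fin θ → k) (h : G) :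
    counit (R := k) (D.grp lam mu h) = 1 := D.counitHom_grp lam mu h

@[simp] theorem counit_x (lam : Fin θ → Fin θ → k) (mu : Fin θ → k) (i : Fin θ) :
    counit (R := k) (D.x lam mu i) = 0 := D.counitHom_x lam mu i

theorem isGroupLikeElem_grp (lam : Fin θ → Fin θ → k) (mu : Fin θ → k) (h : G) :
    IsGroupLikeElem k (D.grp lam mu h) := ⟨D.counit_grp lam mu h, D.comul_grp lam mu h⟩

theorem two_le_N (i : Fin θ) : 2 ≤ D.N i := by
  have h0 := D.N_pos i
  have h1 : D.N i ≠ 1 := fun h => D.nontrivial i (orderOf_eq_one_iff.1 h)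
  omega

/-- The algebra homomorphism `a ↦ [[χᵢ(a), dᵢ(a)], [0, ε(a)]]`, whose off-diagonal entry is a
`(χᵢ, ε)`-skew derivation. -/
def derHom (i : Fin θ) : D.A →ₐ[k] Matrix (Fin 2) (Fin 2) k :=
  lift
    { toFun := fun h => !![(D.χ i h : k), 0; 0, 1]
      map_one' := by ext a b; fin_cases a <;> fin_cases b <;> simp
      map_mul' := fun h h' => by ext a b; fin_cases a <;> fin_cases b <;> simp }
    (fun j => if j = i then !![0, 1; 0, 0] else 0)
    (fun h j => by
      by_cases hj : j = i
      · subst hj; ext a b; fin_cases a <;> fin_cases b <;> simp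
      · simp [hj])
    (fun j l hjl => by
      by_cases hj : j = i <;> by_cases hl : l = i
      · exact absurd (hj.trans hl.symm) hjl.ne
      all_goals simp [hj, hl])
    (fun j => by
      by_cases hj : j = i
      · have h2 : (!![0, 1; 0, 0] : Matrix (Fin 2) (Fin 2) k) ^ 2 = 0 := by
          rw [pow_two]; ext a b; fin_cases a <;> fin_cases b <;> simp
        rw [if_pos hj, pow_eq_zero_of_le (D.two_le_N j) h2]
        simp
      · rw [if_neg hj, zero_pow (D.N_pos j).ne']; simp)

/-- The character `χᵢ` of `A`, as an element of the convolution algebra. -/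
def chr (i : Fin θ) : WithConv (D.A →ₗ[k] k) :=
  toConv (Matrix.entryLinearMap k k 0 0 ∘ₗ (D.derHom i).toLinearMap)

/-- The skew derivation `dᵢ` of `A`, as an element of the convolution algebra. -/
def der (i : Fin θ) : WithConv (D.A →ₗ[k] k) :=
  toConv (Matrix.entryLinearMap k k 0 1 ∘ₗ (D.derHom i).toLinearMap)

theorem derHom_lower (i : Fin θ) (a : D.A) :
    D.derHom i a 1 0 = 0 ∧ D.derHom i a 1 1 = counit (R := k) a := by
  induction a using induction with
  | hg h => simp [derHom]
  | hx j => by_cases hj : j = i <;> simp [derHom, hj]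
  | hs r => simp [Matrix.algebraMap_matrix_apply]
  | ha a b ha hb => simp [ha.1, ha.2, hb.1, hb.2]
  | hm a b ha hb => simp [Matrix.mul_apply, ha.1, ha.2, hb.1, hb.2]

theorem chr_mul (i : Fin θ) (a b : D.A) : D.chr i (a * b) = D.chr i a * D.chr i b := by
  simp [chr, Matrix.mul_apply, (D.derHom_lower i b).1]

theorem der_mul (i : Fin θ) (a b : D.A) :
    D.der i (a * b) = D.der i a * counit (R := k) b + D.chr i a * D.der i b := by
  simp [chr, der, Matrix.mul_apply, (D.derHom_lower i b).2, add_comm]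

@[simp] theorem chr_one (i : Fin θ) : D.chr i 1 = 1 := by simp [chr]
@[simp] theorem der_one (i : Fin θ) : D.der i 1 = 0 := by simp [der]
@[simp] theorem chr_grp (i : Fin θ) (h : G) : D.chr i (D.grp 0 0 h) = D.χ i h := by
  simp [chr, derHom]
@[simp] theorem der_grp (i : Fin θ) (h : G) : D.der i (D.grp 0 0 h) = 0 := by
  simp [der, derHom]
@[simp] theorem chr_x (i j : Fin θ) : D.chr i (D.x 0 0 j) = 0 := by
  by_cases hj : j = i <;> simp [chr, derHom, hj]
@[simp] theorem der_x (i j : Fin θ) : D.der i (D.x 0 0 j) = if j = i then 1 else 0 := by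
  by_cases hj : j = i <;> simp [der, derHom, hj]

/-- The functional `b ↦ φ(u b)`. -/
def translate (u : D.A) : WithConv (D.A →ₗ[k] k) →ₗ[k] WithConv (D.A →ₗ[k] k) where
  toFun φ := toConv (φ.ofConv ∘ₗ LinearMap.mulLeft k u)
  map_add' _ _ := rfl
  map_smul' _ _ := rfl

@[simp] theorem translate_apply (u : D.A) (φ : WithConv (D.A →ₗ[k] k)) (b : D.A) :
    D.translate u φ b = φ (u * b) := rfl

theorem translate_grp_mul (h : G) (φ ψ : WithConv (D.A →ₗ[k] k)) :
    D.translate (D.grp 0 0 h) (φ * ψ) =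
      D.translate (D.grp 0 0 h) φ * D.translate (D.grp 0 0 h) ψ := by
  ext b
  rw [translate_apply, LinearMap.convMul_apply, Bialgebra.comul_mul, comul_grp,
    (ℛ k b).convMul_apply, ← (ℛ k b).eq]
  simp [Finset.mul_sum]

theorem translate_x_mul (j : Fin θ) (φ ψ : WithConv (D.A →ₗ[k] k)) :
    D.translate (D.x 0 0 j) (φ * ψ) = D.translate (D.x 0 0 j) φ * ψ +
      D.translate (D.grp 0 0 (D.g j)) φ * D.translate (D.x 0 0 j) ψ := by
  ext b
  rw [translate_apply, LinearMap.convMul_apply, Bialgebra.comul_mul, comul_x,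
    WithConv.ofConv_add, LinearMap.add_apply, (ℛ k b).convMul_apply, (ℛ k b).convMul_apply,
    ← (ℛ k b).eq]
  simp [Finset.mul_sum, add_mul, Finset.sum_add_distrib]

@[simp] theorem translate_grp_one (h : G) :
    D.translate (D.grp 0 0 h) (1 : WithConv (D.A →ₗ[k] k)) = 1 := by
  ext b; simp
@[simp] theorem translate_x_one (j : Fin θ) :
    D.translate (D.x 0 0 j) (1 : WithConv (D.A →ₗ[k] k)) = 0 := by
  ext b; simp
@[simp] theorem translate_grp_chr (h : G) (i : Fin θ) :
    D.translate (D.grp 0 0 h) (D.chr i) = (D.χ i h : k) • D.chr i := by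
  ext b; simp [chr_mul]
@[simp] theorem translate_x_chr (j i : Fin θ) : D.translate (D.x 0 0 j) (D.chr i) = 0 := by
  ext b; simp [chr_mul]
@[simp] theorem translate_grp_der (h : G) (i : Fin θ) :
    D.translate (D.grp 0 0 h) (D.der i) = (D.χ i h : k) • D.der i := by
  ext b; simp [der_mul]
@[simp] theorem translate_x_der (j i : Fin θ) :
    D.translate (D.x 0 0 j) (D.der i) = if j = i then 1 else 0 := by
  ext b; by_cases hj : j = i <;> simp [der_mul, hj]

/-- The criterion by which the relations between the `χᵢ` and the `dᵢ` are verified: a functional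
which vanishes at `1`, is killed by translation by all `xⱼ`, and is an eigenvector of the
translations by `G`, is zero. -/
theorem eq_zero_of_translate {f : WithConv (D.A →ₗ[k] k)} (c : G → k)
    (hg : ∀ h, D.translate (D.grp 0 0 h) f = c h • f)
    (hx : ∀ j, D.translate (D.x 0 0 j) f = 0) (h1 : f 1 = 0) : f = 0 := by
  have key : ∀ a : D.A, ∃ r : k, D.translate a f = r • f := by
    intro a
    induction a using induction with
    | hg h => exact ⟨_, hg h⟩
    | hx j => exact ⟨0, by rw [hx, zero_smul]⟩
    | hs r => exact ⟨r, by ext b; simp [← Algebra.smul_def]⟩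
    | ha a b ha hb =>
      obtain ⟨r, hr⟩ := ha
      obtain ⟨s, hs⟩ := hb
      refine ⟨r + s, ?_⟩
      rw [add_smul, ← hr, ← hs]
      ext b
      simp [add_mul]
    | hm a b ha hb =>
      obtain ⟨r, hr⟩ := ha
      obtain ⟨s, hs⟩ := hb
      refine ⟨r * s, ?_⟩
      rw [mul_smul, ← hs]
      ext c
      have := congrArg (fun f => f (b * c)) hr
      simpa [mul_assoc] using this
  ext a
  obtain ⟨r, hr⟩ := key a
  have := congrArg (fun f => f 1) hr
  simpa [h1] using this

theorem conv_apply_one (φ ψ : WithConv (D.A →ₗ[k] k)) : (φ * ψ) 1 = φ 1 * ψ 1 := by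
  rw [LinearMap.convMul_apply, Bialgebra.comul_one, Algebra.TensorProduct.one_def]
  simp

theorem chr_mul_chr (l i : Fin θ) : D.chr l * D.chr i = D.chr i * D.chr l := by
  rw [← sub_eq_zero]
  refine D.eq_zero_of_translate (fun h => (D.χ l h : k) * D.χ i h) (fun h => ?_) (fun j => ?_) ?_
  · simp [translate_grp_mul, smul_sub, smul_smul, mul_comm]
  · simp [translate_x_mul]
  · simp [-LinearMap.convMul_apply, conv_apply_one]

theorem chr_mul_der (l i : Fin θ) :
    D.chr l * D.der i = (D.χ l (D.g i) : k) • (D.der i * D.chr l) := by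
  rw [← sub_eq_zero]
  refine D.eq_zero_of_translate (fun h => (D.χ l h : k) * D.χ i h) (fun h => ?_) (fun j => ?_) ?_
  · simp only [map_sub, map_smul, translate_grp_mul, translate_grp_chr, translate_grp_der,
      smul_mul_assoc, mul_smul_comm, smul_sub, smul_smul]
    congr 2 <;> ring
  · by_cases hj : j = i
    · subst hj; simp [translate_x_mul]
    · simp [translate_x_mul, hj]
  · simp [-LinearMap.convMul_apply, conv_apply_one]

theorem der_mul_der {l i : Fin θ} (hli : l ≠ i) :
    D.der l * D.der i = (D.χ l (D.g i) : k) • (D.der i * D.der l) := by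
  rw [← sub_eq_zero]
  refine D.eq_zero_of_translate (fun h => (D.χ l h : k) * D.χ i h) (fun h => ?_) (fun j => ?_) ?_
  · simp only [map_sub, map_smul, translate_grp_mul, translate_grp_der,
      smul_mul_assoc, mul_smul_comm, smul_sub, smul_smul]
    congr 2 <;> ring
  · by_cases hj : j = i
    · subst hj; simp [translate_x_mul, hli.symm]
    · by_cases hl : j = l
      · subst hl; simp [translate_x_mul, hj, smul_smul, D.braiding' hli]
      · simp [translate_x_mul, hj, hl]
  · simp [-LinearMap.convMul_apply, conv_apply_one]

end QLSDatum

namespace QLSDatum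

open Coalgebra WithConv HopfDeformation

variable {k G : Type*} [Field k] [CommGroup G] {θ : ℕ} (D : QLSDatum k G θ) [Finite G]

/-! ### Divided powers of the skew derivations -/

theorem translate_grp_pow (h : G) (φ : WithConv (D.A →ₗ[k] k)) (n : ℕ) :
    D.translate (D.grp 0 0 h) (φ ^ n) = D.translate (D.grp 0 0 h) φ ^ n := by
  induction n with
  | zero => simp
  | succ n ih => rw [pow_succ, translate_grp_mul, ih, pow_succ]

theorem translate_x_chr_pow (j i : Fin θ) (m : ℕ) :
    D.translate (D.x 0 0 j) (D.chr i ^ m) = 0 := by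
  induction m with
  | zero => simp
  | succ m ih => rw [pow_succ, translate_x_mul, ih]; simp

theorem chr_pow_eq_one {i : Fin θ} {n : ℕ} (h : D.χ i ^ n = 1) : D.chr i ^ n = 1 := by
  rw [← sub_eq_zero]
  refine D.eq_zero_of_translate (fun _ => 1) (fun l => ?_) (fun j => ?_) ?_
  · have : (D.χ i l : k) ^ n = 1 := by
      rw [← Units.val_pow_eq_pow_val, ← MonoidHom.pow_apply, h]; simp
    simp [translate_grp_pow, smul_pow, this]
  · simp [translate_x_chr_pow]
  · have : ∀ m, (D.chr i ^ m) 1 = 1 := fun m => by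
      induction m with
      | zero => simp
      | succ m ih => rw [pow_succ, conv_apply_one, ih]; simp
    rw [WithConv.ofConv_sub, LinearMap.sub_apply, this]; simp

/-- The functional `dᵢ^n χᵢ^m / (n)!_q` with `q = χᵢ(gᵢ)`; it vanishes for `n ≥ Nᵢ`. -/
def divPow (i : Fin θ) (n m : ℕ) : WithConv (D.A →ₗ[k] k) :=
  (qFactorial (D.χ i (D.g i) : k) n)⁻¹ • (D.der i ^ n * D.chr i ^ m)

theorem qNumber_N (i : Fin θ) : qNumber (D.χ i (D.g i) : k) (D.N i) = 0 := by
  have h1 : (D.χ i (D.g i) : k) - 1 ≠ 0 := fun h =>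
    D.nontrivial i (Units.ext (by rw [Units.val_one]; linear_combination h))
  have h2 := qNumber_mul (D.χ i (D.g i) : k) (D.N i)
  rw [(D.isPrimitiveRoot i).pow_eq_one, sub_self] at h2
  exact (mul_eq_zero.1 h2).resolve_left h1

theorem qNumber_ne_zero (i : Fin θ) {n : ℕ} (hn : n + 1 < D.N i) :
    qNumber (D.χ i (D.g i) : k) (n + 1) ≠ 0 := by
  have := qFactorial_ne_zero (D.isPrimitiveRoot i) hn
  rw [qFactorial_succ] at this
  exact right_ne_zero_of_mul this

theorem qNumber_succ' (q : k) (n : ℕ) : qNumber q (n + 1) = 1 + q * qNumber q n := by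
  rw [add_comm, qNumber_add]; simp [qNumber]

theorem translate_grp_der_pow_mul (h : G) (i : Fin θ) (n m : ℕ) :
    D.translate (D.grp 0 0 h) (D.der i ^ n * D.chr i ^ m) =
      (D.χ i h : k) ^ (n + m) • (D.der i ^ n * D.chr i ^ m) := by
  rw [translate_grp_mul, translate_grp_pow, translate_grp_pow, translate_grp_der,
    translate_grp_chr, smul_pow, smul_pow, smul_mul_smul_comm, pow_add]

theorem translate_x_der_pow_mul (i : Fin θ) (n m : ℕ) :
    D.translate (D.x 0 0 i) (D.der i ^ (n + 1) * D.chr i ^ m) =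
      qNumber (D.χ i (D.g i) : k) (n + 1) • (D.der i ^ n * D.chr i ^ m) := by
  have key : ∀ φ, D.translate (D.x 0 0 i) (D.der i * φ) =
      φ + (D.χ i (D.g i) : k) • (D.der i * D.translate (D.x 0 0 i) φ) := fun φ => by
    rw [translate_x_mul]; simp
  induction n with
  | zero => rw [zero_add, pow_one, key, translate_x_chr_pow]; simp [qNumber]
  | succ n ih =>
    rw [pow_succ', mul_assoc, key, ih, mul_smul_comm, ← mul_assoc, ← pow_succ', smul_smul,
      qNumber_succ' _ (n + 1), add_smul, one_smul]

theorem translate_x_der_pow_mul_of_ne {j i : Fin θ} (hj : j ≠ i) (n m : ℕ) :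
    D.translate (D.x 0 0 j) (D.der i ^ n * D.chr i ^ m) = 0 := by
  induction n with
  | zero => rw [pow_zero, one_mul, translate_x_chr_pow]
  | succ n ih => rw [pow_succ', mul_assoc, translate_x_mul, ih]; simp [hj]

theorem der_pow_mul_apply_one (i : Fin θ) (n m : ℕ) :
    (D.der i ^ n * D.chr i ^ m) 1 = if n = 0 then 1 else 0 := by
  have h1 : ∀ m, (D.chr i ^ m) 1 = 1 := fun m => by
    induction m with
    | zero => simp
    | succ m ih => rw [pow_succ, conv_apply_one, ih]; simp
  cases n with
  | zero => rw [pow_zero, one_mul, h1]; simp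
  | succ n => rw [pow_succ', mul_assoc, conv_apply_one]; simp

theorem der_pow_N (i : Fin θ) : D.der i ^ D.N i = 0 := by
  obtain ⟨n, hn⟩ : ∃ n, D.N i = n + 1 := ⟨D.N i - 1, by have := D.N_pos i; omega⟩
  have h0 := D.qNumber_N i
  refine D.eq_zero_of_translate (fun h => (D.χ i h : k) ^ D.N i) (fun h => ?_) (fun j => ?_) ?_
  · have := D.translate_grp_der_pow_mul h i (D.N i) 0
    simpa using this
  · by_cases hj : j = i
    · subst hj
      have := D.translate_x_der_pow_mul j n 0
      rw [← hn, h0] at this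
      simpa using this
    · have := D.translate_x_der_pow_mul_of_ne hj (D.N i) 0
      simpa using this
  · have := D.der_pow_mul_apply_one i (D.N i) 0
    rw [if_neg (D.N_pos i).ne'] at this
    simpa using this

theorem der_pow_eq_zero {i : Fin θ} {n : ℕ} (hn : D.N i ≤ n) : D.der i ^ n = 0 :=
  pow_eq_zero_of_le hn (D.der_pow_N i)

theorem divPow_eq_zero {i : Fin θ} {n : ℕ} (hn : D.N i ≤ n) (m : ℕ) : D.divPow i n m = 0 := by
  rw [divPow, D.der_pow_eq_zero hn, zero_mul, smul_zero]

theorem divPow_zero (i : Fin θ) (m : ℕ) : D.divPow i 0 m = D.chr i ^ m := by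
  simp [divPow, qFactorial]

theorem divPow_one_zero (i : Fin θ) : D.divPow i 1 0 = D.der i := by
  simp [divPow, qFactorial, qNumber]

/-- Holds for all `n`: for `n + 1 = Nᵢ` both sides vanish since `(Nᵢ)_q = 0`. -/
theorem der_mul_divPow (i : Fin θ) (n m : ℕ) :
    D.der i * D.divPow i n m = qNumber (D.χ i (D.g i) : k) (n + 1) • D.divPow i (n + 1) m := by
  by_cases hn : n + 1 < D.N i
  · rw [divPow, divPow, mul_smul_comm, ← mul_assoc, ← pow_succ', smul_smul, qFactorial_succ,
      mul_inv_rev, mul_inv_cancel_left₀ (D.qNumber_ne_zero i hn)]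
  · rw [D.divPow_eq_zero (n := n + 1) (by omega), smul_zero, divPow, mul_smul_comm,
      ← mul_assoc, ← pow_succ', D.der_pow_eq_zero (by omega), zero_mul, smul_zero]

theorem divPow_mul_chr (i : Fin θ) (n m : ℕ) :
    D.divPow i n m * D.chr i = D.divPow i n (m + 1) := by
  rw [divPow, divPow, smul_mul_assoc, mul_assoc, ← pow_succ]

theorem mul_divPow_of_qcomm {i : Fin θ} {φ : WithConv (D.A →ₗ[k] k)} {p r : k}
    (hd : φ * D.der i = p • (D.der i * φ)) (hc : φ * D.chr i = r • (D.chr i * φ)) (n m : ℕ) :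
    φ * D.divPow i n m = (p ^ n * r ^ m) • (D.divPow i n m * φ) := by
  rw [divPow, mul_smul_comm, ← mul_assoc, mul_pow_of_qcomm hd, smul_mul_assoc, mul_assoc,
    mul_pow_of_qcomm hc, mul_smul_comm, smul_mul_assoc, smul_smul, ← mul_assoc, smul_smul,
    smul_smul]
  congr 1
  ring

theorem chr_mul_divPow (l i : Fin θ) (n m : ℕ) :
    D.chr l * D.divPow i n m = (D.χ l (D.g i) : k) ^ n • (D.divPow i n m * D.chr l) := by
  have := D.mul_divPow_of_qcomm (D.chr_mul_der l i) (r := 1)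
    (by rw [one_smul]; exact D.chr_mul_chr l i) n m
  rwa [one_pow, mul_one] at this

theorem der_mul_chr_of_ne {l i : Fin θ} (hli : l ≠ i) :
    D.der l * D.chr i = (D.χ l (D.g i) : k) • (D.chr i * D.der l) := by
  rw [chr_mul_der, smul_smul, D.braiding' hli, one_smul]

theorem der_mul_divPow_of_ne {l i : Fin θ} (hli : l ≠ i) (n m : ℕ) :
    D.der l * D.divPow i n m = (D.χ l (D.g i) : k) ^ (n + m) • (D.divPow i n m * D.der l) := by
  rw [D.mul_divPow_of_qcomm (D.der_mul_der hli) (D.der_mul_chr_of_ne hli), pow_add]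

theorem divPow_mul_der (i : Fin θ) (n m : ℕ) : D.divPow i n m * D.der i =
    ((D.χ i (D.g i) : k) ^ m * qNumber (D.χ i (D.g i) : k) (n + 1)) • D.divPow i (n + 1) m := by
  have h1 : D.chr i ^ m * D.der i = (D.χ i (D.g i) : k) ^ m • (D.der i * D.chr i ^ m) := by
    induction m with
    | zero => simp
    | succ m ih =>
      rw [pow_succ, mul_assoc, chr_mul_der, mul_smul_comm, ← mul_assoc, ih, smul_mul_assoc,
        smul_smul, mul_assoc, ← pow_succ, ← pow_succ']
  rw [mul_smul, ← der_mul_divPow, divPow, smul_mul_assoc, mul_assoc, h1, mul_smul_comm,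
    mul_smul_comm, ← mul_assoc, ← mul_assoc, ← pow_succ, ← pow_succ', smul_comm]

theorem translate_grp_divPow (h : G) (i : Fin θ) (n m : ℕ) :
    D.translate (D.grp 0 0 h) (D.divPow i n m) = (D.χ i h : k) ^ (n + m) • D.divPow i n m := by
  rw [divPow, map_smul, translate_grp_der_pow_mul, smul_comm]

theorem translate_x_divPow_succ {i : Fin θ} {n : ℕ} (hn : n + 1 < D.N i) (m : ℕ) :
    D.translate (D.x 0 0 i) (D.divPow i (n + 1) m) = D.divPow i n m := by
  rw [divPow, map_smul, translate_x_der_pow_mul, smul_smul, qFactorial_succ, mul_inv,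
    mul_assoc, inv_mul_cancel₀ (D.qNumber_ne_zero i hn), mul_one, divPow]

theorem translate_x_divPow_zero (j i : Fin θ) (m : ℕ) :
    D.translate (D.x 0 0 j) (D.divPow i 0 m) = 0 := by
  rw [divPow_zero, translate_x_chr_pow]

theorem translate_x_divPow_of_ne {j i : Fin θ} (hj : j ≠ i) (n m : ℕ) :
    D.translate (D.x 0 0 j) (D.divPow i n m) = 0 := by
  rw [divPow, map_smul, translate_x_der_pow_mul_of_ne D hj, smul_zero]

theorem divPow_apply_one (i : Fin θ) (n m : ℕ) :
    D.divPow i n m 1 = if n = 0 then 1 else 0 := by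
  rw [divPow, WithConv.ofConv_smul, LinearMap.smul_apply, der_pow_mul_apply_one]
  by_cases hn : n = 0 <;> simp [hn, qFactorial]

theorem divPow_apply_grp (i : Fin θ) (n m : ℕ) (h : G) :
    D.divPow i n m (D.grp 0 0 h) = if n = 0 then (D.χ i h : k) ^ m else 0 := by
  have := congrArg (fun f => f 1) (D.translate_grp_divPow h i n m)
  simp only [translate_apply, mul_one, WithConv.ofConv_smul, LinearMap.smul_apply,
    divPow_apply_one] at this
  rw [this]
  by_cases hn : n = 0 <;> simp [hn]

theorem divPow_apply_x (i j : Fin θ) {n : ℕ} (m : ℕ) (hn : n < D.N i) :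
    D.divPow i n m (D.x 0 0 j) = if j = i ∧ n = 1 then 1 else 0 := by
  rw [← mul_one (D.x 0 0 j), ← translate_apply]
  by_cases hj : j = i
  · subst hj
    cases n with
    | zero => rw [translate_x_divPow_zero]; simp
    | succ n => rw [D.translate_x_divPow_succ hn, divPow_apply_one]; simp
  · rw [D.translate_x_divPow_of_ne hj]; simp [hj]

theorem divPow_apply_x_pow_mul {i : Fin θ} {n : ℕ} (m : ℕ) (hn : n < D.N i) (a : ℕ) (b : D.A) :
    D.divPow i n m (D.x 0 0 i ^ a * b) = if a ≤ n then D.divPow i (n - a) m b else 0 := by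
  induction a generalizing n with
  | zero => simp
  | succ a ih =>
    rw [pow_succ', mul_assoc, ← translate_apply]
    cases n with
    | zero => rw [translate_x_divPow_zero]; simp
    | succ n => rw [D.translate_x_divPow_succ hn, ih (by omega)]; simp

theorem divPow_apply_x_pow_mul_of_ne {i j : Fin θ} (hj : j ≠ i) (n m a : ℕ) (b : D.A) :
    D.divPow i n m (D.x 0 0 j ^ a * b) = if a = 0 then D.divPow i n m b else 0 := by
  cases a with
  | zero => simp
  | succ a => rw [pow_succ', mul_assoc, ← translate_apply, D.translate_x_divPow_of_ne hj]; simp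

theorem divPow_apply_list {i : Fin θ} {n : ℕ} (m : ℕ) (hn : n < D.N i) (a : Fin θ → ℕ) (h : G)
    (l : List (Fin θ)) :
    D.divPow i n m ((l.map fun j => D.x 0 0 j ^ a j).prod * D.grp 0 0 h) =
      if (∀ j ∈ l, j ≠ i → a j = 0) ∧ (l.map fun j => if j = i then a j else 0).sum = n
      then (D.χ i h : k) ^ m else 0 := by
  induction l generalizing n with
  | nil => simp [divPow_apply_grp, eq_comm]
  | cons j l ih =>
    rw [List.map_cons, List.prod_cons, mul_assoc]
    by_cases hj : j = i
    · subst hj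
      rw [D.divPow_apply_x_pow_mul m hn, ih (by omega)]
      by_cases ha : a j ≤ n
      · have e : ∀ s : ℕ, s = n - a j ↔ a j + s = n := fun s => by omega
        simp [ha, e]
      · have e : ∀ s : ℕ, a j + s ≠ n := fun s => by omega
        simp [ha, e]
    · rw [D.divPow_apply_x_pow_mul_of_ne hj, ih hn]
      by_cases ha : a j = 0 <;> simp [ha, hj]

/-- The values of the divided powers on the PBW basis. -/
theorem divPow_apply_pbwMonomial {i : Fin θ} {n : ℕ} (m : ℕ) (hn : n ≤ D.N i) (p : D.PBWIndex) :
    D.divPow i n m (D.pbwMonomial p) =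
      if (∀ j, j ≠ i → (p.1 j : ℕ) = 0) ∧ (p.1 i : ℕ) = n then (D.χ i p.2 : k) ^ m else 0 := by
  rcases hn.lt_or_eq with hn | rfl
  · rw [pbwMonomial, monomial, D.divPow_apply_list m hn, ← Fin.sum_univ_def]
    simp
  · rw [D.divPow_eq_zero le_rfl, if_neg fun h => (p.1 i).2.ne h.2]
    simp

/-- The functional defined through the PBW basis is the character. -/
theorem chiExt_eq (i : Fin θ) : D.chiExt i = D.chr i := by
  rw [← pow_one (D.chr i), ← divPow_zero]
  refine WithConv.ofConv_injective (D.pbwBasis.ext fun p => ?_)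
  rw [chiExt, Module.Basis.constr_basis, pbwBasis_apply,
    D.divPow_apply_pbwMonomial 1 (Nat.zero_le _), pow_one]
  congr 1
  exact propext ⟨fun h => ⟨fun j _ => h j, h i⟩, fun h j => by
    by_cases hj : j = i
    · rw [hj, h.2]
    · exact h.1 j hj⟩

/-- The functional defined through the PBW basis is the skew derivation. -/
theorem skewDer_eq (i : Fin θ) : D.skewDer i = D.der i := by
  rw [← divPow_one_zero]
  refine WithConv.ofConv_injective (D.pbwBasis.ext fun p => ?_)
  rw [skewDer, Module.Basis.constr_basis, pbwBasis_apply,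
    D.divPow_apply_pbwMonomial 0 (D.N_pos i), pow_zero]
  congr 1
  exact propext ⟨fun h => ⟨fun j hj => by rw [h j, if_neg hj], by rw [h i, if_pos rfl]⟩,
    fun h j => by
      by_cases hj : j = i
      · rw [hj, h.2, if_pos rfl]
      · rw [h.1 j hj, if_neg hj]⟩

/-- The function `ζᵢ`, defined through the PBW basis, in terms of divided powers. The two extreme
terms of the sum are zero, since `dᵢ^Nᵢ = 0`. -/
theorem zeta_eq (i : Fin θ) : D.zeta i = ∑ c ∈ Finset.HasAntidiagonal.antidiagonal (D.N i),
    box (D.divPow i c.1 c.2) (D.divPow i c.2 0) := by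
  refine WithConv.ofConv_injective ((D.pbwBasis.tensorProduct D.pbwBasis).ext fun p => ?_)
  rw [zeta, Module.Basis.constr_basis, Module.Basis.tensorProduct_apply, pbwBasis_apply,
    pbwBasis_apply, WithConv.ofConv_sum, LinearMap.sum_apply]
  have h1 : ∀ c ∈ Finset.HasAntidiagonal.antidiagonal (D.N i),
      box (D.divPow i c.1 c.2) (D.divPow i c.2 0) (D.pbwMonomial p.1 ⊗ₜ[k] D.pbwMonomial p.2) =
      if ((p.1.1 i : ℕ), (p.2.1 i : ℕ)) = c then (if (∀ j, j ≠ i → (p.1.1 j : ℕ) = 0 ∧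
        (p.2.1 j : ℕ) = 0) then (D.χ i p.1.2 : k) ^ (p.2.1 i : ℕ) else 0) else 0 := by
    rintro ⟨a, b⟩ hc
    have hc' : a + b = D.N i := Finset.HasAntidiagonal.mem_antidiagonal.1 hc
    rw [box_tmul, D.divPow_apply_pbwMonomial _ (by omega),
      D.divPow_apply_pbwMonomial _ (by omega)]
    simp only [forall_and]
    by_cases ha : (p.1.1 i : ℕ) = a <;> by_cases hb : (p.2.1 i : ℕ) = b <;>
      by_cases h1 : ∀ j, j ≠ i → (p.1.1 j : ℕ) = 0 <;>
      by_cases h2 : ∀ j, j ≠ i → (p.2.1 j : ℕ) = 0 <;>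
      (simp only [ha, hb, h1, h2, Prod.mk.injEq]; simp) <;>
      split_ifs <;> tauto
  rw [Finset.sum_congr rfl h1, Finset.sum_ite_eq]
  simp only [Finset.HasAntidiagonal.mem_antidiagonal]
  split_ifs <;> tauto

end QLSDatum

/-! ### The exponential of a nilpotent element -/

section NilExp

variable {k : Type*} [Field k] {B B' : Type*} [Ring B] [Algebra k B] [Ring B'] [Algebra k B']

theorem nilExp_eq_sum {f : B} {n : ℕ} (h : f ^ n = 0) :
    nilExp k f = ∑ i ∈ Finset.range n, ((i.factorial : k))⁻¹ • f ^ i := by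
  refine finsum_eq_sum_of_support_subset _ fun i hi => ?_
  by_contra hn
  rw [Finset.coe_range, Set.mem_Iio, not_lt] at hn
  refine hi ?_
  simp only [pow_eq_zero_of_le hn h, smul_zero]

theorem map_nilExp (g : B →ₐ[k] B') {f : B} (hf : IsNilpotent f) :
    g (nilExp k f) = nilExp k (g f) := by
  obtain ⟨n, hn⟩ := hf
  rw [nilExp_eq_sum hn, nilExp_eq_sum (f := g f) (n := n) (by rw [← map_pow, hn, map_zero]),
    map_sum]
  simp

theorem nilExp_zero : nilExp k (0 : B) = 1 := by
  rw [nilExp_eq_sum (n := 1) (by simp)]; simp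

theorem nilExp_add [CharZero k] {a b : B} (h : Commute a b) (ha : IsNilpotent a)
    (hb : IsNilpotent b) : nilExp k (a + b) = nilExp k a * nilExp k b := by
  let _ : Module ℚ B := Module.compHom B (algebraMap ℚ k)
  have key : ∀ {f : B}, IsNilpotent f → nilExp k f = IsNilpotent.exp f := fun {f} hf => by
    obtain ⟨n, hn⟩ := hf
    rw [nilExp_eq_sum hn, IsNilpotent.exp_eq_sum hn]
    refine Finset.sum_congr rfl fun i _ => ?_
    have : (algebraMap ℚ k) ((i.factorial : ℚ)⁻¹) = (i.factorial : k)⁻¹ := by simp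
    rw [← this]; rfl
  rw [key ha, key hb, key (h.isNilpotent_add ha hb), IsNilpotent.exp_add_of_commute h ha hb]

theorem isUnit_nilExp [CharZero k] {f : B} (hf : IsNilpotent f) : IsUnit (nilExp k f) := by
  have h1 := nilExp_add (k := k) (Commute.neg_right (Commute.refl f)) hf hf.neg
  have h2 := nilExp_add (k := k) (Commute.neg_left (Commute.refl f)) hf.neg hf
  rw [add_neg_cancel, nilExp_zero] at h1
  rw [neg_add_cancel, nilExp_zero] at h2
  exact ⟨⟨_, _, h1.symm, h2.symm⟩, rfl⟩

end NilExp

namespace HopfDeformation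

open Coalgebra WithConv

variable {k H : Type*} [Field k] [Ring H] [HopfAlgebra k H]

/-! ### External products and exponentials of Hochschild cocycles -/

/-- `φ ↦ φ ∘ m`, the comultiplication of the dual. -/
def dualComul (k H : Type*) [Field k] [Ring H] [HopfAlgebra k H] :
    WithConv (H →ₗ[k] k) →ₐ[k] WithConv (H ⊗[k] H →ₗ[k] k) :=
  pullback k (Bialgebra.mulCoalgHom k H)

@[simp] theorem dualComul_tmul (φ : WithConv (H →ₗ[k] k)) (a b : H) :
    dualComul k H φ (a ⊗ₜ[k] b) = φ (a * b) := rfl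

theorem compIdMul_box (φ ψ : WithConv (H →ₗ[k] k)) :
    compIdMul (box φ ψ) = box φ (dualComul k H ψ) :=
  conv_ext_tmul₃ fun _ _ _ => rfl

theorem compMulId_box (φ ψ : WithConv (H →ₗ[k] k)) :
    compMulId (box φ ψ) = pullback k (assocSymm k H) (box (dualComul k H φ) ψ) :=
  conv_ext_tmul₃ fun _ _ _ => rfl

theorem epsTensor_box (φ ψ : WithConv (H →ₗ[k] k)) :
    epsTensor (box φ ψ) = box 1 (box φ ψ) := rfl

theorem pullback_assocSymm_box (φ ψ ω : WithConv (H →ₗ[k] k)) :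
    pullback k (assocSymm k H) (box (box φ ψ) ω) = box φ (box ψ ω) :=
  conv_ext_tmul₃ fun _ _ _ => mul_assoc _ _ _

theorem tensorEps_box (φ ψ : WithConv (H →ₗ[k] k)) :
    tensorEps (box φ ψ) = box φ (box ψ 1) := by
  rw [tensorEps_eq, boxOne_apply, pullback_assocSymm_box]

theorem commute_epsTensor_compIdMul {σ : WithConv (H ⊗[k] H →ₗ[k] k)} {φ ψ : WithConv (H →ₗ[k] k)}
    (h : Commute σ (dualComul k H ψ)) : Commute (epsTensor σ) (compIdMul (box φ ψ)) := by
  rw [compIdMul_box, epsTensor_eq, oneBox_apply, Commute, SemiconjBy, box_mul_box, box_mul_box,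
    h.eq, one_mul, mul_one]

theorem commute_tensorEps_compMulId {σ : WithConv (H ⊗[k] H →ₗ[k] k)} {φ ψ : WithConv (H →ₗ[k] k)}
    (h : Commute σ (dualComul k H φ)) : Commute (tensorEps σ) (compMulId (box φ ψ)) := by
  rw [compMulId_box, tensorEps_eq, boxOne_apply]
  refine Commute.map ?_ _
  rw [Commute, SemiconjBy, box_mul_box, box_mul_box, h.eq, one_mul, mul_one]

/-- The exponential of a nilpotent Hochschild 2-cocycle `z` is a multiplicative cocycle, provided
that the terms of the cocycle condition commute. -/
theorem isMulCocycle_nilExp [CharZero k] {z : WithConv (H ⊗[k] H →ₗ[k] k)} (hz : IsNilpotent z)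
    (h : epsTensor z + compIdMul z = tensorEps z + compMulId z)
    (c1 : Commute (epsTensor z) (compIdMul z)) (c2 : Commute (tensorEps z) (compMulId z))
    (hl : ∀ a : H, z ((1 : H) ⊗ₜ[k] a) = 0) (hr : ∀ a : H, z (a ⊗ₜ[k] (1 : H)) = 0) :
    IsMulCocycle (nilExp k z) where
  isUnit := isUnit_nilExp hz
  cocycle := by
    have e1 : epsTensor (nilExp k z) = nilExp k (epsTensor z) := map_nilExp (epsTensorHom k H) hz
    have e2 : tensorEps (nilExp k z) = nilExp k (tensorEps z) := map_nilExp (tensorEpsHom k H) hz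
    have e3 : compIdMul (nilExp k z) = nilExp k (compIdMul z) := map_nilExp (compIdMulHom k H) hz
    have e4 : compMulId (nilExp k z) = nilExp k (compMulId z) := map_nilExp (compMulIdHom k H) hz
    have n1 : IsNilpotent (epsTensor z) := hz.map (epsTensorHom k H)
    have n2 : IsNilpotent (tensorEps z) := hz.map (tensorEpsHom k H)
    have n3 : IsNilpotent (compIdMul z) := hz.map (compIdMulHom k H)
    have n4 : IsNilpotent (compMulId z) := hz.map (compMulIdHom k H)
    rw [e1, e2, e3, e4, ← nilExp_add c1 n1 n3, ← nilExp_add c2 n2 n4, h]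
  one_left a := by
    have h1 := map_nilExp (pullback k (groupLikeTmul (k := k) (H := H) isGroupLikeElem_one)) hz
    have h2 : pullback k (groupLikeTmul (k := k) (H := H) isGroupLikeElem_one) z = 0 :=
      WithConv.ext (LinearMap.ext hl)
    rw [h2, nilExp_zero] at h1
    exact congrArg (fun f => f a) h1
  one_right a := by
    have h1 := map_nilExp (pullback k (tmulGroupLike (k := k) (H := H) isGroupLikeElem_one)) hz
    have h2 : pullback k (tmulGroupLike (k := k) (H := H) isGroupLikeElem_one) z = 0 :=
      WithConv.ext (LinearMap.ext hr)
    rw [h2, nilExp_zero] at h1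
    exact congrArg (fun f => f a) h1

theorem evalLeft_nilExp_of_groupLike {z : WithConv (H ⊗[k] H →ₗ[k] k)} (hz : IsNilpotent z) {g : H}
    (hg : IsGroupLikeElem k g) (h : evalLeft g z = 0) : evalLeft g (nilExp k z) = 1 := by
  have h1 := map_nilExp (pullback k (groupLikeTmul (k := k) (H := H) hg)) hz
  have h2 : pullback k (groupLikeTmul (k := k) (H := H) hg) z = 0 := h
  rw [h2, nilExp_zero] at h1
  exact h1

theorem evalLeft_nilExp_of_skew {z : WithConv (H ⊗[k] H →ₗ[k] k)} (hz : IsNilpotent z) {x g : H}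
    (hx : comul (R := k) x = x ⊗ₜ[k] 1 + g ⊗ₜ[k] x) (hx0 : counit (R := k) x = 0)
    (h1 : evalLeft 1 z = 0) (hg : evalLeft g z = 0) :
    evalLeft x (nilExp k z) = evalLeft x z := by
  have hE : ∀ n, evalLeft x (z ^ (n + 2)) = 0 := fun n => by
    have h0 : evalLeft 1 (z ^ (n + 1)) = 0 := by
      rw [pow_succ, evalLeft_mul_of_groupLike isGroupLikeElem_one, h1, mul_zero]
    rw [pow_succ', evalLeft_mul_of_skew hx, h0, hg, mul_zero, zero_mul, add_zero]
  obtain ⟨n, hn⟩ := hz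
  have hn2 : z ^ (n + 2) = 0 := pow_eq_zero_of_le (by omega) hn
  ext b
  have h3 : ∀ w, (∑ i ∈ Finset.range (n + 2), ((i.factorial : k))⁻¹ • z ^ i) w =
      ∑ i ∈ Finset.range (n + 2), ((i.factorial : k))⁻¹ * (z ^ i) w := fun w => by
    rw [WithConv.ofConv_sum, LinearMap.sum_apply]; rfl
  rw [nilExp_eq_sum hn2, evalLeft_apply, h3, Finset.sum_range_succ', Finset.sum_range_succ']
  rw [Finset.sum_eq_zero fun i _ => ?_]
  · simp [hx0]
  · have := congrArg (fun f => f b) (hE i)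
    rw [evalLeft_apply] at this
    rw [this]; simp

end HopfDeformation

namespace QLSDatum

open Coalgebra WithConv HopfDeformation

variable {k G : Type*} [Field k] [CommGroup G] {θ : ℕ} (D : QLSDatum k G θ) [Finite G]

/-! ### The Hochschild cocycles `ζᵢ` -/

theorem dualComul_chr (i : Fin θ) : dualComul k D.A (D.chr i) = box (D.chr i) (D.chr i) :=
  conv_ext_tmul fun a b => D.chr_mul i a b

theorem dualComul_der (i : Fin θ) :
    dualComul k D.A (D.der i) = box (D.der i) 1 + box (D.chr i) (D.der i) :=
  conv_ext_tmul fun a b => by simp [der_mul]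

theorem box_pow {C C' : Type*} [AddCommGroup C] [Module k C] [Coalgebra k C]
    [AddCommGroup C'] [Module k C'] [Coalgebra k C'] (φ : WithConv (C →ₗ[k] k))
    (ψ : WithConv (C' →ₗ[k] k)) (n : ℕ) : box φ ψ ^ n = box (φ ^ n) (ψ ^ n) := by
  induction n with
  | zero => simp
  | succ n ih => rw [pow_succ, ih, box_mul_box, pow_succ, pow_succ]

theorem sum_box {ι C C' : Type*} [AddCommGroup C] [Module k C] [Coalgebra k C]
    [AddCommGroup C'] [Module k C'] [Coalgebra k C'] (s : Finset ι) (φ : ι → WithConv (C →ₗ[k] k))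
    (ψ : WithConv (C' →ₗ[k] k)) : box (∑ i ∈ s, φ i) ψ = ∑ i ∈ s, box (φ i) ψ := by
  classical
  induction s using Finset.induction_on with
  | empty => exact conv_ext_tmul fun a b => by simp
  | insert a s ha ih => rw [Finset.sum_insert ha, Finset.sum_insert ha, add_box, ih]

theorem box_sum {ι C C' : Type*} [AddCommGroup C] [Module k C] [Coalgebra k C]
    [AddCommGroup C'] [Module k C'] [Coalgebra k C'] (s : Finset ι) (φ : WithConv (C →ₗ[k] k))
    (ψ : ι → WithConv (C' →ₗ[k] k)) : box φ (∑ i ∈ s, ψ i) = ∑ i ∈ s, box φ (ψ i) := by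
  classical
  induction s using Finset.induction_on with
  | empty => exact conv_ext_tmul fun a b => by simp
  | insert a s ha ih => rw [Finset.sum_insert ha, Finset.sum_insert ha, box_add, ih]

/-- The comultiplication of the divided powers, an instance of the `q`-binomial formula. -/
theorem dualComul_divPow {i : Fin θ} {n : ℕ} (hn : n < D.N i) (m : ℕ) :
    dualComul k D.A (D.divPow i n m) = ∑ c ∈ Finset.HasAntidiagonal.antidiagonal n,
      box (D.divPow i c.1 (c.2 + m)) (D.divPow i c.2 m) := by
  set q := (D.χ i (D.g i) : k) with hq
  have hc : box (D.chr i) (D.der i) * box (D.der i) 1 =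
      q • (box (D.der i) 1 * box (D.chr i) (D.der i)) := by
    rw [box_mul_box, box_mul_box, chr_mul_der, smul_box, one_mul, mul_one]
  rw [divPow, map_smul, map_mul, map_pow, map_pow, dualComul_der, dualComul_chr,
    add_pow_qcomm hc, Finset.Nat.sum_antidiagonal_eq_sum_range_succ_mk, Finset.sum_mul,
    Finset.smul_sum]
  refine Finset.sum_congr rfl fun a ha => ?_
  have ha' : a ≤ n := by have := Finset.mem_range.1 ha; omega
  have hg := gaussBinom_mul q n a (n - a) (by omega)
  have f1 := qFactorial_ne_zero (D.isPrimitiveRoot i) (show a < D.N i by omega)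
  have f2 := qFactorial_ne_zero (D.isPrimitiveRoot i) (show n - a < D.N i by omega)
  have f3 := qFactorial_ne_zero (D.isPrimitiveRoot i) hn
  rw [← hq] at f1 f2 f3
  rw [box_pow, box_pow, box_pow, one_pow, box_mul_box, smul_mul_assoc, box_mul_box, one_mul,
    smul_smul, divPow, divPow, smul_box, box_smul, smul_smul, mul_assoc, ← pow_add, ← hq]
  congr 1
  field_simp
  linear_combination hg

end QLSDatum

namespace QLSDatum

open Coalgebra WithConv HopfDeformation

variable {k G : Type*} [Field k] [CommGroup G] {θ : ℕ} (D : QLSDatum k G θ) [Finite G]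

/-- Factors of commutation of two external products cancel if they are inverse to each other. -/
theorem commute_box {φ φ' ψ ψ' : WithConv (D.A →ₗ[k] k)} {r s : k} (h1 : φ * φ' = r • (φ' * φ))
    (h2 : ψ * ψ' = s • (ψ' * ψ)) (hrs : r * s = 1) : Commute (box φ' ψ') (box φ ψ) := by
  rw [Commute, SemiconjBy, box_mul_box, box_mul_box, h1, h2, smul_box, box_smul, smul_smul, hrs,
    one_smul]

variable {D} in
theorem χ_pow_N {i : Fin θ} (hχ : D.χ i ^ D.N i = 1) (l : Fin θ) :
    (D.χ l (D.g i) : k) ^ D.N i = 1 := by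
  by_cases hl : l = i
  · subst hl; exact (D.isPrimitiveRoot l).pow_eq_one
  · have h1 : ((D.χ i (D.g l) : kˣ) : k) ^ D.N i = 1 := by
      rw [← Units.val_pow_eq_pow_val, ← MonoidHom.pow_apply, hχ]; simp
    have h2 := congrArg (· ^ D.N i) (D.braiding' hl)
    simpa [mul_pow, h1] using h2

variable {D} in
theorem commute_zeta_chr {i : Fin θ} (hχ : D.χ i ^ D.N i = 1) (l : Fin θ) :
    Commute (D.zeta i) (box (D.chr l) (D.chr l)) := by
  rw [zeta_eq]
  refine Commute.sum_left _ _ _ fun c hc => ?_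
  refine D.commute_box (D.chr_mul_divPow l i _ _) (D.chr_mul_divPow l i _ _) ?_
  rw [← pow_add, Finset.HasAntidiagonal.mem_antidiagonal.1 hc, χ_pow_N hχ]

variable {D} in
theorem commute_zeta_der_box_one {i l : Fin θ} (hχ : D.χ i ^ D.N i = 1) (hl : l ≠ i) :
    Commute (D.zeta i) (box (D.der l) 1) := by
  rw [zeta_eq]
  refine Commute.sum_left _ _ _ fun c hc => ?_
  refine D.commute_box (s := 1) (D.der_mul_divPow_of_ne hl _ _) (by simp) ?_
  rw [Finset.HasAntidiagonal.mem_antidiagonal.1 hc, χ_pow_N hχ, one_mul]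

variable {D} in
theorem commute_zeta_chr_box_der {i l : Fin θ} (hχ : D.χ i ^ D.N i = 1) (hl : l ≠ i) :
    Commute (D.zeta i) (box (D.chr l) (D.der l)) := by
  rw [zeta_eq]
  refine Commute.sum_left _ _ _ fun c hc => ?_
  refine D.commute_box (D.chr_mul_divPow l i _ _) (D.der_mul_divPow_of_ne hl _ _) ?_
  rw [add_zero, ← pow_add, Finset.HasAntidiagonal.mem_antidiagonal.1 hc, χ_pow_N hχ]

/-- Here the two summands of `dᵢ ∘ m` do not commute with `ζᵢ` separately: both products are
equal to `∑ (a + b)_q • t(a, b) ⊠ t(b, 0)` over `a + b = Nᵢ + 1`, where `t(n, m)` is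
`divPow i n m`. -/
theorem commute_zeta_dualComul_der_self (i : Fin θ) :
    Commute (D.zeta i) (dualComul k D.A (D.der i)) := by
  set q := (D.χ i (D.g i) : k) with hq
  have hN : q ^ D.N i = 1 := (D.isPrimitiveRoot i).pow_eq_one
  set T : ℕ × ℕ → WithConv (D.A ⊗[k] D.A →ₗ[k] k) := fun c =>
    box (D.divPow i c.1 c.2) (D.divPow i c.2 0) with hT
  have h0 : qNumber q 0 = 0 := by simp [qNumber]
  have s1 : ∀ f : ℕ × ℕ → k, ∑ c ∈ Finset.HasAntidiagonal.antidiagonal (D.N i),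
      (f (c.1 + 1, c.2) * qNumber q (c.1 + 1)) • T (c.1 + 1, c.2) =
      ∑ c ∈ Finset.HasAntidiagonal.antidiagonal (D.N i + 1), (f c * qNumber q c.1) • T c := by
    intro f
    rw [Finset.Nat.sum_antidiagonal_succ, h0, mul_zero, zero_smul, zero_add]
  have s2 : ∀ f : ℕ × ℕ → k, ∑ c ∈ Finset.HasAntidiagonal.antidiagonal (D.N i),
      (f (c.1, c.2 + 1) * qNumber q (c.2 + 1)) • T (c.1, c.2 + 1) =
      ∑ c ∈ Finset.HasAntidiagonal.antidiagonal (D.N i + 1), (f c * qNumber q c.2) • T c := by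
    intro f
    rw [Finset.Nat.sum_antidiagonal_succ', h0, mul_zero, zero_smul, zero_add]
  have t1 : D.zeta i * box (D.der i) 1 =
      ∑ c ∈ Finset.HasAntidiagonal.antidiagonal (D.N i + 1), (q ^ c.2 * qNumber q c.1) • T c := by
    rw [zeta_eq, Finset.sum_mul, ← s1 fun c => q ^ c.2]
    refine Finset.sum_congr rfl fun c _ => ?_
    rw [box_mul_box, divPow_mul_der, mul_one, smul_box]
  have t2 : D.zeta i * box (D.chr i) (D.der i) =
      ∑ c ∈ Finset.HasAntidiagonal.antidiagonal (D.N i + 1), (1 * qNumber q c.2) • T c := by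
    rw [zeta_eq, Finset.sum_mul, ← s2 fun c => 1]
    refine Finset.sum_congr rfl fun c _ => ?_
    rw [box_mul_box, divPow_mul_der, divPow_mul_chr, pow_zero, box_smul]
  have t3 : box (D.der i) 1 * D.zeta i =
      ∑ c ∈ Finset.HasAntidiagonal.antidiagonal (D.N i + 1), (1 * qNumber q c.1) • T c := by
    rw [zeta_eq, Finset.mul_sum, ← s1 fun c => 1]
    refine Finset.sum_congr rfl fun c _ => ?_
    rw [box_mul_box, der_mul_divPow, one_mul, smul_box, one_mul]
  have t4 : box (D.chr i) (D.der i) * D.zeta i =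
      ∑ c ∈ Finset.HasAntidiagonal.antidiagonal (D.N i + 1), (q ^ c.1 * qNumber q c.2) • T c := by
    rw [zeta_eq, Finset.mul_sum, ← s2 fun c => q ^ c.1]
    refine Finset.sum_congr rfl fun c _ => ?_
    rw [box_mul_box, der_mul_divPow, chr_mul_divPow, smul_box, box_smul, smul_smul, divPow_mul_chr]
  rw [dualComul_der, Commute, SemiconjBy, mul_add, add_mul, t1, t2, t3, t4,
    ← Finset.sum_add_distrib, ← Finset.sum_add_distrib]
  refine Finset.sum_congr rfl fun c _ => ?_
  rw [← add_smul, ← add_smul]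
  congr 1
  have e1 := qNumber_add q c.1 c.2
  have e2 := qNumber_add q c.2 c.1
  rw [add_comm] at e2
  linear_combination e1 - e2

variable {D} in
theorem commute_zeta_dualComul_divPow {i : Fin θ} (hχ : D.χ i ^ D.N i = 1) (l : Fin θ) (n m : ℕ) :
    Commute (D.zeta i) (dualComul k D.A (D.divPow l n m)) := by
  have hd : Commute (D.zeta i) (dualComul k D.A (D.der l)) := by
    by_cases hl : l = i
    · subst hl; exact D.commute_zeta_dualComul_der_self l
    · rw [dualComul_der]
      exact (commute_zeta_der_box_one hχ hl).add_right (commute_zeta_chr_box_der hχ hl)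
  have hc : Commute (D.zeta i) (dualComul k D.A (D.chr l)) := by
    rw [dualComul_chr]; exact commute_zeta_chr hχ l
  rw [divPow, map_smul, map_mul, map_pow, map_pow]
  exact ((hd.pow_right n).mul_right (hc.pow_right m)).smul_right _

variable {D} in
theorem commute_epsTensor_compIdMul_zeta {i : Fin θ} (hχ : D.χ i ^ D.N i = 1) (l : Fin θ) :
    Commute (epsTensor (D.zeta i)) (compIdMul (D.zeta l)) := by
  have h : compIdMul (D.zeta l) = ∑ c ∈ Finset.HasAntidiagonal.antidiagonal (D.N l),
      compIdMul (box (D.divPow l c.1 c.2) (D.divPow l c.2 0)) := by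
    rw [zeta_eq]; exact map_sum (compIdMulHom k D.A) _ _
  rw [h]
  exact Commute.sum_right _ _ _ fun c _ =>
    commute_epsTensor_compIdMul (commute_zeta_dualComul_divPow hχ l _ _)

variable {D} in
theorem commute_tensorEps_compMulId_zeta {i : Fin θ} (hχ : D.χ i ^ D.N i = 1) (l : Fin θ) :
    Commute (tensorEps (D.zeta i)) (compMulId (D.zeta l)) := by
  have h : compMulId (D.zeta l) = ∑ c ∈ Finset.HasAntidiagonal.antidiagonal (D.N l),
      compMulId (box (D.divPow l c.1 c.2) (D.divPow l c.2 0)) := by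
    rw [zeta_eq]; exact map_sum (compMulIdHom k D.A) _ _
  rw [h]
  exact Commute.sum_right _ _ _ fun c _ =>
    commute_tensorEps_compMulId (commute_zeta_dualComul_divPow hχ l _ _)

variable {D} in
theorem commute_zeta {i l : Fin θ} (hχ : D.χ i ^ D.N i = 1) : Commute (D.zeta i) (D.zeta l) := by
  by_cases hl : l = i
  · subst hl; exact Commute.refl _
  -- each term of `ζₗ` is a polynomial in the two summands of `dₗ ∘ m`, which commute with `ζᵢ`
  rw [D.zeta_eq l]
  refine Commute.sum_right _ _ _ fun c _ => ?_
  have e : box (D.divPow l c.1 c.2) (D.divPow l c.2 0) =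
      ((qFactorial (D.χ l (D.g l) : k) c.1)⁻¹ * (qFactorial (D.χ l (D.g l) : k) c.2)⁻¹) •
        (box (D.der l) 1 ^ c.1 * box (D.chr l) (D.der l) ^ c.2) := by
    rw [divPow, divPow, smul_box, box_smul, smul_smul, box_pow, box_pow, box_mul_box, one_pow,
      one_mul, pow_zero, mul_one]
  rw [e]
  exact (((commute_zeta_der_box_one hχ hl).pow_right _).mul_right
    ((commute_zeta_chr_box_der hχ hl).pow_right _)).smul_right _

theorem zeta_mul_self (i : Fin θ) : D.zeta i * D.zeta i = 0 := by
  have key : ∀ a b n m : ℕ, D.N i ≤ a + n → D.divPow i a b * D.divPow i n m = 0 := by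
    intro a b n m h
    have hc : ∀ b, D.chr i ^ b * D.der i ^ n = ((D.χ i (D.g i) : k) ^ n) ^ b •
        (D.der i ^ n * D.chr i ^ b) := fun b => by
      have h1 := mul_pow_of_qcomm (D.chr_mul_der i i) n
      induction b with
      | zero => simp
      | succ b ih =>
        rw [pow_succ, mul_assoc, h1, mul_smul_comm, ← mul_assoc, ih, smul_mul_assoc, smul_smul,
          mul_assoc, ← pow_succ, ← pow_succ']
    rw [divPow, divPow, smul_mul_smul_comm, mul_assoc, ← mul_assoc (D.chr i ^ b), hc,
      smul_mul_assoc, mul_smul_comm, mul_assoc, ← mul_assoc, ← pow_add, D.der_pow_eq_zero h,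
      zero_mul, smul_zero, smul_zero]
  rw [zeta_eq, Finset.sum_mul_sum]
  refine Finset.sum_eq_zero fun c hc => Finset.sum_eq_zero fun e he => ?_
  have h1 := Finset.HasAntidiagonal.mem_antidiagonal.1 hc
  have h2 := Finset.HasAntidiagonal.mem_antidiagonal.1 he
  rw [box_mul_box]
  rcases le_or_gt (D.N i) (c.1 + e.1) with h | h
  · rw [key _ _ _ _ h]; exact conv_ext_tmul fun a b => by simp
  · rw [key c.2 0 e.2 0 (by omega)]; exact conv_ext_tmul fun a b => by simp

variable {D} in
/-- The Hochschild cocycle condition for `ζᵢ`: both sides are the sum of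
`t(a, b + c) ⊠ t(b, c) ⊠ t(c, 0)` over `a + b + c = Nᵢ`, where `t(n, m)` is `divPow i n m`. -/
theorem zeta_hochschild {i : Fin θ} (hχ : D.χ i ^ D.N i = 1) :
    epsTensor (D.zeta i) + compIdMul (D.zeta i) =
      tensorEps (D.zeta i) + compMulId (D.zeta i) := by
  set t := D.divPow i with ht
  have t0 : ∀ m, t 0 m = D.chr i ^ m := D.divPow_zero i
  have t1 : t 0 (D.N i) = 1 := by rw [t0, D.chr_pow_eq_one hχ]
  have tN : ∀ m, t (D.N i) m = 0 := fun m => D.divPow_eq_zero le_rfl m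
  have hl : epsTensor (D.zeta i) + compIdMul (D.zeta i) =
      ∑ c ∈ Finset.HasAntidiagonal.antidiagonal (D.N i),
        ∑ e ∈ Finset.HasAntidiagonal.antidiagonal c.2,
          box (t c.1 c.2) (box (t e.1 e.2) (t e.2 0)) := by
    have h1 : compIdMul (D.zeta i) = ∑ c ∈ Finset.HasAntidiagonal.antidiagonal (D.N i),
        box (t c.1 c.2) (dualComul k D.A (t c.2 0)) := by
      rw [zeta_eq]
      refine (map_sum (compIdMulHom k D.A) _ _).trans (Finset.sum_congr rfl fun c _ => ?_)
      exact compIdMul_box _ _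
    -- The comultiplication formula for `t(n, m)` needs `n < Nᵢ`. The remaining term of `compIdMul` is
    -- zero, and the corresponding term on the right hand side is `ε ⊗ ζᵢ`.
    have h2 : (0, D.N i) ∈ Finset.HasAntidiagonal.antidiagonal (D.N i) :=
      Finset.HasAntidiagonal.mem_antidiagonal.2 (zero_add _)
    rw [h1, ← Finset.add_sum_erase _ _ h2, ← Finset.add_sum_erase _ _ h2]
    have h3 : ∑ c ∈ (Finset.HasAntidiagonal.antidiagonal (D.N i)).erase (0, D.N i),
        box (t c.1 c.2) (dualComul k D.A (t c.2 0)) =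
        ∑ c ∈ (Finset.HasAntidiagonal.antidiagonal (D.N i)).erase (0, D.N i),
          ∑ e ∈ Finset.HasAntidiagonal.antidiagonal c.2,
            box (t c.1 c.2) (box (t e.1 e.2) (t e.2 0)) := by
      refine Finset.sum_congr rfl fun c hc => ?_
      obtain ⟨hc1, hc2⟩ := Finset.mem_erase.1 hc
      have hc3 := Finset.HasAntidiagonal.mem_antidiagonal.1 hc2
      have hlt : c.2 < D.N i := by
        by_contra h
        exact hc1 (Prod.ext (by simp; omega) (by simp; omega))
      rw [ht, D.dualComul_divPow hlt, box_sum]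
      rfl
    have h4 : dualComul k D.A (t (D.N i) 0) = 0 := by rw [tN, map_zero]
    have h5 : box (t 0 (D.N i)) (0 : WithConv (D.A ⊗[k] D.A →ₗ[k] k)) = 0 :=
      conv_ext_tmul fun a b => by simp
    rw [h3, h4, h5, zero_add, t1, ← box_sum, ← D.zeta_eq]
    rfl
  have hr : tensorEps (D.zeta i) + compMulId (D.zeta i) =
      ∑ c ∈ Finset.HasAntidiagonal.antidiagonal (D.N i),
        ∑ e ∈ Finset.HasAntidiagonal.antidiagonal c.1,
          box (t e.1 (e.2 + c.2)) (box (t e.2 c.2) (t c.2 0)) := by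
    have h1 : compMulId (D.zeta i) = ∑ c ∈ Finset.HasAntidiagonal.antidiagonal (D.N i),
        pullback k (assocSymm k D.A) (box (dualComul k D.A (t c.1 c.2)) (t c.2 0)) := by
      rw [zeta_eq]
      refine (map_sum (compMulIdHom k D.A) _ _).trans (Finset.sum_congr rfl fun c _ => ?_)
      exact compMulId_box _ _
    -- Likewise with the other extreme term, which corresponds to `ζᵢ ⊗ ε`.
    have h2 : (D.N i, 0) ∈ Finset.HasAntidiagonal.antidiagonal (D.N i) :=
      Finset.HasAntidiagonal.mem_antidiagonal.2 (add_zero _)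
    rw [h1, ← Finset.add_sum_erase _ _ h2, ← Finset.add_sum_erase _ _ h2]
    have h3 : ∑ c ∈ (Finset.HasAntidiagonal.antidiagonal (D.N i)).erase (D.N i, 0),
        pullback k (assocSymm k D.A) (box (dualComul k D.A (t c.1 c.2)) (t c.2 0)) =
        ∑ c ∈ (Finset.HasAntidiagonal.antidiagonal (D.N i)).erase (D.N i, 0),
          ∑ e ∈ Finset.HasAntidiagonal.antidiagonal c.1,
            box (t e.1 (e.2 + c.2)) (box (t e.2 c.2) (t c.2 0)) := by
      refine Finset.sum_congr rfl fun c hc => ?_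
      obtain ⟨hc1, hc2⟩ := Finset.mem_erase.1 hc
      have hc3 := Finset.HasAntidiagonal.mem_antidiagonal.1 hc2
      have hlt : c.1 < D.N i := by
        by_contra h
        exact hc1 (Prod.ext (by simp; omega) (by simp; omega))
      rw [ht, D.dualComul_divPow hlt, sum_box, map_sum]
      exact Finset.sum_congr rfl fun e _ => pullback_assocSymm_box _ _ _
    have h4 : dualComul k D.A (t (D.N i) 0) = 0 := by rw [tN, map_zero]
    have h5 : box (0 : WithConv (D.A ⊗[k] D.A →ₗ[k] k)) (t 0 0) = 0 :=
      conv_ext_tmul fun a b => by simp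
    have h6 : tensorEps (D.zeta i) = ∑ c ∈ Finset.HasAntidiagonal.antidiagonal (D.N i),
        box (t c.1 (c.2 + 0)) (box (t c.2 0) (t 0 0)) := by
      rw [zeta_eq]
      refine (map_sum (tensorEpsHom k D.A) _ _).trans (Finset.sum_congr rfl fun c _ => ?_)
      rw [t0, pow_zero]
      exact tensorEps_box _ _
    rw [h3, h4, h5, map_zero, zero_add, h6]
  rw [hl, hr, Finset.sum_sigma', Finset.sum_sigma']
  refine Finset.sum_nbij' (fun s => ⟨(s.1.1 + s.2.1, s.2.2), (s.1.1, s.2.1)⟩)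
    (fun s => ⟨(s.2.1, s.2.2 + s.1.2), (s.2.2, s.1.2)⟩) ?_ ?_ ?_ ?_ ?_
  · rintro ⟨⟨a, b⟩, ⟨c, e⟩⟩ h
    simp only [Finset.mem_sigma, Finset.HasAntidiagonal.mem_antidiagonal] at h ⊢
    exact ⟨by omega, trivial⟩
  · rintro ⟨⟨a, b⟩, ⟨c, e⟩⟩ h
    simp only [Finset.mem_sigma, Finset.HasAntidiagonal.mem_antidiagonal] at h ⊢
    exact ⟨by omega, trivial⟩
  · rintro ⟨⟨a, b⟩, ⟨c, e⟩⟩ h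
    simp only [Finset.mem_sigma, Finset.HasAntidiagonal.mem_antidiagonal] at h ⊢
    obtain ⟨-, rfl⟩ := h
    rfl
  · rintro ⟨⟨a, b⟩, ⟨c, e⟩⟩ h
    simp only [Finset.mem_sigma, Finset.HasAntidiagonal.mem_antidiagonal] at h ⊢
    obtain ⟨-, rfl⟩ := h
    rfl
  · rintro ⟨⟨a, b⟩, ⟨c, e⟩⟩ h
    simp only [Finset.mem_sigma, Finset.HasAntidiagonal.mem_antidiagonal] at h ⊢
    obtain ⟨-, rfl⟩ := h
    rfl

end QLSDatum

namespace QLSDatum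

open Coalgebra WithConv HopfDeformation

variable {k G : Type*} [Field k] [CommGroup G] {θ : ℕ} (D : QLSDatum k G θ) [Finite G]

/-! ### The root vector cocycle -/

theorem evalLeft_grp_zeta (i : Fin θ) (h : G) : evalLeft (D.grp 0 0 h) (D.zeta i) = 0 := by
  rw [zeta_eq]
  refine (map_sum (pullback k (groupLikeTmul (D.isGroupLikeElem_grp 0 0 h))) _ _).trans
    (Finset.sum_eq_zero fun c hc => ?_)
  have hc' := Finset.HasAntidiagonal.mem_antidiagonal.1 hc
  ext b
  change D.divPow i c.1 c.2 (D.grp 0 0 h) * D.divPow i c.2 0 b = 0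
  rw [divPow_apply_grp]
  by_cases h0 : c.1 = 0
  · rw [D.divPow_eq_zero (n := c.2) (by omega)]; simp
  · rw [if_neg h0, zero_mul]

theorem zeta_apply_tmul_one (i : Fin θ) (a : D.A) : D.zeta i (a ⊗ₜ[k] 1) = 0 := by
  rw [zeta_eq, WithConv.ofConv_sum, LinearMap.sum_apply]
  refine Finset.sum_eq_zero fun c hc => ?_
  have hc' := Finset.HasAntidiagonal.mem_antidiagonal.1 hc
  rw [box_tmul, divPow_apply_one]
  by_cases h0 : c.2 = 0
  · rw [D.divPow_eq_zero (n := c.1) (by omega)]; simp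
  · rw [if_neg h0, mul_zero]

theorem evalLeft_x_zeta (i l : Fin θ) : evalLeft (D.x 0 0 i) (D.zeta l) =
    if i = l then D.divPow i (D.N i - 1) 0 else 0 := by
  have h2 := D.two_le_N l
  ext b
  have h1 : ∀ c ∈ Finset.HasAntidiagonal.antidiagonal (D.N l),
      box (D.divPow l c.1 c.2) (D.divPow l c.2 0) (D.x 0 0 i ⊗ₜ[k] b) =
        if (1, D.N l - 1) = c then (if i = l then D.divPow i (D.N i - 1) 0 else 0) b else 0 := by
    rintro ⟨a, n⟩ hc
    have hc' : a + n = D.N l := Finset.HasAntidiagonal.mem_antidiagonal.1 hc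
    rw [box_tmul]
    rcases Nat.lt_or_ge a (D.N l) with ha | ha
    · rw [D.divPow_apply_x l i n ha]
      by_cases h : 1 = a
      · subst h
        have : n = D.N l - 1 := by omega
        subst this
        by_cases hi : i = l
        · subst hi; simp
        · simp [hi]
      · rw [if_neg fun h' => h h'.2.symm, if_neg fun h' => h (Prod.mk.inj h').1, zero_mul]
    · rw [D.divPow_eq_zero ha, if_neg fun h' => by have := (Prod.mk.inj h').1; omega]
      simp
  rw [evalLeft_apply, zeta_eq, WithConv.ofConv_sum, LinearMap.sum_apply, Finset.sum_congr rfl h1,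
    Finset.sum_ite_eq, if_pos (Finset.HasAntidiagonal.mem_antidiagonal.2 (by dsimp only; omega))]

variable {mu : Fin θ → k}

theorem isNilpotent_sum_zeta (hmu : ∀ i, D.χ i ^ D.N i ≠ 1 → mu i = 0) :
    IsNilpotent (∑ i, mu i • D.zeta i) := by
  refine Commute.isNilpotent_sum (fun i _ => ?_) fun i j _ _ => ?_
  · exact IsNilpotent.smul ⟨2, by rw [pow_two, zeta_mul_self]⟩ _
  · by_cases hi : D.χ i ^ D.N i = 1
    · exact ((commute_zeta hi).smul_right _).smul_left _
    · rw [hmu i hi, zero_smul]; exact Commute.zero_left _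

theorem isMulCocycle_rootCocycle [CharZero k] (hmu : ∀ i, D.χ i ^ D.N i ≠ 1 → mu i = 0) :
    IsMulCocycle (D.rootCocycle mu) := by
  have e1 : epsTensor (∑ i, mu i • D.zeta i) = ∑ i, mu i • epsTensor (D.zeta i) := by
    refine (map_sum (epsTensorHom k D.A) _ _).trans (Finset.sum_congr rfl fun i _ => ?_)
    exact map_smul (epsTensorHom k D.A) _ _
  have e2 : tensorEps (∑ i, mu i • D.zeta i) = ∑ i, mu i • tensorEps (D.zeta i) := by
    refine (map_sum (tensorEpsHom k D.A) _ _).trans (Finset.sum_congr rfl fun i _ => ?_)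
    exact map_smul (tensorEpsHom k D.A) _ _
  have e3 : compIdMul (∑ i, mu i • D.zeta i) = ∑ i, mu i • compIdMul (D.zeta i) := by
    refine (map_sum (compIdMulHom k D.A) _ _).trans (Finset.sum_congr rfl fun i _ => ?_)
    exact map_smul (compIdMulHom k D.A) _ _
  have e4 : compMulId (∑ i, mu i • D.zeta i) = ∑ i, mu i • compMulId (D.zeta i) := by
    refine (map_sum (compMulIdHom k D.A) _ _).trans (Finset.sum_congr rfl fun i _ => ?_)
    exact map_smul (compMulIdHom k D.A) _ _
  refine isMulCocycle_nilExp (D.isNilpotent_sum_zeta hmu) ?_ ?_ ?_ (fun a => ?_) fun a => ?_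
  · rw [e1, e2, e3, e4, ← Finset.sum_add_distrib, ← Finset.sum_add_distrib]
    refine Finset.sum_congr rfl fun i _ => ?_
    by_cases hi : D.χ i ^ D.N i = 1
    · rw [← smul_add, ← smul_add, zeta_hochschild hi]
    · simp only [hmu i hi, zero_smul]
  · rw [e1, e3]
    refine Commute.sum_left _ _ _ fun i _ => Commute.sum_right _ _ _ fun j _ => ?_
    by_cases hi : D.χ i ^ D.N i = 1
    · exact ((commute_epsTensor_compIdMul_zeta hi j).smul_right _).smul_left _
    · rw [hmu i hi, zero_smul]; exact Commute.zero_left _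
  · rw [e2, e4]
    refine Commute.sum_left _ _ _ fun i _ => Commute.sum_right _ _ _ fun j _ => ?_
    by_cases hi : D.χ i ^ D.N i = 1
    · exact ((commute_tensorEps_compMulId_zeta hi j).smul_right _).smul_left _
    · rw [hmu i hi, zero_smul]; exact Commute.zero_left _
  · rw [WithConv.ofConv_sum, LinearMap.sum_apply]
    refine Finset.sum_eq_zero fun i _ => ?_
    have h := congrArg (fun f => f a) (D.evalLeft_grp_zeta i 1)
    rw [map_one] at h
    have h' : D.zeta i ((1 : D.A) ⊗ₜ[k] a) = 0 := h
    rw [WithConv.ofConv_smul, LinearMap.smul_apply, h', smul_zero]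
  · rw [WithConv.ofConv_sum, LinearMap.sum_apply]
    refine Finset.sum_eq_zero fun i _ => ?_
    rw [WithConv.ofConv_smul, LinearMap.smul_apply, zeta_apply_tmul_one, smul_zero]

theorem evalLeft_grp_sum_zeta (h : G) : evalLeft (D.grp 0 0 h) (∑ i, mu i • D.zeta i) = 0 := by
  refine (map_sum (pullback k (groupLikeTmul (D.isGroupLikeElem_grp 0 0 h))) _ _).trans
    (Finset.sum_eq_zero fun i _ => ?_)
  refine (map_smul (pullback k (groupLikeTmul (D.isGroupLikeElem_grp 0 0 h))) _ _).trans ?_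
  exact (congrArg (mu i • ·) (D.evalLeft_grp_zeta i h)).trans (smul_zero _)

theorem evalLeft_grp_rootCocycle (hmu : ∀ i, D.χ i ^ D.N i ≠ 1 → mu i = 0) (h : G) :
    evalLeft (D.grp 0 0 h) (D.rootCocycle mu) = 1 :=
  evalLeft_nilExp_of_groupLike (D.isNilpotent_sum_zeta hmu) (D.isGroupLikeElem_grp 0 0 h)
    (D.evalLeft_grp_sum_zeta h)

theorem evalLeft_x_rootCocycle (hmu : ∀ i, D.χ i ^ D.N i ≠ 1 → mu i = 0) (i : Fin θ) :
    evalLeft (D.x 0 0 i) (D.rootCocycle mu) = mu i • D.divPow i (D.N i - 1) 0 := by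
  have h1 : evalLeft 1 (∑ i, mu i • D.zeta i) = 0 := by
    rw [← map_one (D.grp 0 0)]; exact D.evalLeft_grp_sum_zeta 1
  rw [rootCocycle, evalLeft_nilExp_of_skew (D.isNilpotent_sum_zeta hmu) (D.comul_x 0 0 i)
    (D.counit_x 0 0 i) h1 (D.evalLeft_grp_sum_zeta _)]
  ext b
  rw [evalLeft_apply, WithConv.ofConv_sum, LinearMap.sum_apply]
  have h2 : ∀ l, (mu l • D.zeta l) (D.x 0 0 i ⊗ₜ[k] b) =
      if i = l then (mu i • D.divPow i (D.N i - 1) 0) b else 0 := fun l => by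
    have h3 := congrArg (fun f => f b) (D.evalLeft_x_zeta i l)
    rw [evalLeft_apply] at h3
    rw [WithConv.ofConv_smul, LinearMap.smul_apply, h3]
    by_cases hl : i = l
    · subst hl; simp
    · simp [hl]
  rw [Finset.sum_congr rfl fun l _ => h2 l, Finset.sum_ite_eq, if_pos (Finset.mem_univ _)]

end QLSDatum

/-! ### The `q`-exponential -/

section QExpLemmas

variable {k : Type*} [Field k] {B B' : Type*} [Ring B] [Algebra k B] [Ring B'] [Algebra k B']

theorem map_qExp (g : B →ₐ[k] B') (q : k) (f : B) : g (qExp q f) = qExp q (g f) := by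
  simp [qExp]

theorem qExp_zero {q : k} (hq : 0 < orderOf q) : qExp q (0 : B) = 1 := by
  obtain ⟨n, hn⟩ : ∃ n, orderOf q = n + 1 := ⟨orderOf q - 1, by omega⟩
  rw [qExp, hn, Finset.sum_range_succ']
  simp [qFactorial]

theorem Commute.qExp_right {a b : B} (h : Commute a b) (q : k) : Commute a (qExp q b) :=
  Commute.sum_right _ _ _ fun i _ => (h.pow_right i).smul_right _

theorem Commute.qExp_left {a b : B} (h : Commute a b) (q : k) : Commute (qExp q a) b :=
  (h.symm.qExp_right q).symm

theorem isUnit_qExp {q : k} (hq : 0 < orderOf q) {f : B} (hf : IsNilpotent f) :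
    IsUnit (qExp q f) := by
  obtain ⟨n, hn⟩ : ∃ n, orderOf q = n + 1 := ⟨orderOf q - 1, by omega⟩
  rw [qExp, hn, Finset.sum_range_succ', add_comm]
  have h1 : (qFactorial q 0)⁻¹ • f ^ 0 = 1 := by simp [qFactorial]
  rw [h1]
  refine IsNilpotent.isUnit_one_add (Commute.isNilpotent_sum (fun i _ => ?_) fun i j _ _ => ?_)
  · exact (hf.pow_succ i).smul _
  · exact (((Commute.refl f).pow_pow _ _).smul_right _).smul_left _

/-- The functional equation `exp_q(a + b) = exp_q(a) exp_q(b)` for `q`-commuting `a` and `b`. Since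
`exp_q` is a truncated series, the monomials beyond the truncation have to vanish. -/
theorem qExp_add {q : k} {a b : B} (h : b * a = q • (a * b))
    (h0 : ∀ i j, orderOf q ≤ i + j → a ^ i * b ^ j = 0) :
    qExp q (a + b) = qExp q a * qExp q b := by
  set f : ℕ × ℕ → B := fun c =>
    ((qFactorial q c.1)⁻¹ * (qFactorial q c.2)⁻¹) • (a ^ c.1 * b ^ c.2) with hf
  have hr : qExp q a * qExp q b =
      ∑ c ∈ Finset.range (orderOf q) ×ˢ Finset.range (orderOf q), f c := by
    rw [qExp, qExp, Finset.sum_mul_sum, ← Finset.sum_product']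
    exact Finset.sum_congr rfl fun c _ => smul_mul_smul_comm _ _ _ _
  have hl : qExp q (a + b) =
      ∑ n ∈ Finset.range (orderOf q), ∑ c ∈ Finset.HasAntidiagonal.antidiagonal n, f c := by
    refine Finset.sum_congr rfl fun n hn => ?_
    have hn' := Finset.mem_range.1 hn
    rw [add_pow_qcomm h, Finset.Nat.sum_antidiagonal_eq_sum_range_succ_mk, Finset.smul_sum]
    refine Finset.sum_congr rfl fun i hi => ?_
    have hi' : i ≤ n := by have := Finset.mem_range.1 hi; omega
    have hg := gaussBinom_mul q n i (n - i) (by omega)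
    have f1 := qFactorial_ne_zero (IsPrimitiveRoot.orderOf q) (show i < orderOf q by omega)
    have f2 := qFactorial_ne_zero (IsPrimitiveRoot.orderOf q) (show n - i < orderOf q by omega)
    have f3 := qFactorial_ne_zero (IsPrimitiveRoot.orderOf q) hn'
    rw [smul_smul, hf]
    congr 1
    field_simp
    linear_combination hg
  rw [hr, hl, ← Finset.sum_filter_of_ne (p := fun c : ℕ × ℕ => c.1 + c.2 < orderOf q)
    fun c _ hc => by
      by_contra hlt
      exact hc (by rw [hf]; simp only [h0 c.1 c.2 (not_lt.1 hlt), smul_zero]),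
    ← Finset.sum_fiberwise_of_maps_to (s := (Finset.range (orderOf q) ×ˢ
      Finset.range (orderOf q)).filter _) (t := Finset.range (orderOf q))
      (g := fun c => c.1 + c.2) fun c hc => Finset.mem_range.2 (Finset.mem_filter.1 hc).2]
  refine Finset.sum_congr rfl fun n hn => Finset.sum_congr ?_ fun _ _ => rfl
  have hn' := Finset.mem_range.1 hn
  ext ⟨i, j⟩
  simp only [Finset.HasAntidiagonal.mem_antidiagonal, Finset.mem_filter, Finset.mem_product,
    Finset.mem_range]
  omega

/-- `x` and `y` commute up to the factor `r`. -/
def QCommute (r : k) (x y : B) : Prop := x * y = r • (y * x)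

namespace QCommute

variable {r s : k} {x y z : B}

theorem mul_left (h1 : QCommute r x z) (h2 : QCommute s y z) : QCommute (r * s) (x * y) z := by
  rw [QCommute] at *
  rw [mul_assoc, h2, mul_smul_comm, ← mul_assoc, h1, smul_mul_assoc, smul_smul, mul_assoc,
    mul_comm s]

theorem mul_right (h1 : QCommute r x y) (h2 : QCommute s x z) : QCommute (r * s) x (y * z) := by
  rw [QCommute] at *
  rw [← mul_assoc, h1, smul_mul_assoc, mul_assoc, h2, mul_smul_comm, smul_smul, mul_assoc]

theorem symm (h : QCommute r x y) (hr : r ≠ 0) : QCommute r⁻¹ y x := by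
  rw [QCommute] at *
  rw [h, smul_smul, inv_mul_cancel₀ hr, one_smul]

theorem of_commute (h : Commute x y) : QCommute (1 : k) x y := by
  rw [QCommute, one_smul, h.eq]

theorem commute (h : QCommute r x y) (hr : r = 1) : Commute x y := by
  rw [QCommute, hr, one_smul] at h; exact h

theorem mul_pow (h : QCommute r y x) (n : ℕ) : ∃ c : k, (x * y) ^ n = c • (x ^ n * y ^ n) := by
  induction n with
  | zero => exact ⟨1, by simp⟩
  | succ n ih =>
    obtain ⟨c, hc⟩ := ih
    have h1 : ∃ c' : k, y ^ n * x = c' • (x * y ^ n) := by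
      clear hc
      induction n with
      | zero => exact ⟨1, by simp⟩
      | succ n ih =>
        obtain ⟨c', hc'⟩ := ih
        exact ⟨c' * r, by
          rw [pow_succ', mul_assoc, hc', mul_smul_comm, ← mul_assoc, h, smul_mul_assoc, smul_smul,
            mul_assoc]⟩
    obtain ⟨c', hc'⟩ := h1
    exact ⟨c * c', by
      rw [pow_succ, hc, smul_mul_assoc, mul_assoc, ← mul_assoc (y ^ n), hc', smul_mul_assoc,
        mul_smul_comm, smul_smul, mul_assoc, ← pow_succ, ← mul_assoc, ← pow_succ]⟩

end QCommute

end QExpLemmas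

namespace HopfDeformation

open Coalgebra WithConv

variable {k H : Type*} [Field k] [Ring H] [HopfAlgebra k H]

theorem qCommute_box {C C' : Type*} [AddCommGroup C] [Module k C] [Coalgebra k C]
    [AddCommGroup C'] [Module k C'] [Coalgebra k C'] {r s : k} {φ φ' : WithConv (C →ₗ[k] k)}
    {ψ ψ' : WithConv (C' →ₗ[k] k)} (h1 : QCommute r φ φ') (h2 : QCommute s ψ ψ') :
    QCommute (r * s) (box φ ψ) (box φ' ψ') := by
  rw [QCommute] at *
  rw [box_mul_box, box_mul_box, h1, h2, smul_box, box_smul, smul_smul]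

theorem box_commute_box {C C' : Type*} [AddCommGroup C] [Module k C] [Coalgebra k C]
    [AddCommGroup C'] [Module k C'] [Coalgebra k C'] {φ φ' : WithConv (C →ₗ[k] k)}
    {ψ ψ' : WithConv (C' →ₗ[k] k)} (h1 : Commute φ φ') (h2 : Commute ψ ψ') :
    Commute (box φ ψ) (box φ' ψ') := by
  rw [Commute, SemiconjBy, box_mul_box, box_mul_box, h1.eq, h2.eq]

/-! ### Products of cocycles and `q`-exponentials -/

theorem IsMulCocycle.mul {σ τ : WithConv (H ⊗[k] H →ₗ[k] k)} (hσ : IsMulCocycle σ)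
    (hτ : IsMulCocycle τ) (c1 : Commute (epsTensor τ) (compIdMul σ))
    (c2 : Commute (tensorEps τ) (compMulId σ)) : IsMulCocycle (σ * τ) where
  isUnit := hσ.isUnit.mul hτ.isUnit
  cocycle := by
    have m1 : epsTensor (σ * τ) = epsTensor σ * epsTensor τ := map_mul (epsTensorHom k H) _ _
    have m2 : tensorEps (σ * τ) = tensorEps σ * tensorEps τ := map_mul (tensorEpsHom k H) _ _
    have m3 : compIdMul (σ * τ) = compIdMul σ * compIdMul τ := map_mul (compIdMulHom k H) _ _
    have m4 : compMulId (σ * τ) = compMulId σ * compMulId τ := map_mul (compMulIdHom k H) _ _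
    rw [m1, m2, m3, m4]
    calc epsTensor σ * epsTensor τ * (compIdMul σ * compIdMul τ)
        = epsTensor σ * (epsTensor τ * compIdMul σ) * compIdMul τ := by simp only [mul_assoc]
      _ = (epsTensor σ * compIdMul σ) * (epsTensor τ * compIdMul τ) := by
          rw [c1.eq]; simp only [mul_assoc]
      _ = (tensorEps σ * compMulId σ) * (tensorEps τ * compMulId τ) := by
          rw [hσ.cocycle, hτ.cocycle]
      _ = tensorEps σ * (tensorEps τ * compMulId σ) * compMulId τ := by
          rw [c2.eq]; simp only [mul_assoc]
      _ = _ := by simp only [mul_assoc]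
  one_left a := by
    have h1 := map_mul (HopfDeformation.pullback k (groupLikeTmul (k := k) (H := H) isGroupLikeElem_one)) σ τ
    have h2 : HopfDeformation.pullback k
        (groupLikeTmul (k := k) (H := H) isGroupLikeElem_one) σ = 1 :=
      WithConv.ext (LinearMap.ext hσ.one_left)
    have h3 : HopfDeformation.pullback k
        (groupLikeTmul (k := k) (H := H) isGroupLikeElem_one) τ = 1 :=
      WithConv.ext (LinearMap.ext hτ.one_left)
    rw [h2, h3, mul_one] at h1
    exact congrArg (fun f => f a) h1
  one_right a := by
    have h1 := map_mul (HopfDeformation.pullback k (tmulGroupLike (k := k) (H := H) isGroupLikeElem_one)) σ τ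
    have h2 : HopfDeformation.pullback k
        (tmulGroupLike (k := k) (H := H) isGroupLikeElem_one) σ = 1 :=
      WithConv.ext (LinearMap.ext hσ.one_right)
    have h3 : HopfDeformation.pullback k
        (tmulGroupLike (k := k) (H := H) isGroupLikeElem_one) τ = 1 :=
      WithConv.ext (LinearMap.ext hτ.one_right)
    rw [h2, h3, mul_one] at h1
    exact congrArg (fun f => f a) h1

theorem IsMulCocycle.list_prod {ι : Type*} {s : ι → WithConv (H ⊗[k] H →ₗ[k] k)} {l : List ι}
    (h : ∀ p ∈ l, IsMulCocycle (s p))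
    (hl : l.Pairwise fun p p' => Commute (epsTensor (s p')) (compIdMul (s p)) ∧
      Commute (tensorEps (s p')) (compMulId (s p))) : IsMulCocycle (l.map s).prod := by
  induction l with
  | nil => exact isMulCocycle_one
  | cons p l ih =>
    obtain ⟨h1, h2⟩ := List.pairwise_cons.1 hl
    rw [List.map_cons, List.prod_cons]
    refine (h p List.mem_cons_self).mul (ih (fun p' hp' => h p' (List.mem_cons_of_mem _ hp')) h2)
      ?_ ?_
    · have e : epsTensor (l.map s).prod = ((l.map s).map (epsTensorHom k H)).prod :=
        map_list_prod (epsTensorHom k H) _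
      rw [e]
      refine Commute.list_prod_left _ _ fun y hy => ?_
      simp only [List.map_map, List.mem_map] at hy
      obtain ⟨p', hp', rfl⟩ := hy
      exact (h1 p' hp').1
    · have e : tensorEps (l.map s).prod = ((l.map s).map (tensorEpsHom k H)).prod :=
        map_list_prod (tensorEpsHom k H) _
      rw [e]
      refine Commute.list_prod_left _ _ fun y hy => ?_
      simp only [List.map_map, List.mem_map] at hy
      obtain ⟨p', hp', rfl⟩ := hy
      exact (h1 p' hp').2

/-- The `q`-exponential of a Hochschild cocycle `f` is a multiplicative cocycle if `f(1 ⊗ m)` and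
`f(m ⊗ 1)` are the sums of `f ⊗ ε`, resp. `ε ⊗ f`, and one and the same `q`-commuting term `w`. -/
theorem isMulCocycle_qExp {q : k} (hq : 0 < orderOf q) {f : WithConv (H ⊗[k] H →ₗ[k] k)}
    {w : WithConv (H ⊗[k] (H ⊗[k] H) →ₗ[k] k)} (hf : IsNilpotent f)
    (h1 : compIdMul f = tensorEps f + w) (h2 : compMulId f = epsTensor f + w)
    (q1 : QCommute q w (tensorEps f)) (q2 : QCommute q w (epsTensor f))
    (z1 : ∀ i j, orderOf q ≤ i + j → tensorEps f ^ i * w ^ j = 0)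
    (z2 : ∀ i j, orderOf q ≤ i + j → epsTensor f ^ i * w ^ j = 0)
    (hc : Commute (epsTensor f) (tensorEps f))
    (hl : ∀ a : H, f ((1 : H) ⊗ₜ[k] a) = 0) (hr : ∀ a : H, f (a ⊗ₜ[k] (1 : H)) = 0) :
    IsMulCocycle (qExp q f) where
  isUnit := isUnit_qExp hq hf
  cocycle := by
    have e1 : epsTensor (qExp q f) = qExp q (epsTensor f) := map_qExp (epsTensorHom k H) q f
    have e2 : tensorEps (qExp q f) = qExp q (tensorEps f) := map_qExp (tensorEpsHom k H) q f
    have e3 : compIdMul (qExp q f) = qExp q (compIdMul f) := map_qExp (compIdMulHom k H) q f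
    have e4 : compMulId (qExp q f) = qExp q (compMulId f) := map_qExp (compMulIdHom k H) q f
    rw [e1, e2, e3, e4, h1, h2, qExp_add q1 z1, qExp_add q2 z2, ← mul_assoc, ← mul_assoc,
      ((hc.qExp_right q).qExp_left q).eq]
  one_left a := by
    have h1 := map_qExp (pullback k (groupLikeTmul (k := k) (H := H) isGroupLikeElem_one)) q f
    have h2 : pullback k (groupLikeTmul (k := k) (H := H) isGroupLikeElem_one) f = 0 :=
      WithConv.ext (LinearMap.ext hl)
    rw [h2, qExp_zero hq] at h1
    exact congrArg (fun f => f a) h1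
  one_right a := by
    have h1 := map_qExp (pullback k (tmulGroupLike (k := k) (H := H) isGroupLikeElem_one)) q f
    have h2 : pullback k (tmulGroupLike (k := k) (H := H) isGroupLikeElem_one) f = 0 :=
      WithConv.ext (LinearMap.ext hr)
    rw [h2, qExp_zero hq] at h1
    exact congrArg (fun f => f a) h1

theorem evalLeft_qExp_of_groupLike {q : k} (hq : 0 < orderOf q)
    {f : WithConv (H ⊗[k] H →ₗ[k] k)} {g : H}
    (hg : IsGroupLikeElem k g) (h : evalLeft g f = 0) : evalLeft g (qExp q f) = 1 := by
  have h1 := map_qExp (pullback k (groupLikeTmul (k := k) (H := H) hg)) q f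
  have h2 : pullback k (groupLikeTmul (k := k) (H := H) hg) f = 0 := h
  rw [h2, qExp_zero hq] at h1
  exact h1

theorem evalLeft_qExp_of_skew {q : k} (hq : 2 ≤ orderOf q) {f : WithConv (H ⊗[k] H →ₗ[k] k)}
    {x g : H} (hx : comul (R := k) x = x ⊗ₜ[k] 1 + g ⊗ₜ[k] x) (hx0 : counit (R := k) x = 0)
    (h1 : evalLeft 1 f = 0) (hg : evalLeft g f = 0) :
    evalLeft x (qExp q f) = evalLeft x f := by
  have hE : ∀ n, evalLeft x (f ^ (n + 2)) = 0 := fun n => by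
    have h0 : evalLeft 1 (f ^ (n + 1)) = 0 := by
      rw [pow_succ, evalLeft_mul_of_groupLike isGroupLikeElem_one, h1, mul_zero]
    rw [pow_succ', evalLeft_mul_of_skew hx, h0, hg, mul_zero, zero_mul, add_zero]
  obtain ⟨n, hn⟩ : ∃ n, orderOf q = n + 2 := ⟨orderOf q - 2, by omega⟩
  ext b
  have h3 : ∀ w, (∑ i ∈ Finset.range (n + 2), (qFactorial q i)⁻¹ • f ^ i) w =
      ∑ i ∈ Finset.range (n + 2), (qFactorial q i)⁻¹ * (f ^ i) w := fun w => by
    rw [WithConv.ofConv_sum, LinearMap.sum_apply]; rfl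
  rw [qExp, hn, evalLeft_apply, h3, Finset.sum_range_succ', Finset.sum_range_succ',
    Finset.sum_eq_zero fun i _ => ?_]
  · simp [hx0, qFactorial, qNumber]
  · have := congrArg (fun f => f b) (hE i)
    rw [evalLeft_apply] at this
    rw [this]; simp

end HopfDeformation

namespace QLSDatum

open Coalgebra WithConv HopfDeformation

variable {k G : Type*} [Field k] [CommGroup G] {θ : ℕ} (D : QLSDatum k G θ) [Finite G]

/-! ### Linked pairs -/

variable {D} in
theorem χ_mul_χ_of_linked {i j : Fin θ} (h : D.χ i * D.χ j = 1) (g : G) :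
    (D.χ i g : k) * D.χ j g = 1 := by
  rw [← Units.val_mul, ← MonoidHom.mul_apply, h]; simp

variable {D} in
theorem linked_symm {i j : Fin θ} (h : D.χ i * D.χ j = 1) : D.χ j * D.χ i = 1 := by
  rw [← h]
  ext g
  rw [MonoidHom.mul_apply, MonoidHom.mul_apply, mul_comm]

variable {D} in
theorem χ_eq_of_linked {i j : Fin θ} (hij : i ≠ j) (h : D.χ i * D.χ j = 1) :
    (D.χ j (D.g i) : k) = D.χ j (D.g j) := by
  have h1 := χ_mul_χ_of_linked h (D.g j)
  have h2 := D.braiding' hij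
  have h3 : (D.χ i (D.g j) : k) ≠ 0 := Units.ne_zero _
  exact mul_left_cancel₀ h3 (h2.trans h1.symm)

variable {D} in
theorem N_eq_of_linked {i j : Fin θ} (h : D.χ i * D.χ j = 1) :
    D.N i = orderOf (D.χ j (D.g i) : k) := by
  have h1 : D.χ i (D.g i) = (D.χ j (D.g i))⁻¹ :=
    eq_inv_of_mul_eq_one_left (by rw [← MonoidHom.mul_apply, h]; rfl)
  rw [N, h1, orderOf_inv, orderOf_units]

variable {D} in
/-- If two different vertices `a`, `b` are both linked to `c`, then `χ_c(g_c) = -1`. -/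
theorem sq_eq_one_of_linked_linked {a b c : Fin θ} (hab : a ≠ b) (hac : a ≠ c) (hbc : b ≠ c)
    (h1 : D.χ a * D.χ c = 1) (h2 : D.χ b * D.χ c = 1) : (D.χ c (D.g c) : k) ^ 2 = 1 := by
  have e1 := D.braiding' hab
  have e2 := χ_mul_χ_of_linked h1 (D.g b)
  have e3 := χ_mul_χ_of_linked h2 (D.g a)
  rw [χ_eq_of_linked hac h1] at e3
  rw [χ_eq_of_linked hbc h2] at e2
  have h0 : (D.χ c (D.g c) : k) ^ 2 = ((D.χ a (D.g b) : k) * (D.χ c (D.g c))) *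
      ((D.χ b (D.g a) : k) * D.χ c (D.g c)) := by
    linear_combination -(D.χ c (D.g c) : k) ^ 2 * e1
  rw [h0, e2, e3, one_mul]

theorem der_sq_eq_zero {c : Fin θ} (h : (D.χ c (D.g c) : k) ^ 2 = 1) : D.der c * D.der c = 0 := by
  rw [← pow_two]
  refine D.der_pow_eq_zero ?_
  rw [N, ← orderOf_units]
  exact orderOf_le_of_pow_eq_one two_pos h

/-! ### The Hochschild cocycles `η_{i,j}` -/

/-- The functional `dᵢ * χⱼ`. -/
def derChr (i j : Fin θ) : WithConv (D.A →ₗ[k] k) := D.der i * D.chr j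

theorem eta_eq (i j : Fin θ) : D.eta i j = box (D.derChr i j) (D.der j) := by
  rw [derChr, ← skewDer_eq, ← chiExt_eq, ← skewDer_eq]; rfl

theorem qCommute_chr_der (l i : Fin θ) : QCommute (D.χ l (D.g i) : k) (D.chr l) (D.der i) :=
  D.chr_mul_der l i

theorem qCommute_chr_chr (l i : Fin θ) : QCommute (1 : k) (D.chr l) (D.chr i) :=
  QCommute.of_commute (D.chr_mul_chr l i)

theorem qCommute_der_chr (i l : Fin θ) : QCommute (D.χ l (D.g i) : k)⁻¹ (D.der i) (D.chr l) :=
  (D.qCommute_chr_der l i).symm (Units.ne_zero _)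

theorem qCommute_der_der {l i : Fin θ} (hli : l ≠ i) :
    QCommute (D.χ l (D.g i) : k) (D.der l) (D.der i) := D.der_mul_der hli

theorem qCommute_chr_derChr (l i j : Fin θ) :
    QCommute (D.χ l (D.g i) : k) (D.chr l) (D.derChr i j) := by
  simpa [derChr] using (D.qCommute_chr_der l i).mul_right (D.qCommute_chr_chr l j)

variable {D} in
theorem commute_derChr_der {i j l : Fin θ} (h : D.χ i * D.χ j = 1)
    (hl : l = i → D.der i * D.der i = 0) : Commute (D.derChr i j) (D.der l) := by
  by_cases hli : l = i
  · have h0 := hl hli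
    subst hli
    rw [Commute, SemiconjBy, derChr, ← mul_assoc, h0, zero_mul, mul_assoc, D.chr_mul_der,
      mul_smul_comm, ← mul_assoc, h0, zero_mul, smul_zero]
  · exact ((D.qCommute_der_der (Ne.symm hli)).mul_left (D.qCommute_chr_der j l)).commute
      (χ_mul_χ_of_linked h _)

variable {D} in
theorem qCommute_derChr_derChr {i j a b : Fin θ} (h : D.χ i * D.χ j = 1) (hia : i ≠ a) :
    QCommute (D.χ b (D.g i) : k)⁻¹ (D.derChr i j) (D.derChr a b) := by
  have h1 := (D.qCommute_der_der hia).mul_left (D.qCommute_chr_der j a)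
  rw [χ_mul_χ_of_linked h] at h1
  have h2 := (D.qCommute_der_chr i b).mul_left (D.qCommute_chr_chr j b)
  rw [mul_one] at h2
  simpa [derChr] using h1.mul_right h2

theorem derChr_apply_grp (i j : Fin θ) (h : G) : D.derChr i j (D.grp 0 0 h) = 0 := by
  rw [derChr, LinearMap.convMul_apply, comul_grp]; simp

theorem derChr_apply_x (i j l : Fin θ) : D.derChr i j (D.x 0 0 l) = if l = i then 1 else 0 := by
  rw [derChr, LinearMap.convMul_apply, comul_x]; simp

theorem derChr_pow_N (i j : Fin θ) {n : ℕ} (hn : D.N i ≤ n) : D.derChr i j ^ n = 0 := by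
  obtain ⟨c, hc⟩ := (D.qCommute_chr_der j i).mul_pow n
  rw [derChr, hc, D.der_pow_eq_zero hn, zero_mul, smul_zero]

theorem evalLeft_grp_eta (i j : Fin θ) (h : G) : evalLeft (D.grp 0 0 h) (D.eta i j) = 0 := by
  ext b
  rw [evalLeft_apply, eta_eq, box_tmul, derChr_apply_grp, zero_mul]; rfl

theorem evalLeft_x_eta (i j l : Fin θ) :
    evalLeft (D.x 0 0 l) (D.eta i j) = if l = i then D.der j else 0 := by
  ext b
  rw [evalLeft_apply, eta_eq, box_tmul, derChr_apply_x]
  by_cases hl : l = i <;> simp [hl]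

/-- The part common to `η_{i,j}(1 ⊗ m)` and `η_{i,j}(m ⊗ 1)`. -/
def etaMid (i j : Fin θ) : WithConv (D.A ⊗[k] (D.A ⊗[k] D.A) →ₗ[k] k) :=
  box (D.derChr i j) (box (D.chr j) (D.der j))

theorem compIdMul_eta (i j : Fin θ) :
    compIdMul (D.eta i j) = tensorEps (D.eta i j) + D.etaMid i j := by
  rw [eta_eq, compIdMul_box, dualComul_der, box_add, tensorEps_box, etaMid]

variable {D} in
/-- Here `χᵢ χⱼ = ε` is used, to turn `χᵢ * χⱼ` into the unit. -/
theorem compMulId_eta {i j : Fin θ} (h : D.χ i * D.χ j = 1) :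
    compMulId (D.eta i j) = epsTensor (D.eta i j) + D.etaMid i j := by
  have hc : D.chr i * D.chr j = 1 := by
    rw [← sub_eq_zero]
    refine D.eq_zero_of_translate (fun _ => 1) (fun g => ?_) (fun l => ?_) ?_
    · simp [translate_grp_mul, smul_smul, mul_comm (D.χ j g : k), χ_mul_χ_of_linked h]
    · simp [translate_x_mul]
    · rw [WithConv.ofConv_sub, LinearMap.sub_apply, conv_apply_one]; simp
  rw [eta_eq, compMulId_box, epsTensor_box, etaMid, derChr, map_mul, dualComul_der, dualComul_chr,
    add_mul, box_mul_box, box_mul_box, hc, one_mul, add_box, map_add, pullback_assocSymm_box,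
    pullback_assocSymm_box, add_comm]

theorem box_pow_mul_box_pow_zero_left {C C' : Type*} [AddCommGroup C] [Module k C] [Coalgebra k C]
    [AddCommGroup C'] [Module k C'] [Coalgebra k C'] {φ φ' : WithConv (C →ₗ[k] k)}
    {ψ ψ' : WithConv (C' →ₗ[k] k)} {i j : ℕ} (h : φ ^ i * φ' ^ j = 0) :
    box φ ψ ^ i * box φ' ψ' ^ j = 0 := by
  rw [box_pow, box_pow, box_mul_box, h]
  exact conv_ext_tmul fun a b => by simp

theorem box_pow_mul_box_pow_zero_right {C C' : Type*} [AddCommGroup C] [Module k C] [Coalgebra k C]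
    [AddCommGroup C'] [Module k C'] [Coalgebra k C'] {φ φ' : WithConv (C →ₗ[k] k)}
    {ψ ψ' : WithConv (C' →ₗ[k] k)} {i j : ℕ} (h : ψ ^ i * ψ' ^ j = 0) :
    box φ ψ ^ i * box φ' ψ' ^ j = 0 := by
  rw [box_pow, box_pow, box_mul_box, h]
  exact conv_ext_tmul fun a b => by simp

theorem orderOf_χ_pos (j : Fin θ) (g : G) : 0 < orderOf (D.χ j g : k) := by
  rw [orderOf_units]
  exact ((D.χ j).isOfFinOrder (isOfFinOrder_of_finite g)).orderOf_pos

/-- The factor of the linking cocycle that belongs to the pair `p`. -/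
def linkFactor (lam : Fin θ → Fin θ → k) (p : Fin θ × Fin θ) :
    WithConv (D.A ⊗[k] D.A →ₗ[k] k) :=
  qExp (D.χ p.2 (D.g p.1) : k) (lam p.1 p.2 • D.eta p.1 p.2)

theorem linkFactor_eq_one {lam : Fin θ → Fin θ → k} {p : Fin θ × Fin θ} (h : lam p.1 p.2 = 0) :
    D.linkFactor lam p = 1 := by
  rw [linkFactor, h, zero_smul, qExp_zero (D.orderOf_χ_pos _ _)]

theorem isMulCocycle_linkFactor {lam : Fin θ → Fin θ → k} {i j : Fin θ} (hij : i ≠ j)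
    (h : D.χ i * D.χ j = 1) : IsMulCocycle (D.linkFactor lam (i, j)) := by
  set r := lam i j with hr
  -- the order of `q` is `Nᵢ = Nⱼ`, so the powers beyond the truncation of `exp_q` vanish
  set q := (D.χ j (D.g i) : k) with hq
  have hN : D.N i = orderOf q := N_eq_of_linked h
  have hN' : D.N j = orderOf q := by
    rw [N, hq, χ_eq_of_linked hij h, orderOf_units]
  have hd : Commute (D.derChr i j) (D.der j) :=
    commute_derChr_der h fun h' => absurd h'.symm hij
  have e1 : epsTensor (r • D.eta i j) = r • epsTensor (D.eta i j) :=
    map_smul (epsTensorHom k D.A) _ _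
  have e2 : tensorEps (r • D.eta i j) = r • tensorEps (D.eta i j) :=
    map_smul (tensorEpsHom k D.A) _ _
  have e3 : compIdMul (r • D.eta i j) = r • compIdMul (D.eta i j) :=
    map_smul (compIdMulHom k D.A) _ _
  have e4 : compMulId (r • D.eta i j) = r • compMulId (D.eta i j) :=
    map_smul (compMulIdHom k D.A) _ _
  have smulQ : ∀ {x y : WithConv (D.A ⊗[k] (D.A ⊗[k] D.A) →ₗ[k] k)}, QCommute q x y →
      QCommute q (r • x) (r • y) := fun {x y} hxy => by
    rw [QCommute] at *
    rw [smul_mul_smul_comm, smul_mul_smul_comm, hxy, smul_comm]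
  have q1 : QCommute q (D.etaMid i j) (tensorEps (D.eta i j)) := by
    have h1 := qCommute_box (QCommute.of_commute (Commute.refl (D.derChr i j)))
      (qCommute_box (D.qCommute_chr_der j j) (QCommute.of_commute (k := k)
        (Commute.one_right (D.der j))))
    rw [mul_one, one_mul, ← χ_eq_of_linked hij h] at h1
    rw [eta_eq, tensorEps_box]
    exact h1
  have q2 : QCommute q (D.etaMid i j) (epsTensor (D.eta i j)) := by
    have h1 := qCommute_box (QCommute.of_commute (Commute.one_right (D.derChr i j)))
      (qCommute_box (D.qCommute_chr_derChr j i j) (QCommute.of_commute (k := k)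
        (Commute.refl (D.der j))))
    rw [mul_one, one_mul] at h1
    rw [eta_eq, epsTensor_box]
    exact h1
  refine isMulCocycle_qExp (w := r • D.etaMid i j) (D.orderOf_χ_pos _ _) ?_ ?_ ?_ ?_ ?_ ?_ ?_ ?_
    (fun a => ?_) fun a => ?_
  · refine IsNilpotent.smul ⟨D.N i, ?_⟩ _
    rw [eta_eq, box_pow, D.derChr_pow_N i j le_rfl]
    exact conv_ext_tmul fun a b => by simp
  · rw [e3, e2, compIdMul_eta, smul_add]
  · rw [e4, e1, compMulId_eta h, smul_add]
  · rw [e2]; exact smulQ q1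
  · rw [e1]; exact smulQ q2
  · intro m n hmn
    rw [e2, smul_pow, smul_pow, smul_mul_smul_comm, eta_eq, tensorEps_box, etaMid,
      box_pow_mul_box_pow_zero_left (by rw [← pow_add, D.derChr_pow_N i j (hN.le.trans hmn)]),
      smul_zero]
  · intro m n hmn
    rw [e1, smul_pow, smul_pow, smul_mul_smul_comm, eta_eq, epsTensor_box, etaMid,
      box_pow_mul_box_pow_zero_right (box_pow_mul_box_pow_zero_right
        (by rw [← pow_add, D.der_pow_eq_zero (hN'.le.trans hmn)])), smul_zero]
  · rw [e1, e2]
    refine (Commute.smul_right ?_ _).smul_left _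
    rw [eta_eq, epsTensor_box, tensorEps_box, Commute, SemiconjBy, box_mul_box, box_mul_box,
      box_mul_box, box_mul_box, hd.eq, one_mul, one_mul, mul_one, mul_one]
  · have h1 := congrArg (fun f => f a) (D.evalLeft_grp_eta i j 1)
    rw [map_one] at h1
    have h2 : D.eta i j ((1 : D.A) ⊗ₜ[k] a) = 0 := h1
    rw [WithConv.ofConv_smul, LinearMap.smul_apply, h2, smul_zero]
  · rw [WithConv.ofConv_smul, LinearMap.smul_apply, eta_eq, box_tmul, der_one, mul_zero, smul_zero]

section TwoPairs

variable {D} {i j a b : Fin θ}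

theorem der_sq_of_shared {c d e : Fin θ} (hc : d ≠ e) (hdc : d ≠ c) (hec : e ≠ c)
    (h1 : D.χ d * D.χ c = 1) (h2 : D.χ e * D.χ c = 1) : D.der c * D.der c = 0 :=
  D.der_sq_eq_zero (sq_eq_one_of_linked_linked hc hdc hec h1 h2)

/-- In the exceptional case `j = a`, the vertex `j` is linked to both `i` and `b`, so `dⱼ² = 0`. -/
theorem commute_derChr_der_of_pairs (hij : i < j) (hab : a < b)
    (h : D.χ i * D.χ j = 1) (h' : D.χ a * D.χ b = 1) : Commute (D.derChr a b) (D.der j) := by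
  refine commute_derChr_der h' fun hja => ?_
  subst hja
  exact der_sq_of_shared (hij.trans hab).ne hij.ne hab.ne' h (linked_symm h')

/-- If the two pairs share a vertex, that vertex `c` is linked to two others, so that `dⱼ² = 0`
(for `j = b`) or the factors of commutation are fixed by `χ_c(g_c)² = 1`. -/
theorem commute_box_chr_der (hij : i < j) (hab : a < b) (hne : (i, j) ≠ (a, b))
    (h : D.χ i * D.χ j = 1) (h' : D.χ a * D.χ b = 1) :
    Commute (box (D.derChr a b) (D.der b)) (box (D.chr j) (D.der j)) := by
  by_cases hjb : j = b
  · subst hjb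
    have hia : i ≠ a := fun e => hne (by rw [e])
    rw [Commute, SemiconjBy, box_mul_box, box_mul_box, der_sq_of_shared hia hij.ne hab.ne h h']
    exact conv_ext_tmul fun a b => by simp
  · refine ((qCommute_box (D.qCommute_chr_derChr j a b) (D.qCommute_der_der hjb)).commute ?_).symm
    have h1 := D.braiding' hjb
    by_cases hja : j = a
    · subst hja
      have h2 := sq_eq_one_of_linked_linked (hij.trans hab).ne hij.ne hab.ne' h
        (linked_symm h')
      have h3 := χ_mul_χ_of_linked h' (D.g j)
      have h4 : (D.χ b (D.g j) : k) ≠ 0 := Units.ne_zero _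
      rw [mul_right_cancel₀ h4 (h1.trans h3.symm)]
      linear_combination h2
    · have h2 := D.braiding' hja
      have h3 := χ_mul_χ_of_linked h' (D.g j)
      have h4 : (D.χ b (D.g j) : k) ≠ 0 := Units.ne_zero _
      have h5 : (D.χ a (D.g j) : k) ≠ 0 := Units.ne_zero _
      refine mul_right_cancel₀ (mul_ne_zero h5 h4) ?_
      linear_combination (D.χ j (D.g b) : k) * D.χ b (D.g j) * h2 + h1 - h3

theorem commute_box_derChr_chr (hij : i < j) (hab : a < b) (hne : (i, j) ≠ (a, b))
    (h : D.χ i * D.χ j = 1) (h' : D.χ a * D.χ b = 1) :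
    Commute (box (D.derChr a b) (D.der b)) (box (D.derChr i j) (D.chr j)) := by
  by_cases hia : i = a
  · subst hia
    have hjb : j ≠ b := fun e => hne (by rw [e])
    have h0 := der_sq_of_shared (c := i) hjb hij.ne' hab.ne' (linked_symm h)
      (linked_symm h')
    have h1 : ∀ c e, D.derChr i c * D.derChr i e = 0 := fun c e => by
      rw [derChr, derChr, mul_assoc, ← mul_assoc (D.chr c), D.chr_mul_der, smul_mul_assoc,
        mul_smul_comm, mul_assoc, ← mul_assoc, h0, zero_mul, smul_zero]
    rw [Commute, SemiconjBy, box_mul_box, box_mul_box, h1, h1]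
    exact conv_ext_tmul fun a b => by simp
  · refine ((qCommute_box (qCommute_derChr_derChr h hia) (D.qCommute_chr_der j b)).commute ?_).symm
    rw [inv_mul_eq_one₀ (Units.ne_zero _)]
    by_cases hbj : b = j
    · subst hbj; exact χ_eq_of_linked hij.ne h
    · have h1 := D.braiding' hbj
      have h3 : (D.χ b (D.g j) : k) ≠ 0 := Units.ne_zero _
      have h4 := χ_mul_χ_of_linked h (D.g b)
      have h5 : (D.χ i (D.g b) : k) ≠ 0 := Units.ne_zero _
      by_cases hbi : b = i
      · subst hbi
        have h2 := sq_eq_one_of_linked_linked (c := b) (fun e => by omega) hij.ne' hab.ne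
          (linked_symm h) h'
        refine mul_left_cancel₀ h5 ?_
        linear_combination h2 - h4
      · have h2 := D.braiding' hbi
        refine mul_left_cancel₀ h5 ?_
        linear_combination h2 - h4

end TwoPairs

end QLSDatum

namespace QLSDatum

open Coalgebra WithConv HopfDeformation

variable {k G : Type*} [Field k] [CommGroup G] {θ : ℕ} (D : QLSDatum k G θ) [Finite G]

/-! ### The linking cocycle -/

variable {lam : Fin θ → Fin θ → k}

section TwoPairs

variable {D} {i j a b : Fin θ}

theorem commute_epsTensor_compIdMul_eta (hij : i < j) (hab : a < b) (hne : (i, j) ≠ (a, b))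
    (h : D.χ i * D.χ j = 1) (h' : D.χ a * D.χ b = 1) :
    Commute (epsTensor (D.eta a b)) (compIdMul (D.eta i j)) := by
  rw [compIdMul_eta, eta_eq, eta_eq, epsTensor_box, tensorEps_box, etaMid]
  have h1 : Commute (box (D.derChr a b) (D.der b)) (box (D.der j) 1) :=
    box_commute_box (commute_derChr_der_of_pairs hij hab h h') (Commute.one_right (D.der b))
  have h2 := commute_box_chr_der hij hab hne h h'
  refine Commute.add_right ?_ ?_
  · exact box_commute_box (Commute.one_left (D.derChr i j)) h1
  · exact box_commute_box (Commute.one_left (D.derChr i j)) h2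

theorem commute_tensorEps_compMulId_eta (hij : i < j) (hab : a < b) (hne : (i, j) ≠ (a, b))
    (h : D.χ i * D.χ j = 1) (h' : D.χ a * D.χ b = 1) :
    Commute (tensorEps (D.eta a b)) (compMulId (D.eta i j)) := by
  have e : D.etaMid i j =
      pullback k (assocSymm k D.A) (box (box (D.derChr i j) (D.chr j)) (D.der j)) := by
    rw [pullback_assocSymm_box, etaMid]
  rw [compMulId_eta h]
  refine Commute.add_right ?_ ?_
  · rw [eta_eq, eta_eq, tensorEps_box, epsTensor_box]
    have h1 : Commute (box (D.der b) 1) (box (D.derChr i j) (D.der j)) :=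
      box_commute_box (commute_derChr_der_of_pairs hab hij h' h).symm (Commute.one_left (D.der j))
    exact box_commute_box (Commute.one_right (D.derChr a b)) h1
  · rw [e, tensorEps_eq, boxOne_apply, eta_eq]
    have h1 := commute_box_derChr_chr hij hab hne h h'
    have h2 := box_commute_box h1 (Commute.one_left (D.der j))
    exact h2.map _

end TwoPairs

theorem epsTensor_linkFactor (p : Fin θ × Fin θ) : epsTensor (D.linkFactor lam p) =
    qExp (D.χ p.2 (D.g p.1) : k) (lam p.1 p.2 • epsTensor (D.eta p.1 p.2)) := by
  refine (map_qExp (epsTensorHom k D.A) _ _).trans ?_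
  rw [map_smul]; rfl

theorem tensorEps_linkFactor (p : Fin θ × Fin θ) : tensorEps (D.linkFactor lam p) =
    qExp (D.χ p.2 (D.g p.1) : k) (lam p.1 p.2 • tensorEps (D.eta p.1 p.2)) := by
  refine (map_qExp (tensorEpsHom k D.A) _ _).trans ?_
  rw [map_smul]; rfl

theorem compIdMul_linkFactor (p : Fin θ × Fin θ) : compIdMul (D.linkFactor lam p) =
    qExp (D.χ p.2 (D.g p.1) : k) (lam p.1 p.2 • compIdMul (D.eta p.1 p.2)) := by
  refine (map_qExp (compIdMulHom k D.A) _ _).trans ?_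
  rw [map_smul]; rfl

theorem compMulId_linkFactor (p : Fin θ × Fin θ) : compMulId (D.linkFactor lam p) =
    qExp (D.χ p.2 (D.g p.1) : k) (lam p.1 p.2 • compMulId (D.eta p.1 p.2)) := by
  refine (map_qExp (compMulIdHom k D.A) _ _).trans ?_
  rw [map_smul]; rfl

theorem linkCocycle_eq : D.linkCocycle lam = ((pairs θ).map (D.linkFactor lam)).prod := rfl

theorem mem_pairs {p : Fin θ × Fin θ} : p ∈ pairs θ ↔ p.1 < p.2 := by
  obtain ⟨i, j⟩ := p
  rw [pairs, List.mem_filter, List.mem_product]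
  simp

theorem nodup_pairs : (pairs θ).Nodup :=
  ((List.nodup_finRange θ).product (List.nodup_finRange θ)).filter _

variable {D} in
theorem isMulCocycle_linkCocycle (hlam : ∀ i j, i < j → D.χ i * D.χ j ≠ 1 → lam i j = 0) :
    IsMulCocycle (D.linkCocycle lam) := by
  rw [linkCocycle_eq]
  refine IsMulCocycle.list_prod (fun p hp => ?_) ?_
  · have hp' := mem_pairs.1 hp
    by_cases h : D.χ p.1 * D.χ p.2 = 1
    · exact D.isMulCocycle_linkFactor hp'.ne h
    · rw [D.linkFactor_eq_one (hlam _ _ hp' h)]; exact isMulCocycle_one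
  · refine List.Nodup.pairwise_of_forall_ne nodup_pairs fun p hp p' hp' hne => ?_
    have h1 := mem_pairs.1 hp
    have h2 := mem_pairs.1 hp'
    rw [epsTensor_linkFactor, tensorEps_linkFactor, compIdMul_linkFactor, compMulId_linkFactor]
    by_cases h : D.χ p.1 * D.χ p.2 = 1
    · by_cases h' : D.χ p'.1 * D.χ p'.2 = 1
      · refine ⟨((((commute_epsTensor_compIdMul_eta h1 h2 hne h h').smul_right _).smul_left
          _).qExp_right _).qExp_left _, ((((commute_tensorEps_compMulId_eta h1 h2 hne h
          h').smul_right _).smul_left _).qExp_right _).qExp_left _⟩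
      · rw [hlam _ _ h2 h', zero_smul, zero_smul, qExp_zero (D.orderOf_χ_pos _ _)]
        exact ⟨Commute.one_left _, Commute.one_left _⟩
    · rw [hlam _ _ h1 h, zero_smul, zero_smul, qExp_zero (D.orderOf_χ_pos _ _)]
      exact ⟨Commute.one_right _, Commute.one_right _⟩

theorem evalLeft_smul (w : D.A) (r : k) (F : WithConv (D.A ⊗[k] D.A →ₗ[k] k)) :
    evalLeft w (r • F) = r • evalLeft w F := rfl

theorem evalLeft_grp_linkFactor (p : Fin θ × Fin θ) (h : G) :
    evalLeft (D.grp 0 0 h) (D.linkFactor lam p) = 1 :=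
  evalLeft_qExp_of_groupLike (D.orderOf_χ_pos _ _) (D.isGroupLikeElem_grp 0 0 h) (by
    rw [evalLeft_smul, evalLeft_grp_eta, smul_zero])

theorem evalLeft_grp_list_prod (l : List (Fin θ × Fin θ)) (h : G) :
    evalLeft (D.grp 0 0 h) (l.map (D.linkFactor lam)).prod = 1 := by
  refine (map_list_prod (pullback k (groupLikeTmul (D.isGroupLikeElem_grp 0 0 h))) _).trans ?_
  refine List.prod_eq_one fun y hy => ?_
  simp only [List.map_map, List.mem_map] at hy
  obtain ⟨p, -, rfl⟩ := hy
  exact D.evalLeft_grp_linkFactor p h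

theorem evalLeft_grp_linkCocycle (h : G) :
    evalLeft (D.grp 0 0 h) (D.linkCocycle lam) = 1 := by
  rw [linkCocycle_eq, evalLeft_grp_list_prod]

variable {D} in
theorem evalLeft_x_linkFactor (hlam : ∀ i j, i < j → D.χ i * D.χ j ≠ 1 → lam i j = 0)
    {p : Fin θ × Fin θ} (hp : p.1 < p.2) (l : Fin θ) :
    evalLeft (D.x 0 0 l) (D.linkFactor lam p) =
      lam p.1 p.2 • if l = p.1 then D.der p.2 else 0 := by
  by_cases h : D.χ p.1 * D.χ p.2 = 1
  · have h2 : 2 ≤ orderOf (D.χ p.2 (D.g p.1) : k) := by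
      rw [← N_eq_of_linked h]; exact D.two_le_N _
    have h3 : ∀ g, evalLeft (D.grp 0 0 g) (lam p.1 p.2 • D.eta p.1 p.2) = 0 := fun g => by
      rw [evalLeft_smul, evalLeft_grp_eta, smul_zero]
    have h1 := h3 1
    rw [map_one] at h1
    rw [linkFactor, evalLeft_qExp_of_skew h2 (D.comul_x 0 0 l) (D.counit_x 0 0 l) h1 (h3 _),
      evalLeft_smul, evalLeft_x_eta]
  · have h0 := hlam _ _ hp h
    rw [D.linkFactor_eq_one h0, h0, zero_smul]
    ext b
    simp

variable {D} in
theorem evalLeft_x_linkCocycle (hlam : ∀ i j, i < j → D.χ i * D.χ j ≠ 1 → lam i j = 0)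
    (i : Fin θ) : evalLeft (D.x 0 0 i) (D.linkCocycle lam) =
      ∑ l ∈ Finset.univ.filter fun l => i < l, lam i l • D.der l := by
  have key : ∀ l : List (Fin θ × Fin θ), (∀ p ∈ l, p.1 < p.2) →
      evalLeft (D.x 0 0 i) (l.map (D.linkFactor lam)).prod =
        (l.map fun p => lam p.1 p.2 • if i = p.1 then D.der p.2 else 0).sum := by
    intro l hl
    induction l with
    | nil => ext b; simp
    | cons p l ih =>
      have h1 := D.evalLeft_grp_list_prod (lam := lam) l 1
      rw [map_one] at h1
      rw [List.map_cons, List.prod_cons, evalLeft_mul_of_skew (D.comul_x 0 0 i),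
        evalLeft_grp_linkFactor, h1, mul_one, one_mul, ih fun p' hp' =>
        hl p' (List.mem_cons_of_mem _ hp'), evalLeft_x_linkFactor hlam (hl p List.mem_cons_self),
        List.map_cons, List.sum_cons]
  rw [linkCocycle_eq, key _ fun p hp => mem_pairs.1 hp, ← List.sum_toFinset _ nodup_pairs]
  have e : (pairs θ).toFinset = Finset.univ.filter fun p : Fin θ × Fin θ => p.1 < p.2 := by
    ext p; simp [mem_pairs]
  rw [e, Finset.sum_filter, ← Finset.univ_product_univ, Finset.sum_product, Finset.sum_eq_single i,
    Finset.sum_filter]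
  · simp
  · intro m _ hm
    refine Finset.sum_eq_zero fun l _ => ?_
    rw [if_neg (Ne.symm hm), smul_zero, ite_self]
  · simp

end QLSDatum

namespace QLSDatum

open Coalgebra WithConv HopfDeformation

variable {k G : Type*} [Field k] [CommGroup G] {θ : ℕ} (D : QLSDatum k G θ)

/-! ### Spanning monomials of `u(D, λ, μ)` -/

variable (lam : Fin θ → Fin θ → k) (mu : Fin θ → k)

/-- The span of the monomials in `xᵢ`, `i ∈ l`, multiplied in the order of the list `l`, and the
elements of `G`. -/
def listSpan (l : List (Fin θ)) : Submodule k (D.U lam mu) :=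
  Submodule.span k (Set.range fun p : D.PBWIndex =>
    (l.map fun i => D.x lam mu i ^ (p.1 i : ℕ)).prod * D.grp lam mu p.2)

variable {lam mu}

theorem grp_mul_mem_listSpan (h : G) (l : List (Fin θ)) {w : D.U lam mu}
    (hw : w ∈ D.listSpan lam mu l) : D.grp lam mu h * w ∈ D.listSpan lam mu l := by
  induction hw using Submodule.span_induction with
  | mem w hw =>
    obtain ⟨p, rfl⟩ := hw
    obtain ⟨c, hc⟩ := D.grp_mul_prod lam mu h (fun i => p.1 i) l
    dsimp only
    rw [← mul_assoc, hc, smul_mul_assoc, mul_assoc, ← map_mul]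
    exact Submodule.smul_mem _ _ (Submodule.subset_span ⟨(p.1, h * p.2), rfl⟩)
  | zero => rw [mul_zero]; exact Submodule.zero_mem _
  | add s t _ _ hs ht => rw [mul_add]; exact Submodule.add_mem _ hs ht
  | smul r s _ hs => rw [mul_smul_comm]; exact Submodule.smul_mem _ _ hs

theorem x_pow_mul_mem_listSpan {m : Fin θ} {l : List (Fin θ)} (hm : m ∉ l) {a : ℕ}
    (ha : a < D.N m) {w : D.U lam mu} (hw : w ∈ D.listSpan lam mu l) :
    D.x lam mu m ^ a * w ∈ D.listSpan lam mu (m :: l) := by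
  induction hw using Submodule.span_induction with
  | mem w hw =>
    obtain ⟨p, rfl⟩ := hw
    refine Submodule.subset_span ⟨(Function.update p.1 m ⟨a, ha⟩, p.2), ?_⟩
    have e : (l.map fun i => D.x lam mu i ^ (Function.update p.1 m ⟨a, ha⟩ i : ℕ)) =
        l.map fun i => D.x lam mu i ^ (p.1 i : ℕ) := by
      refine List.map_congr_left fun i hi => ?_
      have : i ≠ m := fun h => hm (h ▸ hi)
      rw [Function.update_of_ne this]
    simp only [List.map_cons, List.prod_cons, e, Function.update_self, mul_assoc]
  | zero => rw [mul_zero]; exact Submodule.zero_mem _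
  | add s t _ _ hs ht => rw [mul_add]; exact Submodule.add_mem _ hs ht
  | smul r s _ hs => rw [mul_smul_comm]; exact Submodule.smul_mem _ _ hs

variable [Finite G]

theorem listSpan_le_cons {m : Fin θ} {l : List (Fin θ)} (hm : m ∉ l) {w : D.U lam mu}
    (hw : w ∈ D.listSpan lam mu l) : w ∈ D.listSpan lam mu (m :: l) := by
  simpa using D.x_pow_mul_mem_listSpan hm (D.N_pos m) hw

theorem x_mul_mem_listSpan_cons {m : Fin θ} {l : List (Fin θ)} (hm : m ∉ l) {w : D.U lam mu}
    (hw : w ∈ D.listSpan lam mu (m :: l)) :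
    D.x lam mu m * w ∈ D.listSpan lam mu (m :: l) := by
  induction hw using Submodule.span_induction with
  | mem w hw =>
    obtain ⟨p, rfl⟩ := hw
    have hc : (l.map fun i => D.x lam mu i ^ (p.1 i : ℕ)).prod * D.grp lam mu p.2 ∈
        D.listSpan lam mu l := Submodule.subset_span ⟨p, rfl⟩
    simp only [List.map_cons, List.prod_cons]
    rw [mul_assoc, ← mul_assoc, ← pow_succ']
    by_cases h : (p.1 m : ℕ) + 1 < D.N m
    · exact D.x_pow_mul_mem_listSpan hm h hc
    · have h1 : (p.1 m : ℕ) + 1 = D.N m := by have := (p.1 m).2; omega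
      rw [h1, x_pow, smul_mul_assoc, sub_mul, one_mul]
      exact Submodule.smul_mem _ _ (Submodule.sub_mem _ (D.listSpan_le_cons hm hc)
        (D.listSpan_le_cons hm (D.grp_mul_mem_listSpan _ _ hc)))
  | zero => rw [mul_zero]; exact Submodule.zero_mem _
  | add s t _ _ hs ht => rw [mul_add]; exact Submodule.add_mem _ hs ht
  | smul r s _ hs => rw [mul_smul_comm]; exact Submodule.smul_mem _ _ hs

/-- For decreasing lists the linking relations move `xᵢ` to the right past the `xₘ` with `m > i`;
the correction terms lie in the span already. -/
theorem x_mul_mem_listSpan {l : List (Fin θ)} (hl : l.Pairwise (· > ·)) {i : Fin θ} (hi : i ∈ l)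
    {w : D.U lam mu} (hw : w ∈ D.listSpan lam mu l) :
    D.x lam mu i * w ∈ D.listSpan lam mu l := by
  induction l generalizing w with
  | nil => simp at hi
  | cons m l ih =>
    obtain ⟨h1, h2⟩ := List.pairwise_cons.1 hl
    have hm : m ∉ l := fun h => lt_irrefl _ (h1 m h)
    rcases List.mem_cons.1 hi with rfl | hil
    · exact D.x_mul_mem_listSpan_cons hm hw
    have him : i < m := h1 i hil
    have key : ∀ a < D.N m, ∀ c ∈ D.listSpan lam mu l,
        D.x lam mu i * (D.x lam mu m ^ a * c) ∈ D.listSpan lam mu (m :: l) := by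
      intro a ha c hc
      induction a with
      | zero => rw [pow_zero, one_mul]; exact D.listSpan_le_cons hm (ih h2 hil hc)
      | succ a iha =>
        have hs := D.x_pow_mul_mem_listSpan hm (show a < D.N m by omega) hc
        rw [pow_succ', mul_assoc, ← mul_assoc, D.x_mul_x lam mu him, add_mul, smul_mul_assoc,
          smul_mul_assoc, mul_assoc, sub_mul, one_mul]
        exact Submodule.add_mem _
          (Submodule.smul_mem _ _ (D.x_mul_mem_listSpan_cons hm (iha (by omega))))
          (Submodule.smul_mem _ _ (Submodule.sub_mem _ hs (D.grp_mul_mem_listSpan _ _ hs)))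
    induction hw using Submodule.span_induction with
    | mem w hw =>
      obtain ⟨p, rfl⟩ := hw
      simp only [List.map_cons, List.prod_cons]
      rw [mul_assoc]
      exact key _ (p.1 m).2 _ (Submodule.subset_span ⟨p, rfl⟩)
    | zero => rw [mul_zero]; exact Submodule.zero_mem _
    | add s t _ _ hs ht => rw [mul_add]; exact Submodule.add_mem _ hs ht
    | smul r s _ hs => rw [mul_smul_comm]; exact Submodule.smul_mem _ _ hs

theorem pairwise_reverse_finRange : (List.finRange θ).reverse.Pairwise (· > ·) :=
  List.pairwise_reverse.2 (List.pairwise_lt_finRange θ)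

/-- The monomials in decreasing order span `u(D, λ, μ)`. -/
theorem listSpan_eq_top : D.listSpan lam mu (List.finRange θ).reverse = ⊤ := by
  set S := D.listSpan lam mu (List.finRange θ).reverse with hS
  have key : ∀ u : D.U lam mu, ∀ s ∈ S, u * s ∈ S := by
    intro u
    induction u using induction with
    | hg h => exact fun s hs => D.grp_mul_mem_listSpan h _ hs
    | hx i =>
      exact fun s hs => D.x_mul_mem_listSpan pairwise_reverse_finRange
        (List.mem_reverse.2 (List.mem_finRange i)) hs
    | hs r => intro s hs; rw [← Algebra.smul_def]; exact S.smul_mem _ hs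
    | ha a b ha hb => intro s hs; rw [add_mul]; exact S.add_mem (ha s hs) (hb s hs)
    | hm a b ha hb => intro s hs; rw [mul_assoc]; exact ha _ (hb s hs)
  have h1 : (1 : D.U lam mu) ∈ S :=
    Submodule.subset_span ⟨(fun i => ⟨0, D.N_pos i⟩, 1), by simp⟩
  exact Submodule.eq_top_iff'.2 fun u => by simpa using key u 1 h1

instance : Module.Finite k (D.U lam mu) := by
  have : Finite D.PBWIndex := inferInstance
  exact ⟨by rw [← D.listSpan_eq_top]; exact Submodule.fg_span (Set.finite_range _)⟩

theorem finrank_U_le : Module.finrank k (D.U lam mu) ≤ Module.finrank k D.A := by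
  have := Fintype.ofFinite D.PBWIndex
  rw [Module.finrank_eq_card_basis D.pbwBasis, ← finrank_top, ← D.listSpan_eq_top]
  exact finrank_range_le_card _

/-! ### Homomorphisms of bialgebras out of `u(D, λ, μ)` -/

/-- An algebra homomorphism that respects `ε` and `Δ` on the generators is a homomorphism of
coalgebras. -/
def toCoalgHom {B : Type*} [Ring B] [Bialgebra k B] (f : D.U lam mu →ₐ[k] B)
    (hg : ∀ h, IsGroupLikeElem k (f (D.grp lam mu h)))
    (hx0 : ∀ i, counit (R := k) (f (D.x lam mu i)) = 0)
    (hx : ∀ i, comul (R := k) (f (D.x lam mu i)) = f (D.x lam mu i) ⊗ₜ[k] 1 +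
      f (D.grp lam mu (D.g i)) ⊗ₜ[k] f (D.x lam mu i)) : D.U lam mu →ₗc[k] B :=
  (BialgHom.ofAlgHom f
    (algHom_ext (fun h => by simpa using (hg h).counit_eq_one) (fun i => by simpa using hx0 i))
    (algHom_ext (fun h => by simpa [comul_grp] using (hg h).comul_eq_tmul_self.symm)
      (fun i => by simpa [comul_x] using (hx i).symm))).toCoalgHom

end QLSDatum

namespace HopfDeformation

open Coalgebra WithConv

variable {k H : Type*} [Field k] [Ring H] [HopfAlgebra k H]

/-! ### Elements annihilated by a skew derivation -/

/-- `c` is annihilated by both translations by the functional `d`. -/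
def Annihilates (d : WithConv (H →ₗ[k] k)) (c : H) : Prop := actLeft d c = 0 ∧ actRight d c = 0

theorem actLeft_of_groupLike (φ : WithConv (H →ₗ[k] k)) {g : H} (hg : IsGroupLikeElem k g) :
    actLeft φ g = φ g • g := by
  rw [actLeft_apply, hg.comul_eq_tmul_self]; simp

theorem actRight_of_groupLike (φ : WithConv (H →ₗ[k] k)) {g : H} (hg : IsGroupLikeElem k g) :
    actRight φ g = φ g • g := by
  rw [actRight_apply, hg.comul_eq_tmul_self]; simp

theorem actLeft_of_skew (φ : WithConv (H →ₗ[k] k)) {x g : H}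
    (hx : comul (R := k) x = x ⊗ₜ[k] 1 + g ⊗ₜ[k] x) : actLeft φ x = φ x • 1 + φ g • x := by
  rw [actLeft_apply, hx]; simp

theorem actRight_of_skew (φ : WithConv (H →ₗ[k] k)) {x g : H}
    (hx : comul (R := k) x = x ⊗ₜ[k] 1 + g ⊗ₜ[k] x) : actRight φ x = φ 1 • x + φ x • g := by
  rw [actRight_apply, hx]; simp

theorem actLeft_smul (r : k) (φ : WithConv (H →ₗ[k] k)) (b : H) :
    actLeft (r • φ) b = r • actLeft φ b := by
  rw [actLeft_eq _ (ℛ k b), actLeft_eq _ (ℛ k b), Finset.smul_sum]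
  simp [smul_smul]

theorem actRight_smul (r : k) (φ : WithConv (H →ₗ[k] k)) (b : H) :
    actRight (r • φ) b = r • actRight φ b := by
  rw [actRight_eq _ (ℛ k b), actRight_eq _ (ℛ k b), Finset.smul_sum]
  simp [smul_smul]

theorem actLeft_sum {ι : Type*} (s : Finset ι) (φ : ι → WithConv (H →ₗ[k] k)) (b : H) :
    actLeft (∑ i ∈ s, φ i) b = ∑ i ∈ s, actLeft (φ i) b := by
  simp only [actLeft_eq _ (ℛ k b), WithConv.ofConv_sum, LinearMap.sum_apply, Finset.sum_smul]
  exact Finset.sum_comm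

theorem actRight_sum {ι : Type*} (s : Finset ι) (φ : ι → WithConv (H →ₗ[k] k)) (b : H) :
    actRight (∑ i ∈ s, φ i) b = ∑ i ∈ s, actRight (φ i) b := by
  simp only [actRight_eq _ (ℛ k b), WithConv.ofConv_sum, LinearMap.sum_apply, Finset.sum_smul]
  exact Finset.sum_comm

section SkewDer

variable {d χ : WithConv (H →ₗ[k] k)}

theorem Annihilates.mul (hd : ∀ a b, d (a * b) = d a * counit (R := k) b + χ a * d b) {a b : H}
    (ha : Annihilates d a) (hb : Annihilates d b) : Annihilates d (a * b) := by
  constructor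
  · rw [actLeft_skewDer hd, ha.1, hb.1, zero_mul, mul_zero, add_zero]
  · rw [actRight_skewDer hd, ha.2, hb.2, zero_mul, mul_zero, add_zero]

theorem annihilates_of_groupLike {g : H} (hg : IsGroupLikeElem k g) (h : d g = 0) :
    Annihilates d g := by
  constructor
  · rw [actLeft_of_groupLike d hg, h, zero_smul]
  · rw [actRight_of_groupLike d hg, h, zero_smul]

theorem annihilates_of_skew {x g : H} (hx : comul (R := k) x = x ⊗ₜ[k] 1 + g ⊗ₜ[k] x)
    (h1 : d 1 = 0) (h2 : d g = 0) (h3 : d x = 0) : Annihilates d x := by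
  constructor
  · rw [actLeft_of_skew d hx, h2, h3]; simp
  · rw [actRight_of_skew d hx, h1, h3]; simp

theorem Annihilates.pow (hd : ∀ a b, d (a * b) = d a * counit (R := k) b + χ a * d b)
    (h1 : d 1 = 0) {a : H} (ha : Annihilates d a) (n : ℕ) : Annihilates d (a ^ n) := by
  induction n with
  | zero => rw [pow_zero]; exact annihilates_of_groupLike isGroupLikeElem_one h1
  | succ n ih => rw [pow_succ]; exact ih.mul hd ha

theorem Annihilates.list_prod (hd : ∀ a b, d (a * b) = d a * counit (R := k) b + χ a * d b)
    (h1 : d 1 = 0) {l : List H} (hl : ∀ a ∈ l, Annihilates d a) : Annihilates d l.prod := by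
  induction l with
  | nil => exact annihilates_of_groupLike isGroupLikeElem_one h1
  | cons a l ih =>
    rw [List.prod_cons]
    exact (hl a List.mem_cons_self).mul hd (ih fun b hb => hl b (List.mem_cons_of_mem _ hb))

end SkewDer

end HopfDeformation

namespace QLSDatum

open Coalgebra WithConv HopfDeformation

variable {k G : Type*} [Field k] [CommGroup G] {θ : ℕ} (D : QLSDatum k G θ) [Finite G]

variable {lam : Fin θ → Fin θ → k} {mu : Fin θ → k}

/-! ### Products with generators in a deformation of `u(D, λ, μ)` -/

theorem toDeformed_grp_mul {σ : WithConv (D.U lam mu ⊗[k] D.U lam mu →ₗ[k] k)}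
    (hσ : IsMulCocycle σ) (h1 : ∀ h, evalLeft (D.grp lam mu h) σ = 1) (h : G) (b : D.U lam mu) :
    toDeformed hσ (D.grp lam mu h) * toDeformed hσ b = toDeformed hσ (D.grp lam mu h * b) := by
  rw [toDeformed_mul]
  obtain ⟨u, rfl⟩ := hσ.isUnit
  rw [deformedMul_tmul_of_left (D.isGroupLikeElem_grp lam mu h)]
  intro b
  have := congrArg (fun f => f b) (h1 h)
  simpa using this

theorem toDeformed_x_mul {σ : WithConv (D.U lam mu ⊗[k] D.U lam mu →ₗ[k] k)}
    (hσ : IsMulCocycle σ) (h1 : ∀ h, evalLeft (D.grp lam mu h) σ = 1) (i : Fin θ)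
    (b : D.U lam mu) :
    toDeformed hσ (D.x lam mu i) * toDeformed hσ b = toDeformed hσ (D.x lam mu i * b +
      (actLeft (evalLeft (D.x lam mu i) σ) b -
        D.grp lam mu (D.g i) * actRight (evalLeft (D.x lam mu i) σ) b)) := by
  rw [toDeformed_mul, deformedMul_of_skew hσ.isUnit (D.isGroupLikeElem_grp lam mu _)
    (D.comul_x lam mu i) (by rw [← map_one (D.grp lam mu), h1]) (h1 _)]

/-! ### The homomorphism from `u(D, 0, μ)` to the deformation by the root vector cocycle -/

theorem annihilates_der_grp (i : Fin θ) (h : G) : Annihilates (D.der i) (D.grp 0 0 h) :=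
  annihilates_of_groupLike (D.isGroupLikeElem_grp 0 0 h) (D.der_grp i h)

theorem annihilates_der_x {i j : Fin θ} (hj : j ≠ i) : Annihilates (D.der i) (D.x 0 0 j) :=
  annihilates_of_skew (D.comul_x 0 0 j) (D.der_one i) (D.der_grp i _) (by simp [hj])

theorem actLeft_der_x_pow (i : Fin θ) {c : D.A} (hc : actLeft (D.der i) c = 0) (m : ℕ) :
    actLeft (D.der i) (D.x 0 0 i ^ (m + 1) * c) =
      qNumber (D.χ i (D.g i) : k) (m + 1) • (D.x 0 0 i ^ m * c) := by
  have key : ∀ b, actLeft (D.der i) (D.x 0 0 i * b) =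
      b + (D.χ i (D.g i) : k) • (D.x 0 0 i * actLeft (D.der i) b) := fun b => by
    rw [actLeft_skewDer (D.der_mul i), actLeft_of_skew _ (D.comul_x 0 0 i),
      actLeft_of_skew _ (D.comul_x 0 0 i)]
    simp
  induction m with
  | zero => rw [zero_add, pow_one, key, hc]; simp [qNumber]
  | succ m ih =>
    rw [pow_succ', mul_assoc, key, ih, mul_smul_comm, ← mul_assoc, ← pow_succ', smul_smul,
      qNumber_succ' _ (m + 1), add_smul, one_smul]

theorem actRight_der_x_pow (i : Fin θ) {c : D.A} (hc : actRight (D.der i) c = 0) (m : ℕ) :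
    actRight (D.der i) (D.x 0 0 i ^ (m + 1) * c) =
      qNumber (D.χ i (D.g i) : k) (m + 1) • (D.x 0 0 i ^ m * (D.grp 0 0 (D.g i) * c)) := by
  have key : ∀ b, actRight (D.der i) (D.x 0 0 i * b) =
      D.grp 0 0 (D.g i) * b + D.x 0 0 i * actRight (D.der i) b := fun b => by
    rw [actRight_skewDer (D.der_mul i), actRight_of_skew _ (D.comul_x 0 0 i),
      actRight_of_skew _ (D.comul_x 0 0 i)]
    simp
  induction m with
  | zero => rw [zero_add, pow_one, key, hc]; simp [qNumber]
  | succ m ih =>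
    have h1 := mul_pow_of_qcomm (D.grp_mul_x 0 0 (D.g i) i) (m + 1)
    have h2 : qNumber (D.χ i (D.g i) : k) (m + 1 + 1) =
        (D.χ i (D.g i) : k) ^ (m + 1) + qNumber (D.χ i (D.g i) : k) (m + 1) := by
      rw [qNumber_add]; simp [qNumber]; ring
    rw [pow_succ', mul_assoc, key, ih, mul_smul_comm, ← mul_assoc, h1, smul_mul_assoc,
      mul_assoc, ← mul_assoc (D.x 0 0 i), ← pow_succ', ← add_smul, h2]

theorem actLeft_divPow (i : Fin θ) {n : ℕ} (hn : n < D.N i) {c : D.A}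
    (hc : actLeft (D.der i) c = 0) {m : ℕ} (hm : m ≤ n) :
    actLeft (D.divPow i n 0) (D.x 0 0 i ^ m * c) = if m = n then c else 0 := by
  induction n generalizing m with
  | zero =>
    obtain rfl : m = 0 := by omega
    rw [divPow_zero, pow_zero, actLeft_one, pow_zero, one_mul, if_pos rfl]
  | succ n ih =>
    have h0 := D.qNumber_ne_zero i hn
    have h1 : D.divPow i (n + 1) 0 = (qNumber (D.χ i (D.g i) : k) (n + 1))⁻¹ •
        (D.der i * D.divPow i n 0) := by
      rw [der_mul_divPow, smul_smul, inv_mul_cancel₀ h0, one_smul]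
    rw [h1, actLeft_smul, actLeft_mul]
    cases m with
    | zero => rw [pow_zero, one_mul, hc, map_zero, smul_zero, if_neg (by omega)]
    | succ m =>
      rw [D.actLeft_der_x_pow i hc, map_smul, ih (by omega) (by omega)]
      by_cases h : m = n
      · subst h; rw [if_pos rfl, if_pos rfl, smul_smul, inv_mul_cancel₀ h0, one_smul]
      · rw [if_neg h, if_neg (by omega), smul_zero, smul_zero]

theorem actRight_divPow (i : Fin θ) {n : ℕ} (hn : n < D.N i) {c : D.A}
    (hc : actRight (D.der i) c = 0) {m : ℕ} (hm : m ≤ n) :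
    actRight (D.divPow i n 0) (D.x 0 0 i ^ m * c) =
      if m = n then D.grp 0 0 (D.g i ^ n) * c else 0 := by
  induction n generalizing m c with
  | zero =>
    obtain rfl : m = 0 := by omega
    rw [divPow_zero, pow_zero, actRight_one, pow_zero, one_mul, if_pos rfl, pow_zero, map_one,
      one_mul]
  | succ n ih =>
    have h0 := D.qNumber_ne_zero i hn
    have h1 : D.divPow i (n + 1) 0 = (qNumber (D.χ i (D.g i) : k) (n + 1))⁻¹ •
        (D.divPow i n 0 * D.der i) := by
      rw [divPow_mul_der, pow_zero, one_mul, smul_smul, inv_mul_cancel₀ h0, one_smul]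
    rw [h1, actRight_smul, actRight_mul]
    cases m with
    | zero => rw [pow_zero, one_mul, hc, map_zero, smul_zero, if_neg (by omega)]
    | succ m =>
      have hc' : actRight (D.der i) (D.grp 0 0 (D.g i) * c) = 0 := by
        rw [actRight_skewDer (D.der_mul i), (D.annihilates_der_grp i _).2, hc, zero_mul, mul_zero,
          add_zero]
      rw [D.actRight_der_x_pow i hc, map_smul, ih (by omega) hc' (by omega)]
      by_cases h : m = n
      · subst h
        rw [if_pos rfl, if_pos rfl, smul_smul, inv_mul_cancel₀ h0, one_smul, ← mul_assoc,
          ← map_mul, ← pow_succ]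
      · rw [if_neg h, if_neg (by omega), smul_zero, smul_zero]

section RootHom

variable [CharZero k] (hmu : ∀ i, D.χ i ^ D.N i ≠ 1 → mu i = 0)

local notation "τ" => toDeformed (D.isMulCocycle_rootCocycle hmu)

variable {D}

theorem rootDeformed_grp_mul (h : G) (b : D.A) :
    τ (D.grp 0 0 h) * τ b = τ (D.grp 0 0 h * b) :=
  D.toDeformed_grp_mul _ (D.evalLeft_grp_rootCocycle hmu) h b

/-- Multiplication by `xᵢ` is not deformed until the power `xᵢ^Nᵢ` is reached. -/
theorem rootDeformed_x_mul (i : Fin θ) {m : ℕ} (hm : m + 1 ≤ D.N i) {c : D.A}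
    (hc : Annihilates (D.der i) c) : τ (D.x 0 0 i) * τ (D.x 0 0 i ^ m * c) =
      τ (D.x 0 0 i ^ (m + 1) * c +
        if m + 1 = D.N i then mu i • (c - D.grp 0 0 (D.g i ^ D.N i) * c) else 0) := by
  rw [D.toDeformed_x_mul _ (D.evalLeft_grp_rootCocycle hmu), evalLeft_x_rootCocycle D hmu,
    actLeft_smul, actRight_smul, D.actLeft_divPow i (by omega) hc.1 (by omega),
    D.actRight_divPow i (by omega) hc.2 (by omega), ← mul_assoc, ← pow_succ']
  congr 2
  by_cases h : m + 1 = D.N i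
  · have h' : m = D.N i - 1 := by omega
    rw [if_pos h', if_pos h', if_pos h, mul_smul_comm, ← mul_assoc, ← map_mul, ← pow_succ',
      Nat.sub_add_cancel (by omega), smul_sub]
  · have h' : m ≠ D.N i - 1 := by omega
    rw [if_neg h', if_neg h', if_neg h]; simp

theorem rootDeformed_x_pow_mul (i : Fin θ) {m : ℕ} (hm : m < D.N i) {c : D.A}
    (hc : Annihilates (D.der i) c) :
    τ (D.x 0 0 i) ^ m * τ c = τ (D.x 0 0 i ^ m * c) := by
  induction m with
  | zero => rw [pow_zero, pow_zero, one_mul, one_mul]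
  | succ m ih =>
    rw [pow_succ', mul_assoc, ih (by omega), rootDeformed_x_mul hmu i (by omega) hc,
      if_neg (by omega), add_zero]

theorem rootDeformed_x_mul_of_annihilates (i : Fin θ) {c : D.A} (hc : Annihilates (D.der i) c) :
    τ (D.x 0 0 i) * τ c = τ (D.x 0 0 i * c) := by
  simpa using rootDeformed_x_pow_mul hmu i (D.two_le_N i) hc

/-- The homomorphism from `u(D, 0, μ)` to the deformation of `A` by the root vector cocycle. -/
def rootHom : D.U 0 mu →ₐ[k] Deformed (D.isMulCocycle_rootCocycle hmu) :=
  lift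
    { toFun := fun h => τ (D.grp 0 0 h)
      map_one' := by rw [map_one]; rfl
      map_mul' := fun h h' => by rw [rootDeformed_grp_mul hmu, map_mul] }
    (fun i => τ (D.x 0 0 i))
    (fun h i => by
      change τ (D.grp 0 0 h) * τ (D.x 0 0 i) = _ • (τ (D.x 0 0 i) * τ (D.grp 0 0 h))
      rw [rootDeformed_grp_mul hmu, rootDeformed_x_mul_of_annihilates hmu i
        (D.annihilates_der_grp i h), grp_mul_x, map_smul])
    (fun i j hij => by
      rw [Pi.zero_apply, Pi.zero_apply, zero_smul, add_zero,
        rootDeformed_x_mul_of_annihilates hmu i (D.annihilates_der_x hij.ne'),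
        rootDeformed_x_mul_of_annihilates hmu j (D.annihilates_der_x hij.ne),
        D.x_mul_x_zero 0 hij.ne, map_smul])
    (fun i => by
      change τ (D.x 0 0 i) ^ D.N i = mu i • (1 - τ (D.grp 0 0 (D.g i ^ D.N i)))
      have h0 : Annihilates (D.der i) 1 :=
        annihilates_of_groupLike isGroupLikeElem_one (D.der_one i)
      obtain ⟨m, hm⟩ : ∃ m, D.N i = m + 1 := ⟨D.N i - 1, by have := D.N_pos i; omega⟩
      have h1 := rootDeformed_x_pow_mul hmu i (m := m) (by omega) h0
      have h2 := rootDeformed_x_mul hmu i (m := m) (by omega) h0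
      rw [toDeformed_one, mul_one] at h1
      rw [← h1, ← pow_succ', ← hm, if_pos rfl, x_pow] at h2
      rw [h2]
      simp only [Pi.zero_apply, zero_smul, mul_one, zero_add, map_smul, map_sub, toDeformed_one])

theorem rootHom_grp (h : G) : rootHom hmu (D.grp 0 mu h) = τ (D.grp 0 0 h) := lift_grp h

theorem rootHom_x (i : Fin θ) : rootHom hmu (D.x 0 mu i) = τ (D.x 0 0 i) := lift_x i

theorem annihilates_der_list (i : Fin θ) (a : Fin θ → ℕ) {l : List (Fin θ)} (hi : i ∉ l) (h : G) :
    Annihilates (D.der i) ((l.map fun j => D.x 0 0 j ^ a j).prod * D.grp 0 0 h) := by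
  refine (Annihilates.list_prod (D.der_mul i) (D.der_one i) fun y hy => ?_).mul (D.der_mul i)
    (D.annihilates_der_grp i h)
  obtain ⟨j, hj, rfl⟩ := List.mem_map.1 hy
  exact (D.annihilates_der_x (i := i) (j := j) fun e => hi (by rw [← e]; exact hj)).pow
    (D.der_mul i) (D.der_one i) _

/-- On ordered monomials the two multiplications agree: a factor `xᵢ^a` with `a < Nᵢ` does not
interact with factors annihilated by `dᵢ`. -/
theorem rootHom_list {a : Fin θ → ℕ} (ha : ∀ i, a i < D.N i) {l : List (Fin θ)} (hl : l.Nodup)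
    (h : G) : rootHom hmu ((l.map fun j => D.x 0 mu j ^ a j).prod * D.grp 0 mu h) =
      τ ((l.map fun j => D.x 0 0 j ^ a j).prod * D.grp 0 0 h) := by
  induction l with
  | nil => simpa using rootHom_grp hmu h
  | cons i l ih =>
    obtain ⟨h1, h2⟩ := List.nodup_cons.1 hl
    rw [List.map_cons, List.prod_cons, mul_assoc, map_mul, ih h2, map_pow, rootHom_x,
      rootDeformed_x_pow_mul hmu i (ha i) (annihilates_der_list i a h1 h), List.map_cons,
      List.prod_cons, mul_assoc]

theorem rootHom_pbwIdent (a : D.A) : rootHom hmu (D.pbwIdent mu a) = τ a := by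
  have : (rootHom hmu).toLinearMap ∘ₗ D.pbwIdent mu = (τ).toLinearMap :=
    D.pbwBasis.ext fun p => by
      rw [LinearMap.comp_apply, pbwIdent, Module.Basis.constr_basis, pbwBasis_apply]
      exact rootHom_list hmu (fun i => (p.1 i).2) (List.nodup_finRange θ) p.2
  exact congrArg (fun f => f a) this

end RootHom

end QLSDatum

namespace HopfDeformation

open Coalgebra WithConv

variable {k H : Type*} [Field k] [Ring H] [HopfAlgebra k H]

theorem bijective_of_surjective_of_finrank_le {V W : Type*} [AddCommGroup V] [Module k V]
    [AddCommGroup W] [Module k W] [FiniteDimensional k V] {f : V →ₗ[k] W}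
    (hf : Function.Surjective f) (h : Module.finrank k V ≤ Module.finrank k W) :
    Function.Bijective f := by
  have := Module.Finite.of_surjective f hf
  exact ⟨(LinearMap.injective_iff_surjective_of_finrank_eq_finrank
    (h.antisymm (LinearMap.finrank_le_finrank_of_surjective hf))).2 hf, hf⟩

theorem comul_toDeformed_of_skew {σ : WithConv (H ⊗[k] H →ₗ[k] k)} (hσ : IsMulCocycle σ) {x g : H}
    (hx : comul (R := k) x = x ⊗ₜ[k] 1 + g ⊗ₜ[k] x) :
    comul (R := k) (toDeformed hσ x) = toDeformed hσ x ⊗ₜ[k] 1 +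
      toDeformed hσ g ⊗ₜ[k] toDeformed hσ x := by
  rw [← CoalgHomClass.map_comp_comul_apply, hx]
  rfl

end HopfDeformation

namespace QLSDatum

open Coalgebra WithConv HopfDeformation

variable {k G : Type*} [Field k] [CommGroup G] {θ : ℕ} (D : QLSDatum k G θ) [Finite G]

variable {lam : Fin θ → Fin θ → k} {mu : Fin θ → k}

/-! ### The identification of `A` with `u(D, 0, μ)` -/

/-- An algebra homomorphism from `u(D, λ, μ)` to a cocycle deformation of `u(D, λ', μ')` which is
the identity on generators is a homomorphism of coalgebras. -/
def toDeformedCoalgHom {lam' : Fin θ → Fin θ → k} {mu' : Fin θ → k}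
    {σ : WithConv (D.U lam' mu' ⊗[k] D.U lam' mu' →ₗ[k] k)} (hσ : IsMulCocycle σ)
    (f : D.U lam mu →ₐ[k] Deformed hσ)
    (hg : ∀ h, f (D.grp lam mu h) = toDeformed hσ (D.grp lam' mu' h))
    (hx : ∀ i, f (D.x lam mu i) = toDeformed hσ (D.x lam' mu' i)) :
    D.U lam mu →ₗc[k] Deformed hσ :=
  D.toCoalgHom f (fun h => by rw [hg]; exact (D.isGroupLikeElem_grp lam' mu' h).map _)
    (fun i => by rw [hx]; exact D.counit_x lam' mu' i)
    (fun i => by rw [hx, hg]; exact comul_toDeformed_of_skew hσ (D.comul_x lam' mu' i))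

section RootEquiv

variable [CharZero k] (hmu : ∀ i, D.χ i ^ D.N i ≠ 1 → mu i = 0)

/-- Surjective because of the PBW monomials, and injective for reasons of dimension. -/
theorem bijective_rootHom : Function.Bijective (rootHom hmu) := by
  refine bijective_of_surjective_of_finrank_le (f := (rootHom hmu).toLinearMap) (fun a => ?_) ?_
  · exact ⟨D.pbwIdent mu ((toDeformed (D.isMulCocycle_rootCocycle hmu)).symm a),
      (rootHom_pbwIdent hmu _).trans rfl⟩
  · exact D.finrank_U_le

/-- The identification of `A` with `u(D, 0, μ)` as coalgebras. -/
def pbwEquiv : D.A ≃ₗc[k] D.U 0 mu :=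
  (toDeformed (D.isMulCocycle_rootCocycle hmu)).trans
    (CoalgEquiv.ofBijective (f := D.toDeformedCoalgHom (D.isMulCocycle_rootCocycle hmu)
      (rootHom hmu) (rootHom_grp hmu) (rootHom_x hmu)) (D.bijective_rootHom hmu)).symm

theorem rootHom_pbwEquiv (a : D.A) :
    rootHom hmu (D.pbwEquiv hmu a) = toDeformed (D.isMulCocycle_rootCocycle hmu) a :=
  CoalgEquiv.apply_symm_apply (CoalgEquiv.ofBijective (f := D.toDeformedCoalgHom
    (D.isMulCocycle_rootCocycle hmu) (rootHom hmu) (rootHom_grp hmu) (rootHom_x hmu))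
    (D.bijective_rootHom hmu)) _

theorem pbwEquiv_apply (a : D.A) : D.pbwEquiv hmu a = D.pbwIdent mu a :=
  (D.bijective_rootHom hmu).1 (by rw [rootHom_pbwEquiv, rootHom_pbwIdent])

theorem pbwEquiv_grp (h : G) : D.pbwEquiv hmu (D.grp 0 0 h) = D.grp 0 mu h :=
  (D.bijective_rootHom hmu).1 (by rw [rootHom_pbwEquiv, rootHom_grp])

theorem pbwEquiv_x (i : Fin θ) : D.pbwEquiv hmu (D.x 0 0 i) = D.x 0 mu i :=
  (D.bijective_rootHom hmu).1 (by rw [rootHom_pbwEquiv, rootHom_x])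

theorem pbwEquiv_one : D.pbwEquiv hmu 1 = 1 := by
  rw [← map_one (D.grp 0 0), pbwEquiv_grp, map_one]

theorem pbwEquiv_deformedMul (a b : D.A) :
    D.pbwEquiv hmu (deformedMul (D.rootCocycle mu) (a ⊗ₜ[k] b)) =
      D.pbwEquiv hmu a * D.pbwEquiv hmu b :=
  (D.bijective_rootHom hmu).1 (by
    rw [map_mul, rootHom_pbwEquiv, rootHom_pbwEquiv, rootHom_pbwEquiv, toDeformed_mul])

end RootEquiv

/-! ### The linking cocycle on `u(D, 0, μ)` -/

section Link

variable (hmu : ∀ i, D.χ i ^ D.N i ≠ 1 → mu i = 0)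

theorem projMu_grp (h : G) : D.projMu mu hmu (D.grp 0 mu h) = D.quot.grp 0 0 (h : G ⧸ D.G₀) :=
  lift_grp h

theorem projMu_x (i : Fin θ) : D.projMu mu hmu (D.x 0 mu i) = D.quot.x 0 0 i := lift_x i

/-- The projection `π_μ` as a homomorphism of coalgebras. -/
def projMuCoalgHom : D.U 0 mu →ₗc[k] D.quot.A :=
  D.toCoalgHom (D.projMu mu hmu)
    (fun h => by rw [projMu_grp]; exact D.quot.isGroupLikeElem_grp 0 0 _)
    (fun i => by rw [projMu_x]; exact D.quot.counit_x 0 0 i)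
    (fun i => by rw [projMu_x, projMu_grp]; exact D.quot.comul_x 0 0 i)

variable {D} in
theorem quot_linked (hlam : ∀ i j, i < j → D.χ i * D.χ j ≠ 1 → lam i j = 0) (i j : Fin θ)
    (hij : i < j) (h : D.quot.χ i * D.quot.χ j ≠ 1) : lam i j = 0 := by
  refine hlam i j hij fun h' => h ?_
  ext g
  exact congrArg (fun f : G →* kˣ => ((f g : kˣ) : k)) h'

theorem isMulCocycle_linkCocycleMu
    (hlam : ∀ i j, i < j → D.χ i * D.χ j ≠ 1 → lam i j = 0) :
    IsMulCocycle (D.linkCocycleMu lam mu hmu) :=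
  (isMulCocycle_linkCocycle (quot_linked hlam)).pullback (D.projMuCoalgHom hmu)
    (map_one (D.projMu mu hmu)) (map_mul (D.projMu mu hmu))

/-- The skew derivation `dᵢ`, inflated to `u(D, 0, μ)`. -/
def derMu (i : Fin θ) : WithConv (D.U 0 mu →ₗ[k] k) :=
  HopfDeformation.pullback k (D.projMuCoalgHom hmu) (D.quot.der i)

/-- The functional `derMu hmu i` is a skew derivation with respect to the inflation of `χᵢ`. -/
theorem derMu_mul (i : Fin θ) (a b : D.U 0 mu) : D.derMu hmu i (a * b) =
    D.derMu hmu i a * counit (R := k) b +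
      HopfDeformation.pullback k (D.projMuCoalgHom hmu) (D.quot.chr i) a * D.derMu hmu i b := by
  have h := D.quot.der_mul i (D.projMu mu hmu a) (D.projMu mu hmu b)
  have hc : counit (R := k) (D.projMu mu hmu b) = counit (R := k) b :=
    CoalgHomClass.counit_comp_apply (D.projMuCoalgHom hmu) b
  rw [← map_mul, hc] at h
  exact h

theorem derMu_grp (i : Fin θ) (h : G) : D.derMu hmu i (D.grp 0 mu h) = 0 := by
  refine Eq.trans ?_ (D.quot.der_grp i (h : G ⧸ D.G₀))
  rw [← projMu_grp D hmu]; rfl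

theorem derMu_x (i j : Fin θ) : D.derMu hmu i (D.x 0 mu j) = if j = i then 1 else 0 := by
  refine Eq.trans ?_ (D.quot.der_x i j)
  rw [← projMu_x D hmu]; rfl

theorem derMu_one (i : Fin θ) : D.derMu hmu i 1 = 0 := by
  rw [← map_one (D.grp 0 mu), derMu_grp]

theorem annihilates_derMu_grp (i : Fin θ) (h : G) : Annihilates (D.derMu hmu i) (D.grp 0 mu h) :=
  annihilates_of_groupLike (D.isGroupLikeElem_grp 0 mu h) (D.derMu_grp hmu i h)

theorem annihilates_derMu_x {i j : Fin θ} (hj : j ≠ i) :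
    Annihilates (D.derMu hmu i) (D.x 0 mu j) :=
  annihilates_of_skew (D.comul_x 0 mu j) (D.derMu_one hmu i) (D.derMu_grp hmu i _)
    (by rw [derMu_x, if_neg hj])

theorem evalLeft_grp_linkCocycleMu (h : G) :
    evalLeft (D.grp 0 mu h) (D.linkCocycleMu lam mu hmu) = 1 := by
  have h1 := D.quot.evalLeft_grp_linkCocycle (lam := lam) (h : G ⧸ D.G₀)
  rw [← projMu_grp D hmu] at h1
  refine Eq.trans ?_ (map_one (HopfDeformation.pullback k (D.projMuCoalgHom hmu)))
  rw [← h1]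
  rfl

theorem evalLeft_x_linkCocycleMu (hlam : ∀ i j, i < j → D.χ i * D.χ j ≠ 1 → lam i j = 0)
    (i : Fin θ) :
    evalLeft (D.x 0 mu i) (D.linkCocycleMu lam mu hmu) =
      ∑ l ∈ Finset.univ.filter fun l => i < l, lam i l • D.derMu hmu l := by
  have h1 := evalLeft_x_linkCocycle (quot_linked hlam) i
  rw [← projMu_x D hmu] at h1
  have h2 := congrArg (HopfDeformation.pullback k (D.projMuCoalgHom hmu)) h1
  rw [map_sum, Finset.sum_congr rfl fun l _ => map_smul _ _ _] at h2
  exact h2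

variable (hlam : ∀ i j, i < j → D.χ i * D.χ j ≠ 1 → lam i j = 0)

local notation "ρ" => toDeformed (D.isMulCocycle_linkCocycleMu hmu hlam)

theorem linkDeformed_grp_mul (h : G) (b : D.U 0 mu) :
    ρ (D.grp 0 mu h) * ρ b = ρ (D.grp 0 mu h * b) :=
  D.toDeformed_grp_mul _ (D.evalLeft_grp_linkCocycleMu hmu) h b

theorem linkDeformed_x_mul (i : Fin θ) (b : D.U 0 mu) : ρ (D.x 0 mu i) * ρ b =
    ρ (D.x 0 mu i * b + ∑ l ∈ Finset.univ.filter fun l => i < l,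
      lam i l • (actLeft (D.derMu hmu l) b - D.grp 0 mu (D.g i) * actRight (D.derMu hmu l) b)) := by
  rw [D.toDeformed_x_mul _ (D.evalLeft_grp_linkCocycleMu hmu), D.evalLeft_x_linkCocycleMu hmu hlam,
    actLeft_sum, actRight_sum, Finset.mul_sum, ← Finset.sum_sub_distrib]
  simp only [actLeft_smul, actRight_smul, mul_smul_comm, smul_sub]

theorem linkDeformed_x_mul_of_annihilates (i : Fin θ) {b : D.U 0 mu}
    (hb : ∀ l, i < l → Annihilates (D.derMu hmu l) b) :
    ρ (D.x 0 mu i) * ρ b = ρ (D.x 0 mu i * b) := by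
  rw [linkDeformed_x_mul D hmu hlam, Finset.sum_eq_zero, add_zero]
  intro l hl
  have h := hb l (Finset.mem_filter.1 hl).2
  rw [h.1, h.2, mul_zero, sub_zero, smul_zero]

/-- The only functional `dₗ` with `l > i` that does not annihilate `xⱼ` is `dⱼ`; it yields the linking
relation. -/
theorem linkDeformed_x_mul_x {i j : Fin θ} (hij : i < j) : ρ (D.x 0 mu i) * ρ (D.x 0 mu j) =
    ρ (D.x 0 mu i * D.x 0 mu j + lam i j • (1 - D.grp 0 mu (D.g i * D.g j))) := by
  rw [linkDeformed_x_mul D hmu hlam, Finset.sum_eq_single j]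
  · rw [actLeft_of_skew _ (D.comul_x 0 mu j), actRight_of_skew _ (D.comul_x 0 mu j), derMu_x,
      derMu_grp, derMu_one, if_pos rfl, map_mul]
    simp
  · intro l _ hl
    have h := D.annihilates_derMu_x hmu hl.symm
    rw [h.1, h.2, mul_zero, sub_zero, smul_zero]
  · intro h
    exact absurd (Finset.mem_filter.2 ⟨Finset.mem_univ j, hij⟩) h

theorem linkDeformed_x_pow_mul (i : Fin θ) (m : ℕ) {b : D.U 0 mu}
    (hb : ∀ l, i < l → Annihilates (D.derMu hmu l) b) :
    ρ (D.x 0 mu i) ^ m * ρ b = ρ (D.x 0 mu i ^ m * b) := by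
  induction m with
  | zero => rw [pow_zero, pow_zero, one_mul, one_mul]
  | succ m ih =>
    rw [pow_succ', mul_assoc, ih, linkDeformed_x_mul_of_annihilates D hmu hlam i fun l hl => ?_,
      ← mul_assoc, ← pow_succ']
    exact ((D.annihilates_derMu_x hmu hl.ne).pow (D.derMu_mul hmu l) (D.derMu_one hmu l) m).mul
      (D.derMu_mul hmu l) (hb l hl)

/-- The homomorphism from `u(D, λ, μ)` to the deformation of `u(D, 0, μ)` by the linking
cocycle. -/
def linkHom : D.U lam mu →ₐ[k] Deformed (D.isMulCocycle_linkCocycleMu hmu hlam) :=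
  lift
    { toFun := fun h => ρ (D.grp 0 mu h)
      map_one' := by rw [map_one]; rfl
      map_mul' := fun h h' => by rw [linkDeformed_grp_mul D hmu hlam, map_mul] }
    (fun i => ρ (D.x 0 mu i))
    (fun h i => by
      change ρ (D.grp 0 mu h) * ρ (D.x 0 mu i) = _ • (ρ (D.x 0 mu i) * ρ (D.grp 0 mu h))
      rw [linkDeformed_grp_mul D hmu hlam, linkDeformed_x_mul_of_annihilates D hmu hlam i
        (fun l _ => D.annihilates_derMu_grp hmu l h), grp_mul_x, map_smul])
    (fun i j hij => by
      change _ = _ + _ • (1 - ρ (D.grp 0 mu (D.g i * D.g j)))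
      rw [linkDeformed_x_mul_x D hmu hlam hij,
        linkDeformed_x_mul_of_annihilates D hmu hlam j
          (fun l hl => D.annihilates_derMu_x hmu (hij.trans hl).ne),
        D.x_mul_x_zero mu hij.ne, map_add, map_smul, map_smul, map_sub, toDeformed_one])
    (fun i => by
      change ρ (D.x 0 mu i) ^ D.N i = mu i • (1 - ρ (D.grp 0 mu (D.g i ^ D.N i)))
      have h := D.linkDeformed_x_pow_mul hmu hlam i (D.N i) (b := 1)
        fun l _ => annihilates_of_groupLike isGroupLikeElem_one (D.derMu_one hmu l)
      rw [toDeformed_one, mul_one, mul_one, x_pow] at h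
      rw [h, map_smul, map_sub, toDeformed_one])

theorem linkHom_grp (h : G) : D.linkHom hmu hlam (D.grp lam mu h) = ρ (D.grp 0 mu h) := lift_grp h

theorem linkHom_x (i : Fin θ) : D.linkHom hmu hlam (D.x lam mu i) = ρ (D.x 0 mu i) := lift_x i

theorem annihilates_derMu_list {i : Fin θ} (a : Fin θ → ℕ) {l : List (Fin θ)} (hi : i ∉ l)
    (h : G) :
    Annihilates (D.derMu hmu i) ((l.map fun j => D.x 0 mu j ^ a j).prod * D.grp 0 mu h) := by
  refine (Annihilates.list_prod (D.derMu_mul hmu i) (D.derMu_one hmu i) fun y hy => ?_).mul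
    (D.derMu_mul hmu i) (D.annihilates_derMu_grp hmu i h)
  obtain ⟨j, hj, rfl⟩ := List.mem_map.1 hy
  exact (D.annihilates_derMu_x hmu (i := i) (j := j) fun e => hi (by rw [← e]; exact hj)).pow
    (D.derMu_mul hmu i) (D.derMu_one hmu i) _

/-- On monomials in decreasing order the two multiplications agree: a factor `xᵢ` on the left only
interacts with the `xₗ` for `l > i`. -/
theorem linkHom_list (a : Fin θ → ℕ) {l : List (Fin θ)} (hl : l.Pairwise (· > ·)) (h : G) :
    D.linkHom hmu hlam ((l.map fun j => D.x lam mu j ^ a j).prod * D.grp lam mu h) =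
      ρ ((l.map fun j => D.x 0 mu j ^ a j).prod * D.grp 0 mu h) := by
  induction l with
  | nil => simpa using D.linkHom_grp hmu hlam h
  | cons i l ih =>
    obtain ⟨h1, h2⟩ := List.pairwise_cons.1 hl
    rw [List.map_cons, List.prod_cons, mul_assoc, map_mul, ih h2, map_pow, linkHom_x,
      linkDeformed_x_pow_mul D hmu hlam i _ fun j hj =>
        D.annihilates_derMu_list hmu a (fun hjl => (h1 j hjl).asymm hj) h,
      List.map_cons, List.prod_cons, mul_assoc]

end Link

/-! ### The isomorphism from the deformation of `A` to `u(D, λ, μ)` -/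

section Main

variable [CharZero k] (hmu : ∀ i, D.χ i ^ D.N i ≠ 1 → mu i = 0)
  (hlam : ∀ i j, i < j → D.χ i * D.χ j ≠ 1 → lam i j = 0)

/-- Surjective because of the monomials in decreasing order, and injective for reasons of
dimension. -/
theorem bijective_linkHom : Function.Bijective (D.linkHom hmu hlam) := by
  refine bijective_of_surjective_of_finrank_le (f := (D.linkHom hmu hlam).toLinearMap) ?_ ?_
  · have h : (⊤ : Submodule k (D.U 0 mu)).map
        (toDeformed (D.isMulCocycle_linkCocycleMu hmu hlam) : D.U 0 mu →ₗ[k] _) ≤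
        LinearMap.range (D.linkHom hmu hlam).toLinearMap := by
      rw [← D.listSpan_eq_top, listSpan, Submodule.map_span_le]
      rintro _ ⟨p, rfl⟩
      exact ⟨_, D.linkHom_list hmu hlam (fun i => p.1 i) pairwise_reverse_finRange p.2⟩
    exact fun a => h ⟨_, Submodule.mem_top,
      (toDeformed (D.isMulCocycle_linkCocycleMu hmu hlam)).apply_symm_apply a⟩
  · exact D.finrank_U_le.trans (D.pbwEquiv hmu).toLinearEquiv.finrank_eq.le

/-- The isomorphism of coalgebras from `u(D, λ, μ)` to the deformation of `u(D, 0, μ)` by the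
linking cocycle. -/
def linkEquiv : D.U lam mu ≃ₗc[k] Deformed (D.isMulCocycle_linkCocycleMu hmu hlam) :=
  CoalgEquiv.ofBijective (f := D.toDeformedCoalgHom (D.isMulCocycle_linkCocycleMu hmu hlam)
    (D.linkHom hmu hlam) (D.linkHom_grp hmu hlam) (D.linkHom_x hmu hlam))
    (D.bijective_linkHom hmu hlam)

/-- The isomorphism of coalgebras `A → u(D, λ, μ)`. -/
def sigmaEquiv : D.A ≃ₗc[k] D.U lam mu :=
  (D.pbwEquiv hmu).trans ((toDeformed (D.isMulCocycle_linkCocycleMu hmu hlam)).trans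
    (D.linkEquiv hmu hlam).symm)

theorem linkHom_sigmaEquiv (a : D.A) : D.linkHom hmu hlam (D.sigmaEquiv hmu hlam a) =
    toDeformed (D.isMulCocycle_linkCocycleMu hmu hlam) (D.pbwEquiv hmu a) :=
  (D.linkEquiv hmu hlam).apply_symm_apply _

theorem sigma_eq : D.sigma lam mu hmu =
    pullback₂ (D.pbwEquiv hmu : D.A →ₗc[k] D.U 0 mu) (D.linkCocycleMu lam mu hmu) *
      D.rootCocycle mu := by
  rw [sigma]
  congr 1
  refine conv_ext_tmul fun a b => ?_
  rw [pullback₂_tmul, CoalgEquiv.coe_toCoalgHom, pbwEquiv_apply, pbwEquiv_apply]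
  rfl

theorem isMulCocycle_sigma (hlam : ∀ i j, i < j → D.χ i * D.χ j ≠ 1 → lam i j = 0) :
    IsMulCocycle (D.sigma lam mu hmu) := by
  rw [sigma_eq]
  exact (D.isMulCocycle_rootCocycle hmu).comp (D.isMulCocycle_linkCocycleMu hmu hlam) _
    (D.pbwEquiv_one hmu) (D.pbwEquiv_deformedMul hmu)

theorem sigmaEquiv_deformedMul (a b : D.A) :
    D.sigmaEquiv hmu hlam (deformedMul (D.sigma lam mu hmu) (a ⊗ₜ[k] b)) =
      D.sigmaEquiv hmu hlam a * D.sigmaEquiv hmu hlam b := by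
  refine (D.bijective_linkHom hmu hlam).1 ?_
  have h := map_deformedMul_comp (D.isMulCocycle_rootCocycle hmu).isUnit
    (D.isMulCocycle_linkCocycleMu hmu hlam).isUnit _ (D.pbwEquiv_deformedMul hmu) a b
  rw [map_mul, linkHom_sigmaEquiv, linkHom_sigmaEquiv, linkHom_sigmaEquiv, sigma_eq,
    toDeformed_mul]
  exact congrArg _ h

theorem sigmaEquiv_grp (h : G) : D.sigmaEquiv hmu hlam (D.grp 0 0 h) = D.grp lam mu h :=
  (D.bijective_linkHom hmu hlam).1 (by rw [linkHom_sigmaEquiv, pbwEquiv_grp, linkHom_grp])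

theorem sigmaEquiv_x (i : Fin θ) : D.sigmaEquiv hmu hlam (D.x 0 0 i) = D.x lam mu i :=
  (D.bijective_linkHom hmu hlam).1 (by rw [linkHom_sigmaEquiv, pbwEquiv_x, linkHom_x])

theorem sigmaEquiv_one : D.sigmaEquiv hmu hlam 1 = 1 := by
  rw [← map_one (D.grp 0 0), sigmaEquiv_grp, map_one]

end Main

end QLSDatum

end

theorem mainTheorem5 {k G : Type*} [Field k] [CharZero k] [CommGroup G] [Finite G] {θ : ℕ}
    (D : QLSDatum k G θ) (lam : Fin θ → Fin θ → k) (mu : Fin θ → k)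
    (hlam : ∀ i j, i < j → D.χ i * D.χ j ≠ 1 → lam i j = 0)
    (hmu : ∀ i, D.χ i ^ D.N i ≠ 1 → mu i = 0) :
    HopfDeformation.IsMulCocycle (D.sigma lam mu hmu) ∧
    ∃ Φ : D.A ≃ₗc[k] D.U lam mu,
      Φ 1 = 1 ∧
      (∀ a b : D.A, Φ (HopfDeformation.deformedMul (D.sigma lam mu hmu) (a ⊗ₜ[k] b)) = Φ a * Φ b) ∧
      (∀ a : D.A, Φ (HopfDeformation.deformedAntipode (D.sigma lam mu hmu) a) =
        HopfAlgebra.antipode k (Φ a)) ∧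
      (∀ h : G, Φ (D.grp 0 0 h) = D.grp lam mu h) ∧
      (∀ i : Fin θ, Φ (D.x 0 0 i) = D.x lam mu i) :=
  ⟨D.isMulCocycle_sigma hmu hlam, D.sigmaEquiv hmu hlam, D.sigmaEquiv_one hmu hlam,
    D.sigmaEquiv_deformedMul hmu hlam,
    HopfDeformation.map_deformedAntipode (D.isMulCocycle_sigma hmu hlam) _
      (D.sigmaEquiv_one hmu hlam) (D.sigmaEquiv_deformedMul hmu hlam),
    D.sigmaEquiv_grp hmu hlam, D.sigmaEquiv_x hmu hlam⟩
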